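/- **Setting.** Let $A>0$, $\Omega=(-A,A)^3\subset\mathbb R^3$ with points $\mathbf x=(x,y,z)$, and let $n$ be the outward unit normal on $\partial\Omega$. All functions are real valued. For vector functions with $N$ components, $\|U\|_{H^m_N}^2=\sum_{k=1}^N\|u_k\|_{H^m}^2$. Let $$L(U)=\Delta U+A_1(\mathbf x)U_x+A_2(\mathbf x)U_y+A_3(\mathbf x)U_z+A_0(\mathbf x)U$$ with $N\times N$ matrices $A_j$ continuous on $\overline\Omega$; the norm of $A_j$ is the square root of the sum of the squares of the maximum norms of its entries. Problem 1 has Cauchy data on $S=\{|x|,|y|<A,\ z=-A\}$, Problem 2 on $S=\{|x|,|y|<A,\ z=A\}$. In each problem, consider the boundary conditions $$U=\varphi_0,\quad \partial_nU=\varphi_1\ \text{ on } S,\qquad \partial_nU=0\ \text{ on the other five faces of }\Omega. \tag{1}$$ Let $H^3_{0,N}(\Omega)$ be the space of all $V\in H^3_N(\Omega)$ such that $V=0$ on $S$ and $\partial_nV=0$ on all faces of $\Omega$ except the one opposite to $S$. For $F\in H^3_N(\Omega)$ and $\gamma\in(0,1)$, the minimization problem is to minimize $$J_\gamma(V)=\int_\Omega|L(V+F)|^2\,d\mathbf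 x+\gamma\|V\|^2_{H^3_N(\Omega)}\quad\text{over } V\in H^3_{0,N}(\Omega).$$ For $\varepsilon\in(0,A)$ let $\Omega_\varepsilon=\Omega\cap\{z<A-\varepsilon\}$ in Problem 1 and $\Omega_\varepsilon=\Omega\cap\{z>-A+\varepsilon\}$ in Problem 2. **Theorem 7.2.** For every $A>0$ and $M$ there is a constant $B>0$ such that for every $\varepsilon\in(0,A)$ there are $\delta_0\in(0,1)$ and $\alpha\in(0,1/2)$ with the following property, for both problems, every $N$, and every operator $L$ as above whose coefficient matrices have norms at most $M$. Suppose that $U^*\in H^3_N(\Omega)$ satisfies $L(U^*)=0$ in $\Omega$ and the conditions (1) with (noiseless) data $\varphi_0^*,\varphi_1^*$; that $F^*\in H^3_N(\Omega)$ satisfies (1) with the same data $\varphi_0^*,\varphi_1^*$; that $F\in H^3_N(\Omega)$ satisfies (1) with (noisy) data $\varphi_0,\varphi_1$; and that, for some $\delta\in(0,\delta_0)$, $$\|F-F^*\|_{H^2_N(\Omega)}\le\delta .$$ Then, for $\gamma=\delta^2$, the functional $J_{\delta^2}$ has a minimizer on $H^3_{0,N}(\Omega)$, and for every minimizer $V_{\min,\delta}$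 the function $U_{\min,\delta}=V_{\min,\delta}+F$ satisfies $$\|U_{\min,\delta}-U^*\|_{H^2_N(\Omega_\varepsilon)}\le B\left(1+\|U^*\|_{H^3_N(\Omega)}+\|F^*\|_{H^3_N(\Omega)}\right)\delta^{\alpha}.$$ -/

import Mathlib

open MeasureTheory Set
open scoped ContDiff ENNReal

noncomputable section

namespace QRM

/-! ### Domains -/

/-- Points `(x, y, z)` of `ℝ³`; the coordinates `x, y, z` have the indices `0, 1, 2`. -/
abbrev E3 : Type := Fin 3 → ℝ

/-- The cube `Ω = {(x, y, z) : -A < x, y, z < A}`. -/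
def cube (A : ℝ) : Set E3 := {x | ∀ i, x i ∈ Ioo (-A) A}

/-- The closed cube. -/
def closedCube (A : ℝ) : Set E3 := {x | ∀ i, x i ∈ Icc (-A) A}

/-- The open square `(-A, A)²`, which parametrizes every face of the cube. -/
def square (A : ℝ) : Set (Fin 2 → ℝ) := {y | ∀ j, y j ∈ Ioo (-A) A}

/-- The point of the hyperplane `{x i = c}` whose other two coordinates, in order, are `y`. -/
def facePoint (i : Fin 3) (c : ℝ) (y : Fin 2 → ℝ) : E3 :=
  Fin.insertNth (α := fun _ => ℝ) i c y

/-- The two possible positions of the surface `S` that carries the Cauchy data: the backscattering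
side `{z = -A}` (first problem) or the transmitted side `{z = A}` (second problem). -/
inductive Surface where
  | bsc : Surface
  | tr : Surface

/-- The sign `σ` such that `S ⊆ {z = σ A}`. The outward normal on `S` is `σ e_z`. -/
def Surface.sign : Surface → ℝ
  | .bsc => -1
  | .tr => 1

/-- The part of the cube whose distance to the face opposite to `S` is more than `ε`:
`{z < A - ε}` if `S` is the side `{z = -A}`, and `{z > -A + ε}` if `S` is the side `{z = A}`. -/
def subdomain (A ε : ℝ) : Surface → Set E3
  | .bsc => {x ∈ cube A | x 2 < A - ε}
  | .tr => {x ∈ cube A | -A + ε < x 2}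

/-! ### Weak derivatives and Sobolev spaces -/

/-- The classical partial derivative `∂φ/∂x_i`. -/
def partialDeriv (i : Fin 3) (φ : E3 → ℝ) : E3 → ℝ :=
  fun x => fderiv ℝ φ x (Pi.single i 1)

/-- The classical derivative `∂^α φ` for a multi-index `α`. -/
def multiDeriv (α : Fin 3 → ℕ) (φ : E3 → ℝ) : E3 → ℝ :=
  (partialDeriv 0)^[α 0] ((partialDeriv 1)^[α 1] ((partialDeriv 2)^[α 2] φ))

/-- `φ ∈ C_c^∞(D)`. -/
def IsTestFunction (D : Set E3) (φ : E3 → ℝ) : Prop :=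
  ContDiff ℝ ∞ φ ∧ HasCompactSupport φ ∧ tsupport φ ⊆ D

/-- `v ∈ L²(D)` is the weak derivative `∂^α u` on the open set `D`. -/
def HasWeakDeriv (D : Set E3) (α : Fin 3 → ℕ) (u v : E3 → ℝ) : Prop :=
  MemLp v 2 (volume.restrict D) ∧
    ∀ φ, IsTestFunction D φ →
      ∫ x in D, u x * multiDeriv α φ x = (-1) ^ (∑ i, α i) * ∫ x in D, v x * φ x

open Classical in
/-- The weak derivative `∂^α u ∈ L²(D)` (unique almost everywhere on `D`); `0` if there is none. -/
def weakDeriv (D : Set E3) (α : Fin 3 → ℕ) (u : E3 → ℝ) : E3 → ℝ :=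
  if h : ∃ v, HasWeakDeriv D α u v then h.choose else 0

/-- The multi-indices `α` with `|α| ≤ m`. -/
def multiIndices (m : ℕ) : Finset (Fin 3 → ℕ) :=
  (Fintype.piFinset fun _ => Finset.range (m + 1)).filter fun α => ∑ i, α i ≤ m

/-- `u ∈ H^m(D)`: `u` and all its weak derivatives of order at most `m` are in `L²(D)`. -/
def MemSobolev (D : Set E3) (m : ℕ) (u : E3 → ℝ) : Prop :=
  MemLp u 2 (volume.restrict D) ∧ ∀ α ∈ multiIndices m, ∃ v, HasWeakDeriv D α u v

/-- `‖u‖²` in `H^m(D)`: the sum over `|α| ≤ m` of the integrals of `(∂^α u)²`. -/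
def sobolevNormSq (D : Set E3) (m : ℕ) (u : E3 → ℝ) : ℝ :=
  ∑ α ∈ multiIndices m, ∫ x in D, weakDeriv D α u x ^ 2

/-- `U = (u_1, …, u_N) ∈ H_N^m(D)`. -/
def MemSobolevVec {N : ℕ} (D : Set E3) (m : ℕ) (U : Fin N → E3 → ℝ) : Prop :=
  ∀ n, MemSobolev D m (U n)

/-- The norm of `H_N^m(D)`. -/
def sobolevNormVec {N : ℕ} (D : Set E3) (m : ℕ) (U : Fin N → E3 → ℝ) : ℝ :=
  Real.sqrt (∑ n, sobolevNormSq D m (U n))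

/-! ### Boundary values -/

/-- For `u ∈ H¹(Ω)`: the trace of `u` on the face `{x i = σ A}` of the cube (`σ = ±1`) is the
function `t ∈ L²` of the two other coordinates. The trace is given by Green's formula,
in which the outward normal on this face is `σ e_i`, and the smooth function `φ` is zero on the
opposite face (on the other four faces the `i`-th component of the normal is zero). -/
def HasTrace (A : ℝ) (i : Fin 3) (σ : ℝ) (u : E3 → ℝ) (t : (Fin 2 → ℝ) → ℝ) : Prop :=
  MemLp t 2 (volume.restrict (square A)) ∧
    ∀ φ : E3 → ℝ, ContDiff ℝ ∞ φ → (∀ y ∈ square A, φ (facePoint i (-(σ * A)) y) = 0) →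
      ∫ x in cube A, (u x * partialDeriv i φ x + weakDeriv (cube A) (Pi.single i 1) u x * φ x) =
        σ * ∫ y in square A, t y * φ (facePoint i (σ * A) y)

/-- For `u ∈ H²(Ω)`: the outward normal derivative `σ ∂u/∂x_i` on the face `{x i = σ A}` is `g`,
that is, the trace of `∂u/∂x_i` there is `σ g`. -/
def HasNormalDeriv (A : ℝ) (i : Fin 3) (σ : ℝ) (u : E3 → ℝ) (g : (Fin 2 → ℝ) → ℝ) : Prop :=
  HasTrace A i σ (weakDeriv (cube A) (Pi.single i 1) u) fun y => σ * g y

/-- `∂u/∂n = 0` on the four lateral faces `{x = ±A}`, `{y = ±A}` of the cube. -/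
def LateralNeumann (A : ℝ) (u : E3 → ℝ) : Prop :=
  ∀ i : Fin 3, i ≠ 2 → ∀ σ : ℝ, σ = 1 ∨ σ = -1 → HasNormalDeriv A i σ u 0

/-- All boundary conditions of the boundary value problem with Cauchy data on `S`: `U = φ₀` and
`∂U/∂n = φ₁` on `S`, and `∂U/∂n = 0` on the five other faces. -/
def BoundaryConditions {N : ℕ} (A : ℝ) (S : Surface) (φ₀ φ₁ : Fin N → (Fin 2 → ℝ) → ℝ)
    (U : Fin N → E3 → ℝ) : Prop :=
  ∀ n, HasTrace A 2 S.sign (U n) (φ₀ n) ∧ HasNormalDeriv A 2 S.sign (U n) (φ₁ n) ∧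
    LateralNeumann A (U n) ∧ HasNormalDeriv A 2 (-S.sign) (U n) 0

/-- The space `H_{0,bsc,N}^3(Ω)` or `H_{0,tr,N}^3(Ω)`: each component is in `H³(Ω)`, is zero on
`S`, and has zero normal derivative on all faces except the one opposite to `S`. -/
def zeroSpace (N : ℕ) (A : ℝ) (S : Surface) : Set (Fin N → E3 → ℝ) :=
  {V | ∀ n, MemSobolev (cube A) 3 (V n) ∧ HasTrace A 2 S.sign (V n) 0 ∧
    HasNormalDeriv A 2 S.sign (V n) 0 ∧ LateralNeumann A (V n)}

/-! ### The elliptic system -/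

/-- The coefficients of the operator
`L(U) = ΔU + A₁(x) U_x + A₂(x) U_y + A₃(x) U_z + A₀(x) U`: the `N × N` matrices `A₁, A₂, A₃`
(`first 0`, `first 1`, `first 2`) and `A₀` (`zeroth`), continuous on the closed cube. -/
structure EllipticSystem (A : ℝ) (N : ℕ) where
  first : Fin 3 → E3 → Matrix (Fin N) (Fin N) ℝ
  zeroth : E3 → Matrix (Fin N) (Fin N) ℝ
  first_continuous : ∀ j, ContinuousOn (first j) (closedCube A)
  zeroth_continuous : ContinuousOn zeroth (closedCube A)

/-- The norm of a matrix function in `C_{N²}` of the closed cube: the square root of the sum of the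
squares of the maximum norms of the entries. -/
def matrixNorm {N : ℕ} (A : ℝ) (K : E3 → Matrix (Fin N) (Fin N) ℝ) : ℝ :=
  Real.sqrt (∑ n, ∑ m, (sSup ((fun x => |K x n m|) '' closedCube A)) ^ 2)

/-- The norms of all four coefficient matrices of `L` are at most `M`. -/
def EllipticSystem.NormLE {A : ℝ} {N : ℕ} (L : EllipticSystem A N) (M : ℝ) : Prop :=
  (∀ j, matrixNorm A (L.first j) ≤ M) ∧ matrixNorm A L.zeroth ≤ M

/-- The `n`-th component of `L(U)`, for `U ∈ H_N^2(Ω)`. -/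
def EllipticSystem.apply {A : ℝ} {N : ℕ} (L : EllipticSystem A N) (U : Fin N → E3 → ℝ)
    (n : Fin N) (x : E3) : ℝ :=
  (∑ i, weakDeriv (cube A) (Pi.single i 2) (U n) x) +
    (∑ j, ∑ m, L.first j x n m * weakDeriv (cube A) (Pi.single j 1) (U m) x) +
    ∑ m, L.zeroth x n m * U m x

/-- The functional `J_γ(V) = ∫_Ω |L(V + F)|² dx + γ ‖V‖²_{H_N^3(Ω)}`. -/
def EllipticSystem.functional {A : ℝ} {N : ℕ} (L : EllipticSystem A N) (F : Fin N → E3 → ℝ)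
    (γ : ℝ) (V : Fin N → E3 → ℝ) : ℝ :=
  (∫ x in cube A, ∑ n, L.apply (V + F) n x ^ 2) + γ * sobolevNormVec (cube A) 3 V ^ 2

/-- `V` minimizes `J_γ` on `H_{0,bsc,N}^3(Ω)`, or on `H_{0,tr,N}^3(Ω)`. -/
def EllipticSystem.IsMinimizer {A : ℝ} {N : ℕ} (L : EllipticSystem A N) (S : Surface)
    (F : Fin N → E3 → ℝ) (γ : ℝ) (V : Fin N → E3 → ℝ) : Prop :=
  V ∈ zeroSpace N A S ∧ IsMinOn (L.functional F γ) (zeroSpace N A S) V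

end QRM

end

open QRM

noncomputable section

namespace QRM

/-! ### Domains -/

/-! Put `W = V_min - (U* - F*)`. The boundary data cancel in `U* - F*`, so `W` lies in the zero
space, and `U_min - U* = W + (F - F*)`, where the last term is `O(δ)` in `H²`. It remains to bound
`W` on `Ω_ε`.

Two bounds come from comparing the minimizer with the competitor `U* - F*`
(`EllipticSystem.IsMinimizer.bounds`). Since `L(U*) = 0`, the residual of the competitor is `L(F -
F*) = O(δ)`, so the functional is `O(δ²)` at the minimizer. Hence `‖L(W)‖ = O(δ)` in `L²`, and,
after division by `γ = δ²`, `‖W‖ = O(1)` in `H³` and so in `H²`. The rate then follows from Hölder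
stability of the Cauchy problem (`holder_stability`): a function with zero Cauchy data on `S`, zero
lateral Neumann data, small `L(W)` and bounded `H²` norm is small on `Ω_ε`.

Stability rests on a Carleman estimate with weight `exp(-2λψ(t))`, where `t` is the distance to `S`
and `ψ` is concave and increasing on the relevant interval. Because the weight depends on `t` alone
and the lateral conditions are of Neumann type, the estimate separates. Cosine expansion in the two
lateral variables turns the Laplacian into the operators `u'' - K²u`, with `K` the length of the
frequency vector. Each factors as `(∂ + K)(∂ - K)`, and two uses of a first-order weighted
inequality (`weighted_first_order_estimate`) give an estimate with constants uniform in `K` and `λ ≥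
1` (`carleman_mode`). Parseval sums the modes (`carleman_box`). Traces are Green identities, and
these are applied directly to products of modes with functions of `t` (`isModal_of_zeroComponent`),
so no approximation of Sobolev functions by smooth ones is needed.

Nothing is known on the face opposite to `S`, so `W` is first multiplied by a cutoff in `t` that
vanishes near this face. For large `λ` the lower-order terms of `L` are absorbed, and the commutator
lives where the weight is exponentially smaller than on `Ω_ε` (`localized_estimate`,
`exponential_stability`). Choosing `λ` proportional to `log(1/δ)` balances the two contributions.
Constants are swallowed by giving up part of the exponent and taking `δ₀` small, which is why `B`
can be universal.

A minimizer exists by projection in a Hilbert space (`IsAffineCond.exists_minimizer`). A candidate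
is replaced by the tuple of its residual and all its weak derivatives up to order three. Being such
a tuple is a family of continuous affine equations in a product of `L²` spaces
(`EllipticSystem.isAffineCond_isJet`), and the functional is a weighted squared norm there. Since
the competitor `U* - F*` makes this closed convex set nonempty, it has an element of least norm. -/

lemma isOpen_cube (A : ℝ) : IsOpen (cube A) := by
  have : cube A = ⋂ i, (fun x : E3 => x i) ⁻¹' Ioo (-A) A := by
    ext x; simp [cube]
  rw [this]
  exact isOpen_iInter_of_finite fun i => isOpen_Ioo.preimage (continuous_apply i)

lemma isOpen_subdomain (A ε : ℝ) (S : Surface) : IsOpen (subdomain A ε S) := by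
  cases S
  · exact (isOpen_cube A).inter (isOpen_lt (continuous_apply 2) continuous_const)
  · exact (isOpen_cube A).inter (isOpen_lt continuous_const (continuous_apply 2))

lemma subdomain_subset (A ε : ℝ) (S : Surface) : subdomain A ε S ⊆ cube A := by
  cases S <;> exact fun x hx => hx.1

lemma cube_subset_closedCube (A : ℝ) : cube A ⊆ closedCube A :=
  fun _ hx i => Ioo_subset_Icc_self (hx i)

lemma isCompact_closedCube (A : ℝ) : IsCompact (closedCube A) := by
  have : closedCube A = Set.pi univ fun _ => Icc (-A) A := by
    ext x; simp only [closedCube, Set.mem_pi, mem_ofPred_eq, mem_univ, true_implies]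
  rw [this]
  exact isCompact_univ_pi fun _ => isCompact_Icc

lemma measurableSet_cube (A : ℝ) : MeasurableSet (cube A) := (isOpen_cube A).measurableSet

lemma volume_cube_lt_top (A : ℝ) : volume (cube A) < ⊤ :=
  (measure_mono (cube_subset_closedCube A)).trans_lt (isCompact_closedCube A).measure_lt_top

instance isFiniteMeasure_cube (A : ℝ) : IsFiniteMeasure (volume.restrict (cube A)) :=
  ⟨by simpa using volume_cube_lt_top A⟩

lemma _root_.MeasureTheory.MemLp.integrable_fun_mul {X : Type*} [MeasurableSpace X] {μ : Measure X}
    {f g : X → ℝ} (hf : MemLp f 2 μ) (hg : MemLp g 2 μ) : Integrable (fun x => f x * g x) μ :=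
  hf.integrable_mul hg

/-! ### Derivatives of smooth functions -/

lemma contDiff_partialDeriv {φ : E3 → ℝ} (h : ContDiff ℝ ∞ φ) (i : Fin 3) :
    ContDiff ℝ ∞ (partialDeriv i φ) :=
  (h.fderiv_right (m := ∞) le_rfl).clm_apply contDiff_const

lemma tsupport_partialDeriv_subset (φ : E3 → ℝ) (i : Fin 3) :
    tsupport (partialDeriv i φ) ⊆ tsupport φ := by
  refine (closure_mono ?_).trans (tsupport_fderiv_subset ℝ (f := φ))
  intro x hx
  simp only [Function.mem_support, partialDeriv] at hx ⊢
  intro h; exact hx (by simp [h])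

lemma IsTestFunction.partialDeriv {D : Set E3} {φ : E3 → ℝ} (h : IsTestFunction D φ) (i : Fin 3) :
    IsTestFunction D (partialDeriv i φ) :=
  ⟨contDiff_partialDeriv h.1 i,
    h.2.1.of_isClosed_subset (isClosed_tsupport _) (tsupport_partialDeriv_subset φ i),
    (tsupport_partialDeriv_subset φ i).trans h.2.2⟩

lemma partialDeriv_comm {φ : E3 → ℝ} (h : ContDiff ℝ ∞ φ) (i j : Fin 3) :
    partialDeriv i (partialDeriv j φ) = partialDeriv j (partialDeriv i φ) := by
  have hd : Differentiable ℝ (fderiv ℝ φ) := (h.fderiv_right (m := ∞) le_rfl).differentiable (by simp)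
  have key : ∀ (i j : Fin 3) (x : E3), partialDeriv i (partialDeriv j φ) x =
      fderiv ℝ (fderiv ℝ φ) x (Pi.single i 1) (Pi.single j 1) := by
    intro i j x
    have : fderiv ℝ (partialDeriv j φ) x =
        (fderiv ℝ (fderiv ℝ φ) x).flip (Pi.single j 1) := by
      have := ((hd x).hasFDerivAt.clm_apply (hasFDerivAt_const (Pi.single j (1 : ℝ)) x)).fderiv
      ext v
      unfold partialDeriv
      rw [this]
      simp
    simp [partialDeriv, this]
  ext x
  rw [key, key]
  have : IsSymmSndFDerivAt ℝ φ x := (h.of_le (by norm_cast) : ContDiff ℝ 2 φ).contDiffAt.isSymmSndFDerivAt (by simp)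
  exact this _ _

lemma multiDeriv_zero (φ : E3 → ℝ) : multiDeriv 0 φ = φ := rfl

lemma multiDeriv_single (i : Fin 3) (φ : E3 → ℝ) :
    multiDeriv (Pi.single i 1) φ = partialDeriv i φ := by
  fin_cases i <;> rfl

lemma multiDeriv_single_add_single {φ : E3 → ℝ} (h : ContDiff ℝ ∞ φ) (i j : Fin 3) :
    multiDeriv (Pi.single i 1 + Pi.single j 1) φ = partialDeriv i (partialDeriv j φ) := by
  fin_cases i <;> fin_cases j <;> first | rfl | exact partialDeriv_comm h _ _

lemma IsTestFunction.iterate {D : Set E3} {φ : E3 → ℝ} (h : IsTestFunction D φ) (i : Fin 3)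
    (k : ℕ) : IsTestFunction D ((QRM.partialDeriv i)^[k] φ) := by
  induction k generalizing φ with
  | zero => exact h
  | succ k ih => exact ih (h.partialDeriv i)

lemma IsTestFunction.multiDeriv {D : Set E3} {φ : E3 → ℝ} (h : IsTestFunction D φ)
    (α : Fin 3 → ℕ) : IsTestFunction D (multiDeriv α φ) :=
  ((h.iterate 2 _).iterate 1 _).iterate 0 _

lemma IsTestFunction.memLp {D : Set E3} {φ : E3 → ℝ} (h : IsTestFunction D φ) :
    MemLp φ 2 (volume.restrict D) :=
  (h.1.continuous.memLp_of_hasCompactSupport h.2.1).restrict D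

/-! ### Weak derivatives -/

section WeakDeriv

variable {D D' : Set E3} {α : Fin 3 → ℕ} {u u' v v' w : E3 → ℝ}

lemma IsTestFunction.mono (h : D' ⊆ D) {φ : E3 → ℝ} (hφ : IsTestFunction D' φ) :
    IsTestFunction D φ := ⟨hφ.1, hφ.2.1, hφ.2.2.trans h⟩

lemma ae_eq_zero_of_integral_testFunction (hD : IsOpen D) (hu : MemLp u 2 (volume.restrict D))
    (h : ∀ φ, IsTestFunction D φ → ∫ x in D, u x * φ x = 0) : u =ᵐ[volume.restrict D] 0 := by
  have hloc : LocallyIntegrableOn u D :=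
    locallyIntegrableOn_of_locallyIntegrable_restrict (hu.locallyIntegrable one_le_two)
  have := hD.ae_eq_zero_of_integral_contDiff_smul_eq_zero (μ := volume) hloc ?_
  · rw [Filter.EventuallyEq, ae_restrict_iff' hD.measurableSet]
    exact this
  · intro g hg hgc hgs
    rw [← h g ⟨hg, hgc, hgs⟩, setIntegral_eq_integral_of_forall_compl_eq_zero]
    · simp_rw [smul_eq_mul, mul_comm]
    · intro x hx
      rw [image_eq_zero_of_notMem_tsupport fun h' => hx (hgs h'), mul_zero]

lemma HasWeakDeriv.ae_unique (hD : IsOpen D) (hv : HasWeakDeriv D α u v)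
    (hw : HasWeakDeriv D α u w) : v =ᵐ[volume.restrict D] w := by
  have : v - w =ᵐ[volume.restrict D] 0 := by
    refine ae_eq_zero_of_integral_testFunction hD (hv.1.sub hw.1) fun φ hφ => ?_
    have h1 := hv.2 φ hφ
    rw [hw.2 φ hφ] at h1
    have h2 := mul_left_cancel₀ (pow_ne_zero _ (by norm_num)) h1
    simp only [Pi.sub_apply, sub_mul]
    rw [integral_sub (hv.1.integrable_fun_mul hφ.memLp) (hw.1.integrable_fun_mul hφ.memLp), h2, sub_self]
  filter_upwards [this] with x hx
  simpa [sub_eq_zero] using hx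

lemma hasWeakDeriv_weakDeriv (h : ∃ v, HasWeakDeriv D α u v) :
    HasWeakDeriv D α u (weakDeriv D α u) := by
  rw [weakDeriv, dif_pos h]; exact h.choose_spec

lemma HasWeakDeriv.weakDeriv_ae_eq (hD : IsOpen D) (h : HasWeakDeriv D α u v) :
    weakDeriv D α u =ᵐ[volume.restrict D] v :=
  (hasWeakDeriv_weakDeriv ⟨v, h⟩).ae_unique hD h

lemma HasWeakDeriv.congr_left (h : HasWeakDeriv D α u v) (hu : u =ᵐ[volume.restrict D] u') :
    HasWeakDeriv D α u' v := by
  refine ⟨h.1, fun φ hφ => ?_⟩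
  rw [← h.2 φ hφ]
  exact integral_congr_ae (hu.symm.mono fun x hx => by simp only [hx])

/-- The equality is literal, not only almost everywhere: `weakDeriv` is a choice made from the
predicate `HasWeakDeriv D α u`, which sees only the almost-everywhere class of `u`. -/
lemma weakDeriv_congr (hu : u =ᵐ[volume.restrict D] u') :
    weakDeriv D α u = weakDeriv D α u' := by
  have : HasWeakDeriv D α u = HasWeakDeriv D α u' := by
    ext v; exact ⟨fun h => h.congr_left hu, fun h => h.congr_left hu.symm⟩
  unfold weakDeriv
  rw [this]

lemma HasWeakDeriv.mono (h : D' ⊆ D) (hv : HasWeakDeriv D α u v) :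
    HasWeakDeriv D' α u v := by
  refine ⟨hv.1.mono_measure (Measure.restrict_mono h le_rfl), fun φ hφ => ?_⟩
  have key : ∀ (f ψ : E3 → ℝ), IsTestFunction D' ψ →
      ∫ x in D', f x * ψ x = ∫ x in D, f x * ψ x := by
    intro f ψ hψ
    have h0 : ∀ x, x ∉ D' → f x * ψ x = 0 := fun x hx => by
      rw [image_eq_zero_of_notMem_tsupport fun h' => hx (hψ.2.2 h'), mul_zero]
    rw [setIntegral_eq_integral_of_forall_compl_eq_zero h0,
      setIntegral_eq_integral_of_forall_compl_eq_zero fun x hx => h0 x fun h' => hx (h h')]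
  rw [key _ _ (hφ.multiDeriv α), key _ _ hφ]
  exact hv.2 φ (hφ.mono h)

lemma HasWeakDeriv.add (hu : MemLp u 2 (volume.restrict D)) (hu' : MemLp u' 2 (volume.restrict D))
    (h : HasWeakDeriv D α u v) (h' : HasWeakDeriv D α u' v') :
    HasWeakDeriv D α (u + u') (v + v') := by
  refine ⟨h.1.add h'.1, fun φ hφ => ?_⟩
  simp only [Pi.add_apply, add_mul]
  rw [integral_add (hu.integrable_fun_mul (hφ.multiDeriv α).memLp)
    (hu'.integrable_fun_mul (hφ.multiDeriv α).memLp),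
    integral_add (h.1.integrable_fun_mul hφ.memLp) (h'.1.integrable_fun_mul hφ.memLp),
    h.2 φ hφ, h'.2 φ hφ, mul_add]

lemma HasWeakDeriv.neg (h : HasWeakDeriv D α u v) : HasWeakDeriv D α (-u) (-v) := by
  refine ⟨h.1.neg, fun φ hφ => ?_⟩
  simp only [Pi.neg_apply, neg_mul, integral_neg, h.2 φ hφ, mul_neg]

lemma HasWeakDeriv.sub (hu : MemLp u 2 (volume.restrict D)) (hu' : MemLp u' 2 (volume.restrict D))
    (h : HasWeakDeriv D α u v) (h' : HasWeakDeriv D α u' v') :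
    HasWeakDeriv D α (u - u') (v - v') := by
  rw [sub_eq_add_neg, sub_eq_add_neg]
  exact h.add hu hu'.neg h'.neg

lemma hasWeakDeriv_zero (hu : MemLp u 2 (volume.restrict D)) : HasWeakDeriv D 0 u u :=
  ⟨hu, fun φ _ => by simp [multiDeriv_zero]⟩

/-- If `v = ∂u/∂x_i` and `w = ∂²u/∂x_i∂x_j`, then `w = ∂v/∂x_j`. -/
lemma HasWeakDeriv.of_second {i j : Fin 3} (hv : HasWeakDeriv D (Pi.single i 1) u v)
    (hw : HasWeakDeriv D (Pi.single i 1 + Pi.single j 1) u w) :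
    HasWeakDeriv D (Pi.single j 1) v w := by
  refine ⟨hw.1, fun φ hφ => ?_⟩
  have h1 := hv.2 _ (hφ.partialDeriv j)
  have h2 := hw.2 φ hφ
  rw [multiDeriv_single] at h1 ⊢
  rw [multiDeriv_single_add_single hφ.1, h1] at h2
  simp only [Pi.add_apply, Finset.sum_add_distrib, Finset.sum_pi_single', Finset.mem_univ,
    if_true] at h2 ⊢
  rw [Fintype.sum_pi_single'] at h1
  simp only [pow_one, neg_one_mul, one_add_one_eq_two, even_two, Even.neg_pow, one_pow,
    one_mul] at h1 h2 ⊢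
  linarith

end WeakDeriv

/-! ### Products of functions of one coordinate -/

/-- The function `g₀(x₀) g₁(x₁) g₂(x₂)`. -/
def tensor (g : Fin 3 → ℝ → ℝ) (x : E3) : ℝ := ∏ j, g j (x j)

lemma contDiff_tensor {g : Fin 3 → ℝ → ℝ} (hg : ∀ j, ContDiff ℝ ∞ (g j)) :
    ContDiff ℝ ∞ (tensor g) :=
  contDiff_prod fun j _ => (hg j).comp (contDiff_apply ℝ ℝ j)

lemma continuous_tensor {g : Fin 3 → ℝ → ℝ} (hg : ∀ j, Continuous (g j)) :
    Continuous (tensor g) :=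
  continuous_finsetProd _ fun j _ => (hg j).comp (continuous_apply j)

lemma tensor_update (g : Fin 3 → ℝ → ℝ) (i : Fin 3) (p : ℝ → ℝ) (x : E3) :
    tensor (Function.update g i p) x = p (x i) * ∏ j ∈ Finset.univ.erase i, g j (x j) := by
  rw [tensor, ← Finset.mul_prod_erase _ _ (Finset.mem_univ i), Function.update_self]
  congr 1
  refine Finset.prod_congr rfl fun j hj => ?_
  rw [Function.update_of_ne (Finset.ne_of_mem_erase hj)]

lemma tensor_eq (g : Fin 3 → ℝ → ℝ) (i : Fin 3) (x : E3) :
    tensor g x = g i (x i) * ∏ j ∈ Finset.univ.erase i, g j (x j) := by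
  rw [← tensor_update, Function.update_eq_self]

lemma partialDeriv_tensor {g : Fin 3 → ℝ → ℝ} (hg : ∀ j, Differentiable ℝ (g j)) (i : Fin 3) :
    partialDeriv i (tensor g) = tensor (Function.update g i (deriv (g i))) := by
  ext x
  have hd : DifferentiableAt ℝ (tensor g) x := by
    unfold tensor
    fun_prop
  have hl : HasDerivAt (fun t : ℝ => Function.update x i t) (Pi.single i 1) (x i) :=
    hasDerivAt_update x i (x i)
  have h1 : HasDerivAt (fun t => tensor g (Function.update x i t))
      (partialDeriv i (tensor g) x) (x i) := by
    have h := hd.hasFDerivAt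
    rw [← Function.update_eq_self i x] at h
    have := h.comp_hasDerivAt (x i) hl
    rwa [Function.update_eq_self] at this
  have h2 : (fun t => tensor g (Function.update x i t)) =
      fun t => g i t * ∏ j ∈ Finset.univ.erase i, g j (x j) := by
    ext t
    rw [tensor_eq g i, Function.update_self]
    congr 1
    refine Finset.prod_congr rfl fun j hj => ?_
    rw [Function.update_of_ne (Finset.ne_of_mem_erase hj)]
  rw [h2] at h1
  rw [tensor_update]
  exact h1.unique (((hg i) (x i)).hasDerivAt.mul_const _)

lemma abs_tensor_le {g : Fin 3 → ℝ → ℝ} {B : ℝ} {x : E3} (h : ∀ j, |g j (x j)| ≤ B) :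
    |tensor g x| ≤ B ^ 3 := by
  rw [tensor, Finset.abs_prod]
  refine (Finset.prod_le_prod (fun _ _ => abs_nonneg _) fun j _ => h j).trans ?_
  simp

lemma memLp_of_continuous {A : ℝ} {φ : E3 → ℝ} (h : Continuous φ) :
    MemLp φ 2 (volume.restrict (cube A)) := by
  obtain ⟨C, hC⟩ := (isCompact_closedCube A).exists_bound_of_continuousOn h.continuousOn
  refine MemLp.of_bound h.aestronglyMeasurable C ?_
  filter_upwards [ae_restrict_mem (measurableSet_cube A)] with x hx
  exact hC x (cube_subset_closedCube A hx)

lemma tendsto_integral_tensor {A B : ℝ} {f : E3 → ℝ} (hf : MemLp f 2 (volume.restrict (cube A)))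
    {G : ℕ → Fin 3 → ℝ → ℝ} {g : Fin 3 → ℝ → ℝ} (hG : ∀ n j, Continuous (G n j))
    (hB : ∀ n j, ∀ y ∈ Ioo (-A) A, |G n j y| ≤ B)
    (hlim : ∀ j, ∀ y ∈ Ioo (-A) A, Filter.Tendsto (fun n => G n j y) Filter.atTop (nhds (g j y))) :
    Filter.Tendsto (fun n => ∫ x in cube A, f x * tensor (G n) x) Filter.atTop
      (nhds (∫ x in cube A, f x * tensor g x)) := by
  refine tendsto_integral_of_dominated_convergence (fun x => |f x| * B ^ 3) ?_ ?_ ?_ ?_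
  · exact fun n => hf.1.mul (continuous_tensor (hG n)).aestronglyMeasurable
  · exact ((hf.integrable one_le_two).abs).mul_const _
  · intro n
    filter_upwards [ae_restrict_mem (measurableSet_cube A)] with x hx
    rw [Real.norm_eq_abs, abs_mul]
    exact mul_le_mul_of_nonneg_left (abs_tensor_le fun j => hB n j _ (hx j)) (abs_nonneg _)
  · filter_upwards [ae_restrict_mem (measurableSet_cube A)] with x hx
    exact (tendsto_finsetProd _ fun j _ => hlim j _ (hx j)).const_mul _

/-! ### Cutoff functions on an interval -/

/-- A smooth function equal to `1` at distance at least `2 / (n + 1)` from the end points of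
`(-A, A)` and to `0` at distance at most `1 / (n + 1)`. -/
def cutoff (A : ℝ) (n : ℕ) (x : ℝ) : ℝ :=
  Real.smoothTransition ((n + 1) * (A - x) - 1) * Real.smoothTransition ((n + 1) * (A + x) - 1)

lemma contDiff_cutoff (A : ℝ) (n : ℕ) : ContDiff ℝ ∞ (cutoff A n) := by
  unfold cutoff
  exact (Real.smoothTransition.contDiff.comp (by fun_prop)).mul
    (Real.smoothTransition.contDiff.comp (by fun_prop))

lemma cutoff_nonneg (A : ℝ) (n : ℕ) (x : ℝ) : 0 ≤ cutoff A n x :=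
  mul_nonneg (Real.smoothTransition.nonneg _) (Real.smoothTransition.nonneg _)

lemma cutoff_le_one (A : ℝ) (n : ℕ) (x : ℝ) : cutoff A n x ≤ 1 :=
  mul_le_one₀ (Real.smoothTransition.le_one _) (Real.smoothTransition.nonneg _)
    (Real.smoothTransition.le_one _)

lemma tsupport_cutoff_subset (A : ℝ) (n : ℕ) :
    tsupport (cutoff A n) ⊆ Icc (-A + 1 / (n + 1)) (A - 1 / (n + 1)) := by
  refine closure_minimal (fun x hx => ?_) isClosed_Icc
  have hn : (0 : ℝ) < n + 1 := by positivity
  have h1 : 0 < (n + 1) * (A - x) - 1 := by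
    by_contra h
    exact hx (by simp [cutoff, Real.smoothTransition.zero_of_nonpos (not_lt.1 h)])
  have h2 : 0 < (n + 1) * (A + x) - 1 := by
    by_contra h
    exact hx (by simp [cutoff, Real.smoothTransition.zero_of_nonpos (not_lt.1 h)])
  have h3 : 1 / ((n : ℝ) + 1) < A - x := by rw [div_lt_iff₀ hn]; linarith
  have h4 : 1 / ((n : ℝ) + 1) < A + x := by rw [div_lt_iff₀ hn]; linarith
  constructor <;> linarith

lemma cutoff_eventuallyEq_one {A : ℝ} {n : ℕ} {x : ℝ} (h1 : 2 < (n + 1) * (A - x))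
    (h2 : 2 < (n + 1) * (A + x)) : cutoff A n =ᶠ[nhds x] fun _ => 1 := by
  have c1 : ∀ᶠ y in nhds x, 2 < ((n : ℝ) + 1) * (A - y) :=
    (by fun_prop : Continuous fun y : ℝ => ((n : ℝ) + 1) * (A - y)).continuousAt.eventually_const_lt h1
  have c2 : ∀ᶠ y in nhds x, 2 < ((n : ℝ) + 1) * (A + y) :=
    (by fun_prop : Continuous fun y : ℝ => ((n : ℝ) + 1) * (A + y)).continuousAt.eventually_const_lt h2
  filter_upwards [c1, c2] with y hy1 hy2
  rw [cutoff, Real.smoothTransition.one_of_one_le (by linarith),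
    Real.smoothTransition.one_of_one_le (by linarith), one_mul]

lemma eventually_cutoff_eventuallyEq_one {A x : ℝ} (hx : x ∈ Ioo (-A) A) :
    ∀ᶠ n : ℕ in Filter.atTop, cutoff A n =ᶠ[nhds x] fun _ => 1 := by
  have key : ∀ c : ℝ, 0 < c → ∀ᶠ n : ℕ in Filter.atTop, 2 < ((n : ℝ) + 1) * c := by
    intro c hc
    have : Filter.Tendsto (fun n : ℕ => ((n : ℝ) + 1) * c) Filter.atTop Filter.atTop :=
      (Filter.tendsto_atTop_add_const_right _ _ tendsto_natCast_atTop_atTop).atTop_mul_const hc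
    exact this.eventually_gt_atTop 2
  filter_upwards [key (A - x) (by linarith [hx.2]), key (A + x) (by linarith [hx.1])] with n h1 h2
  exact cutoff_eventuallyEq_one h1 h2

lemma exists_abs_deriv_smoothTransition_le : ∃ K, 0 ≤ K ∧ ∀ x, |deriv Real.smoothTransition x| ≤ K := by
  have hc : Continuous (deriv Real.smoothTransition) :=
    (Real.smoothTransition.contDiff (n := 1)).continuous_deriv le_rfl
  obtain ⟨K, hK⟩ := isCompact_Icc (a := (0 : ℝ)) (b := 1) |>.exists_bound_of_continuousOn
    hc.continuousOn
  refine ⟨max K 0, le_max_right _ _, fun x => ?_⟩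
  by_cases hx : x ∈ Icc (0 : ℝ) 1
  · exact (hK x hx).trans (le_max_left _ _)
  · have : deriv Real.smoothTransition x = 0 := by
      rw [mem_Icc, not_and_or, not_le, not_le] at hx
      rcases hx with hx | hx
      · have : Real.smoothTransition =ᶠ[nhds x] fun _ => 0 := by
          filter_upwards [Iio_mem_nhds hx] with y hy
          exact Real.smoothTransition.zero_of_nonpos (le_of_lt hy)
        rw [this.deriv_eq, deriv_const]
      · have : Real.smoothTransition =ᶠ[nhds x] fun _ => 1 := by
          filter_upwards [Ioi_mem_nhds hx] with y hy
          exact Real.smoothTransition.one_of_one_le (le_of_lt hy)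
        rw [this.deriv_eq, deriv_const]
    simp [this]

lemma exists_abs_deriv_cutoff_le (A : ℝ) :
    ∃ K, 0 ≤ K ∧ ∀ n : ℕ, ∀ x, |deriv (cutoff A n) x| ≤ K * (n + 1) := by
  obtain ⟨K, hK0, hK⟩ := exists_abs_deriv_smoothTransition_le
  refine ⟨2 * K, by positivity, fun n x => ?_⟩
  have hs : Differentiable ℝ Real.smoothTransition :=
    (Real.smoothTransition.contDiff (n := 1)).differentiable one_ne_zero
  have h1 : HasDerivAt (fun x : ℝ => ((n : ℝ) + 1) * (A - x) - 1) (-((n : ℝ) + 1)) x := by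
    simpa using (((hasDerivAt_id x).const_sub A).const_mul ((n : ℝ) + 1)).sub_const 1
  have h2 : HasDerivAt (fun x : ℝ => ((n : ℝ) + 1) * (A + x) - 1) ((n : ℝ) + 1) x := by
    simpa using (((hasDerivAt_id x).const_add A).const_mul ((n : ℝ) + 1)).sub_const 1
  have h := ((hs _).hasDerivAt.comp x h1).mul ((hs _).hasDerivAt.comp x h2)
  have h' : HasDerivAt (cutoff A n) _ x := h
  rw [h'.deriv]
  have hn : (0 : ℝ) ≤ n + 1 := by positivity
  have b1 : ∀ y, |Real.smoothTransition y| ≤ 1 := fun y => by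
    rw [abs_of_nonneg (Real.smoothTransition.nonneg _)]; exact Real.smoothTransition.le_one _
  refine (abs_add_le _ _).trans ?_
  simp only [Function.comp, abs_mul, abs_neg, abs_of_nonneg hn]
  have e1 := mul_le_mul (mul_le_mul_of_nonneg_right (hK ((n + 1) * (A - x) - 1)) hn)
    (b1 ((n + 1) * (A + x) - 1)) (abs_nonneg _) (by positivity)
  have e2 := mul_le_mul (b1 ((n + 1) * (A - x) - 1))
    (mul_le_mul_of_nonneg_right (hK ((n + 1) * (A + x) - 1)) hn) (by positivity) zero_le_one
  linarith

/-- The derivative of the cutoff is `O(n)` but lives only within `2 / (n + 1)` of the end points,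
where `|s| = O(1 / n)` because `s` vanishes there. The bound, uniform in `n`, is what dominated
convergence needs in `HasWeakDeriv.green`. -/
lemma exists_abs_deriv_mul_cutoff_le {A : ℝ} {s : ℝ → ℝ} (hs : ContDiff ℝ ∞ s) (h1 : s A = 0)
    (h2 : s (-A) = 0) :
    ∃ B, ∀ n : ℕ, ∀ x ∈ Ioo (-A) A, |deriv (fun y => s y * cutoff A n y) x| ≤ B := by
  obtain ⟨K, hK0, hK⟩ := exists_abs_deriv_cutoff_le A
  have hsd : Differentiable ℝ s := hs.differentiable (by simp)
  obtain ⟨C, hC⟩ := isCompact_Icc (a := -A) (b := A) |>.exists_bound_of_continuousOn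
    (hs.continuous_deriv (by simp)).continuousOn
  refine ⟨C + 2 * C * K, fun n x hx => ?_⟩
  have hxI := Ioo_subset_Icc_self hx
  have hC0 : 0 ≤ C := (norm_nonneg _).trans (hC x hxI)
  have lip : ∀ y ∈ Icc (-A) A, s y = 0 → |s x| ≤ C * |x - y| := by
    intro y hy h0
    have := (convex_Icc (-A) A).norm_image_sub_le_of_norm_deriv_le (f := s) (C := C)
      (fun z _ => hsd z) hC hy hxI
    simpa [h0] using this
  have hA : -A ≤ A := hxI.1.trans hxI.2
  have l1 := lip A (right_mem_Icc.2 hA) h1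
  have l2 := lip (-A) (left_mem_Icc.2 hA) h2
  rw [abs_of_nonpos (a := x - A) (by linarith [hx.2])] at l1
  rw [abs_of_nonneg (a := x - -A) (by linarith [hx.1])] at l2
  have hη := (contDiff_cutoff A n).differentiable (by simp)
  have hd : HasDerivAt (fun y => s y * cutoff A n y) _ x := (hsd x).hasDerivAt.mul (hη x).hasDerivAt
  rw [hd.deriv]
  refine (abs_add_le _ _).trans (add_le_add ?_ ?_)
  · rw [abs_mul, abs_of_nonneg (cutoff_nonneg _ _ _)]
    calc |deriv s x| * cutoff A n x ≤ C * 1 :=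
          mul_le_mul (hC x hxI) (cutoff_le_one _ _ _) (cutoff_nonneg _ _ _) hC0
      _ = C := mul_one C
  · by_cases hb : 2 < (n + 1) * (A - x) ∧ 2 < (n + 1) * (A + x)
    · rw [(cutoff_eventuallyEq_one hb.1 hb.2).deriv_eq]
      simp only [deriv_const, mul_zero, abs_zero]
      positivity
    · have hb' : |s x| * (n + 1) ≤ 2 * C := by
        have hn : (0 : ℝ) ≤ n + 1 := by positivity
        rw [not_and_or, not_lt, not_lt] at hb
        rcases hb with hb | hb
        · nlinarith [mul_le_mul_of_nonneg_right l1 hn, mul_le_mul_of_nonneg_left hb hC0]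
        · nlinarith [mul_le_mul_of_nonneg_right l2 hn, mul_le_mul_of_nonneg_left hb hC0]
      rw [abs_mul]
      nlinarith [mul_le_mul_of_nonneg_left (hK n x) (abs_nonneg (s x)),
        mul_le_mul_of_nonneg_right hb' hK0]

/-! ### Green's identities -/

section Green

variable {A : ℝ} {i : Fin 3} {f f' : E3 → ℝ} {g : Fin 3 → ℝ → ℝ}

lemma contDiff_deriv {s : ℝ → ℝ} (hs : ContDiff ℝ ∞ s) : ContDiff ℝ ∞ (deriv s) :=
  ((contDiff_infty_iff_deriv (𝕜 := ℝ)).1 hs).2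

lemma contDiff_update (hg : ∀ j, ContDiff ℝ ∞ (g j)) {p : ℝ → ℝ} (hp : ContDiff ℝ ∞ p) (j : Fin 3) :
    ContDiff ℝ ∞ (Function.update g i p j) := by
  by_cases h : j = i
  · subst h; simpa using hp
  · simpa [Function.update_of_ne h] using hg j

/-- Integration by parts in the direction `x_i` against a product function that vanishes on the two
faces orthogonal to `e_i`. -/
lemma HasWeakDeriv.green (hf : MemLp f 2 (volume.restrict (cube A)))
    (h : HasWeakDeriv (cube A) (Pi.single i 1) f f') (hg : ∀ j, ContDiff ℝ ∞ (g j))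
    (h1 : g i A = 0) (h2 : g i (-A) = 0) :
    ∫ x in cube A, (f x * tensor (Function.update g i (deriv (g i))) x + f' x * tensor g x) = 0 := by
  -- Cutting off in all three coordinates gives genuine test functions. Only the `i`-th factor is
  -- differentiated, and it is the one assumed to vanish at both ends; for the others boundedness is
  -- enough to pass to the limit.
  set G : ℕ → Fin 3 → ℝ → ℝ := fun n j y => g j y * cutoff A n y with hG
  have hGc : ∀ n j, ContDiff ℝ ∞ (G n j) := fun n j => (hg j).mul (contDiff_cutoff A n)
  have hGt : ∀ n, IsTestFunction (cube A) (tensor (G n)) := by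
    intro n
    set K : Set E3 := Set.pi univ fun _ => Icc (-A + 1 / ((n : ℝ) + 1)) (A - 1 / (n + 1))
    have hK : IsCompact K := isCompact_univ_pi fun _ => isCompact_Icc
    have hsub : tsupport (tensor (G n)) ⊆ K := by
      refine closure_minimal (fun x hx j _ => ?_) hK.isClosed
      refine tsupport_cutoff_subset A n (subset_closure fun h0 => hx ?_)
      exact Finset.prod_eq_zero (Finset.mem_univ j) (by simp only [hG]; rw [h0, mul_zero])
    refine ⟨contDiff_tensor (hGc n), hK.of_isClosed_subset (isClosed_tsupport _) hsub,
      hsub.trans fun x hx j => ?_⟩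
    have hn : (0 : ℝ) < 1 / (n + 1) := by positivity
    have := hx j (mem_univ j)
    exact ⟨by linarith [this.1], by linarith [this.2]⟩
  obtain ⟨B1, hB1⟩ := exists_abs_deriv_mul_cutoff_le (hg i) h1 h2
  have hb : ∀ j, ∃ B, ∀ y ∈ Icc (-A) A, ‖g j y‖ ≤ B := fun j =>
    isCompact_Icc.exists_bound_of_continuousOn (hg j).continuous.continuousOn
  choose b hb using hb
  set B := B1 ⊔ Finset.univ.sup' Finset.univ_nonempty b
  have hbB : ∀ j, b j ≤ B := fun j =>
    (Finset.le_sup' b (Finset.mem_univ j)).trans le_sup_right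
  have hGB : ∀ n j, ∀ y ∈ Ioo (-A) A, |G n j y| ≤ B := by
    intro n j y hy
    refine le_trans ?_ ((hb j y (Ioo_subset_Icc_self hy)).trans (hbB j))
    rw [abs_mul, abs_of_nonneg (cutoff_nonneg A n y)]
    exact mul_le_of_le_one_right (abs_nonneg _) (cutoff_le_one _ _ _)
  have hGlim : ∀ j, ∀ y ∈ Ioo (-A) A,
      Filter.Tendsto (fun n => G n j y) Filter.atTop (nhds (g j y)) := by
    intro j y hy
    refine tendsto_const_nhds.congr' ?_
    filter_upwards [eventually_cutoff_eventuallyEq_one hy] with n hn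
    simp [hG, hn.eq_of_nhds]
  have L1 := tendsto_integral_tensor h.1 (fun n j => (hGc n j).continuous) hGB hGlim
  have L2 := tendsto_integral_tensor (B := B) hf
    (G := fun n => Function.update (G n) i (deriv (G n i)))
    (g := Function.update g i (deriv (g i)))
    (fun n j => (contDiff_update (hGc n) (contDiff_deriv (hGc n i)) j).continuous) ?_ ?_
  · have e : ∀ n, ∫ x in cube A, f x * tensor (Function.update (G n) i (deriv (G n i))) x =
        - ∫ x in cube A, f' x * tensor (G n) x := by
      intro n
      have := h.2 _ (hGt n)
      rw [multiDeriv_single, partialDeriv_tensor fun j => (hGc n j).differentiable (by simp),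
        Fintype.sum_pi_single'] at this
      simpa using this
    simp_rw [e] at L2
    have := tendsto_nhds_unique L2 L1.neg
    rw [integral_add, this, neg_add_cancel]
    · exact hf.integrable_fun_mul (memLp_of_continuous
        (contDiff_tensor (contDiff_update hg (contDiff_deriv (hg i)))).continuous)
    · exact h.1.integrable_fun_mul (memLp_of_continuous (contDiff_tensor hg).continuous)
  · intro n j y hy
    by_cases hj : j = i
    · subst hj
      simp only [Function.update_self]
      exact (hB1 n y hy).trans le_sup_left
    · simp only [Function.update_of_ne hj]
      exact hGB n j y hy
  · intro j y hy
    by_cases hj : j = i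
    · subst hj
      simp only [Function.update_self]
      refine tendsto_const_nhds.congr' ?_
      filter_upwards [eventually_cutoff_eventuallyEq_one hy] with n hn
      have : G n j =ᶠ[nhds y] g j := by
        filter_upwards [hn] with z hz
        simp [hG, hz]
      exact this.deriv_eq.symm
    · simp only [Function.update_of_ne hj]
      exact hGlim j y hy

lemma HasTrace.green {σ : ℝ} (h : HasTrace A i σ f 0) (hg : ∀ j, ContDiff ℝ ∞ (g j))
    (h0 : g i (-(σ * A)) = 0) :
    ∫ x in cube A, (f x * tensor (Function.update g i (deriv (g i))) x +
      weakDeriv (cube A) (Pi.single i 1) f x * tensor g x) = 0 := by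
  have := h.2 (tensor g) (contDiff_tensor hg) fun y _ => by
    rw [tensor_eq g i]
    simp [facePoint, h0]
  simpa [partialDeriv_tensor fun j => (hg j).differentiable (by simp)] using this

/-- If the traces on both faces orthogonal to `e_i` are zero, then integration by parts has no
boundary terms. -/
lemma green_of_hasTrace (hA : 0 < A) (hf : MemLp f 2 (volume.restrict (cube A)))
    (hf' : MemLp (weakDeriv (cube A) (Pi.single i 1) f) 2 (volume.restrict (cube A)))
    (h1 : HasTrace A i 1 f 0) (h2 : HasTrace A i (-1) f 0) (hg : ∀ j, ContDiff ℝ ∞ (g j)) :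
    ∫ x in cube A, (f x * tensor (Function.update g i (deriv (g i))) x +
      weakDeriv (cube A) (Pi.single i 1) f x * tensor g x) = 0 := by
  -- The weights `(A + y) / (2A)` and `(A - y) / (2A)` add up to `1`. The part `p` vanishes at `-A`
  -- and `q` at `A`, so each is admissible in the trace identity of the other face.
  set p : ℝ → ℝ := fun y => g i y * ((A + y) / (2 * A))
  set q : ℝ → ℝ := fun y => g i y * ((A - y) / (2 * A))
  have hp : ContDiff ℝ ∞ p := (hg i).mul (by fun_prop)
  have hq : ContDiff ℝ ∞ q := (hg i).mul (by fun_prop)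
  have hpq : g i = p + q := by
    ext y
    simp only [p, q, Pi.add_apply]
    field_simp
    ring
  have e1 := h1.green (contDiff_update (i := i) hg hp) (by simp [p])
  have e2 := h2.green (contDiff_update (i := i) hg hq) (by simp [q])
  simp only [Function.update_self, Function.update_idem] at e1 e2
  have int : ∀ r : ℝ → ℝ, ContDiff ℝ ∞ r → Integrable (fun x =>
      f x * tensor (Function.update g i (deriv r)) x +
      weakDeriv (cube A) (Pi.single i 1) f x * tensor (Function.update g i r) x)
      (volume.restrict (cube A)) := fun r hr =>
    (hf.integrable_fun_mul (memLp_of_continuous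
        (contDiff_tensor (contDiff_update hg (contDiff_deriv hr))).continuous)).add
      (hf'.integrable_fun_mul (memLp_of_continuous
        (contDiff_tensor (contDiff_update hg hr)).continuous))
  refine Eq.trans ?_ ((congrArg₂ (· + ·) e1 e2).trans (add_zero 0))
  rw [← integral_add (int p hp) (int q hq)]
  refine integral_congr_ae (.of_forall fun x => ?_)
  have hd : deriv (g i) = deriv p + deriv q := by
    rw [hpq]
    ext y
    exact deriv_add (hp.differentiable (by simp) y) (hq.differentiable (by simp) y)
  simp only [tensor_update, hd, tensor_eq g i x]
  rw [hpq]
  simp only [Pi.add_apply]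
  ring

end Green

/-! ### Cosine and sine series on an interval -/

lemma _root_.HasSum.congr_fun' {ι : Type*} {f g : ι → ℝ} {a : ℝ} (h : HasSum f a)
    (hfg : ∀ i, f i = g i) : HasSum g a := funext hfg ▸ h

/-- The function `cos (π k x / P)`. -/
def cosMode (P : ℝ) (k : ℤ) (x : ℝ) : ℝ := Real.cos (Real.pi * k / P * x)

/-- The function `sin (π k x / P)`. -/
def sinMode (P : ℝ) (k : ℤ) (x : ℝ) : ℝ := Real.sin (Real.pi * k / P * x)

section Parseval

variable {P : ℝ} {f : ℝ → ℝ}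

lemma fourier_neg_eq (k : ℤ) (x : ℝ) :
    (fourier (-k) (x : AddCircle (P - -P)) : ℂ) = cosMode P k x - sinMode P k x * Complex.I := by
  rw [fourier_coe_apply]
  have : 2 * Real.pi * Complex.I * ((-k : ℤ) : ℂ) * x / ((P - -P : ℝ) : ℂ) =
      ((-(Real.pi * k / P * x) : ℝ) : ℂ) * Complex.I := by
    push_cast
    by_cases hP : (P : ℂ) = 0
    · simp [hP]
    · field_simp
      ring
  rw [this, Complex.exp_mul_I, ← Complex.ofReal_cos, ← Complex.ofReal_sin, Real.cos_neg,
    Real.sin_neg, cosMode, sinMode]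
  push_cast
  ring

lemma continuous_cosMode (P : ℝ) (k : ℤ) : Continuous (cosMode P k) := by
  unfold cosMode; fun_prop

lemma continuous_sinMode (P : ℝ) (k : ℤ) : Continuous (sinMode P k) := by
  unfold sinMode; fun_prop

lemma abs_cosMode_le (P : ℝ) (k : ℤ) (x : ℝ) : |cosMode P k x| ≤ 1 := Real.abs_cos_le_one _

lemma abs_sinMode_le (P : ℝ) (k : ℤ) (x : ℝ) : |sinMode P k x| ≤ 1 := Real.abs_sin_le_one _

/-- Parseval's identity for the extension of `f` to `(-P, P)` that is even (`s = 1`) or odd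
(`s = -1`). -/
lemma hasSum_sq_reflection (hP : 0 < P) (hf : MemLp f 2 (volume.restrict (Ioo 0 P))) {s : ℝ}
    (hs : s ^ 2 = 1) :
    HasSum (fun k : ℤ => ‖∫ x in Ioo 0 P, ((f x : ℂ) * ((1 + s) * cosMode P k x -
      (1 - s) * sinMode P k x * Complex.I))‖ ^ 2) (4 * P * ∫ x in Ioo 0 P, f x ^ 2) := by
  have hPP : -P < P := by linarith
  set f0 : ℝ → ℝ := indicator (Ioo 0 P) f with hf0
  have hf0L : MemLp f0 2 volume := (memLp_indicator_iff_restrict measurableSet_Ioo).2 hf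
  have hf0N : MemLp (fun x => f0 (-x)) 2 volume :=
    hf0L.comp_measurePreserving (Measure.measurePreserving_neg volume)
  -- Since `f0` is zero off `(0, P)`, this sum is the reflected extension. Its Fourier coefficients
  -- on the circle of length `2P` pair `f` with `e(x) + s e(-x)`, that is, with a cosine or a sine.
  set g : ℝ → ℂ := fun x => ((f0 x + s * f0 (-x) : ℝ) : ℂ) with hg
  have hgL : MemLp g 2 volume := (hf0L.add (hf0N.const_mul s)).ofReal
  have hI : ∀ (h : ℝ → ℂ), (∀ x, x ∉ Ioo 0 P → h x = 0) →
      ∫ x in -P..P, h x = ∫ x in Ioo 0 P, h x := by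
    intro h h0
    rw [intervalIntegral.integral_of_le hPP.le, setIntegral_eq_integral_of_forall_compl_eq_zero,
      setIntegral_eq_integral_of_forall_compl_eq_zero h0]
    intro x hx
    exact h0 x fun hx' => hx ⟨by linarith [hx'.1], hx'.2.le⟩
  have hcoef : ∀ k : ℤ, fourierCoeffOn hPP g k = (1 / (2 * P) : ℝ) •
      ∫ x in Ioo 0 P, ((f x : ℂ) * ((1 + s) * cosMode P k x -
      (1 - s) * sinMode P k x * Complex.I)) := by
    intro k
    rw [fourierCoeffOn_eq_integral, show (1 : ℝ) / (P - -P) = 1 / (2 * P) by ring]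
    congr 1
    set e : ℝ → ℂ := fun x => cosMode P k x - sinMode P k x * Complex.I with he
    have hec : Continuous e := by
      have := continuous_cosMode P k
      have := continuous_sinMode P k
      fun_prop
    have hint : ∀ u : ℝ → ℝ, MemLp u 2 volume →
        IntervalIntegrable (fun x => e x * (u x : ℂ)) volume (-P) P := by
      intro u hu
      have h1 : Integrable (fun x => (u x : ℂ)) (volume.restrict (Icc (-P) P)) :=
        (hu.restrict _).integrable one_le_two |>.ofReal
      have h2 : IntervalIntegrable (fun x => (u x : ℂ)) volume (-P) P :=
        (intervalIntegrable_iff_integrableOn_Icc_of_le hPP.le).2 h1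
      exact h2.continuousOn_mul hec.continuousOn
    have step : ∫ x in -P..P, fourier (-k) (x : AddCircle (P - -P)) • g x =
        (∫ x in -P..P, e x * (f0 x : ℂ)) + s * ∫ x in -P..P, e x * (f0 (-x) : ℂ) := by
      rw [← intervalIntegral.integral_const_mul, ← intervalIntegral.integral_add (hint _ hf0L)
        ((hint _ hf0N).const_mul _)]
      refine intervalIntegral.integral_congr fun x _ => ?_
      simp only [fourier_neg_eq, hg, smul_eq_mul, he]
      push_cast
      ring
    have step2 : ∫ x in -P..P, e x * (f0 (-x) : ℂ) = ∫ x in -P..P, e (-x) * (f0 x : ℂ) := by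
      have := intervalIntegral.integral_comp_neg (a := -P) (b := P)
        (fun x => e (-x) * (f0 x : ℂ))
      simpa using this
    refine step.trans ?_
    rw [step2, hI, hI, ← integral_const_mul, ← integral_add]
    · refine setIntegral_congr_fun measurableSet_Ioo fun x hx => ?_
      have e1 : f0 x = f x := indicator_of_mem hx f
      have e2 : e (-x) = cosMode P k x + sinMode P k x * Complex.I := by
        simp [he, cosMode, sinMode]
      simp only [e1, e2]
      simp only [he]
      ring
    · exact ((intervalIntegrable_iff_integrableOn_Icc_of_le hPP.le).1 (hint _ hf0L)).mono_set
        fun x hx => ⟨by linarith [hx.1], hx.2.le⟩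
    · have h1 : Integrable (fun x => (f0 x : ℂ)) (volume.restrict (Icc (-P) P)) :=
        (hf0L.restrict _).integrable one_le_two |>.ofReal
      have h2 : IntervalIntegrable (fun x => (f0 x : ℂ)) volume (-P) P :=
        (intervalIntegrable_iff_integrableOn_Icc_of_le hPP.le).2 h1
      have h3 := (h2.continuousOn_mul (hec.comp continuous_neg).continuousOn).const_mul (s : ℂ)
      exact ((intervalIntegrable_iff_integrableOn_Icc_of_le hPP.le).1 h3).mono_set
        fun x hx => ⟨by linarith [hx.1], hx.2.le⟩
    · intro x hx
      simp [hf0, indicator_of_notMem hx]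
    · intro x hx
      simp [hf0, indicator_of_notMem hx]
  have hsum := hasSum_sq_fourierCoeffOn hPP (hgL.restrict _)
  simp_rw [hcoef] at hsum
  have hnorm : ∫ x in -P..P, ‖g x‖ ^ 2 = 2 * ∫ x in Ioo 0 P, f x ^ 2 := by
    have e0 : ∀ x, ‖g x‖ ^ 2 = f0 x ^ 2 + f0 (-x) ^ 2 := by
      intro x
      have : f0 x * f0 (-x) = 0 := by
        by_cases h : x ∈ Ioo 0 P
        · have : -x ∉ Ioo 0 P := fun h' => by linarith [h.1, h'.1]
          simp [hf0, indicator_of_notMem this]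
        · simp [hf0, indicator_of_notMem h]
      rw [hg, Complex.norm_real, Real.norm_eq_abs, sq_abs]
      linear_combination 2 * s * this + f0 (-x) ^ 2 * hs
    have h2 : ∫ x in -P..P, f0 (-x) ^ 2 = ∫ x in -P..P, f0 x ^ 2 := by
      have := intervalIntegral.integral_comp_neg (a := -P) (b := P) (fun x => f0 x ^ 2)
      simpa using this
    have h3 : ∫ x in -P..P, f0 x ^ 2 = ∫ x in Ioo 0 P, f x ^ 2 := by
      rw [intervalIntegral.integral_of_le hPP.le,
        setIntegral_eq_integral_of_forall_compl_eq_zero, ← integral_indicator measurableSet_Ioo]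
      · congr 1
        ext x
        by_cases h : x ∈ Ioo 0 P
        · simp [hf0, h]
        · simp [hf0, h]
      · intro x hx
        have : x ∉ Ioo 0 P := fun h => hx ⟨by linarith [h.1], h.2.le⟩
        simp [hf0, indicator_of_notMem this]
    simp_rw [e0]
    rw [intervalIntegral.integral_add, h2, h3, two_mul]
    · exact (intervalIntegrable_iff_integrableOn_Icc_of_le hPP.le).2 (hf0L.integrable_sq.restrict)
    · exact (intervalIntegrable_iff_integrableOn_Icc_of_le hPP.le).2 (hf0N.integrable_sq.restrict)
  rw [hnorm] at hsum
  have := hsum.mul_left (4 * P ^ 2)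
  have e : 4 * P ^ 2 * ((P - -P)⁻¹ • (2 * ∫ x in Ioo 0 P, f x ^ 2)) =
      4 * P * ∫ x in Ioo 0 P, f x ^ 2 := by
    rw [smul_eq_mul, show P - -P = 2 * P by ring]
    field_simp
  rw [e] at this
  refine this.congr_fun' fun k => ?_
  rw [norm_smul, mul_pow, Real.norm_eq_abs, sq_abs]
  have : ∀ z : ℝ, 4 * P ^ 2 * ((1 / (2 * P)) ^ 2 * z ^ 2) = z ^ 2 := by
    intro z
    field_simp
    ring
  exact this _

/-- The sum over all integers counts every nonconstant mode twice and the constant one once. This is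
exactly the normalization that gives the same constant `P` for all modes. -/
lemma hasSum_sq_cosMode (hP : 0 < P) (hf : MemLp f 2 (volume.restrict (Ioo 0 P))) :
    HasSum (fun k : ℤ => (∫ x in Ioo 0 P, f x * cosMode P k x) ^ 2)
      (P * ∫ x in Ioo 0 P, f x ^ 2) := by
  have := (hasSum_sq_reflection hP hf (s := 1) (by norm_num)).mul_left (1 / 4)
  rw [show 1 / 4 * (4 * P * ∫ x in Ioo 0 P, f x ^ 2) = P * ∫ x in Ioo 0 P, f x ^ 2 by ring] at this
  refine this.congr_fun' fun k => ?_
  · have : ∀ x, (f x : ℂ) * ((1 + (1 : ℝ)) * cosMode P k x -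
        (1 - (1 : ℝ)) * sinMode P k x * Complex.I) = ((2 * (f x * cosMode P k x) : ℝ) : ℂ) := by
      intro x; push_cast; ring
    simp_rw [this]
    rw [integral_complex_ofReal, Complex.norm_real, integral_const_mul, Real.norm_eq_abs, sq_abs]
    ring

lemma hasSum_sq_sinMode (hP : 0 < P) (hf : MemLp f 2 (volume.restrict (Ioo 0 P))) :
    HasSum (fun k : ℤ => (∫ x in Ioo 0 P, f x * sinMode P k x) ^ 2)
      (P * ∫ x in Ioo 0 P, f x ^ 2) := by
  have := (hasSum_sq_reflection hP hf (s := -1) (by norm_num)).mul_left (1 / 4)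
  rw [show 1 / 4 * (4 * P * ∫ x in Ioo 0 P, f x ^ 2) = P * ∫ x in Ioo 0 P, f x ^ 2 by ring] at this
  refine this.congr_fun' fun k => ?_
  · have : ∀ x, (f x : ℂ) * ((1 + (-1 : ℝ)) * cosMode P k x -
        (1 - (-1 : ℝ)) * sinMode P k x * Complex.I) =
        ((f x * sinMode P k x : ℝ) : ℂ) * (-2 * Complex.I) := by
      intro x; push_cast; ring
    simp_rw [this]
    rw [integral_mul_const, integral_complex_ofReal, norm_mul, Complex.norm_real, Real.norm_eq_abs,
      mul_pow, sq_abs]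
    simp
    ring

end Parseval

/-! ### Partial trigonometric series of functions of several variables -/

/-- A bounded family of continuous functions that satisfies Parseval's identity on `(0, P)`. -/
structure IsParseval (P : ℝ) (m : ℤ → ℝ → ℝ) : Prop where
  continuous : ∀ k, Continuous (m k)
  abs_le : ∀ k x, |m k x| ≤ 1
  hasSum : ∀ f : ℝ → ℝ, MemLp f 2 (volume.restrict (Ioo 0 P)) →
    HasSum (fun k => (∫ x in Ioo 0 P, f x * m k x) ^ 2) (P * ∫ x in Ioo 0 P, f x ^ 2)

lemma isParseval_cosMode {P : ℝ} (hP : 0 < P) : IsParseval P (cosMode P) :=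
  ⟨continuous_cosMode P, abs_cosMode_le P, fun _ hf => hasSum_sq_cosMode hP hf⟩

lemma isParseval_sinMode {P : ℝ} (hP : 0 < P) : IsParseval P (sinMode P) :=
  ⟨continuous_sinMode P, abs_sinMode_le P, fun _ hf => hasSum_sq_sinMode hP hf⟩

section Slices

variable {P : ℝ} {m : ℤ → ℝ → ℝ} {Y : Type*} [MeasurableSpace Y] {τ : Measure Y} [SFinite τ]
  {F : ℝ × Y → ℝ}

lemma IsParseval.tsum_eq (hm : IsParseval P m) (hP : 0 < P) {f : ℝ → ℝ}
    (hf : MemLp f 2 (volume.restrict (Ioo 0 P))) :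
    ∑' k, ENNReal.ofReal ((∫ x in Ioo 0 P, f x * m k x) ^ 2) =
      ENNReal.ofReal P * ∫⁻ x in Ioo 0 P, ENNReal.ofReal (f x ^ 2) := by
  have h := hm.hasSum f hf
  rw [← ENNReal.ofReal_tsum_of_nonneg (fun _ => sq_nonneg _) h.summable, h.tsum_eq,
    ENNReal.ofReal_mul hP.le, ofReal_integral_eq_lintegral_ofReal hf.integrable_sq
    (.of_forall fun _ => sq_nonneg _)]

lemma memLp_two_of_lintegral {X : Type*} [MeasurableSpace X] {μ : Measure X} {f : X → ℝ}
    (hf : AEStronglyMeasurable f μ) (h : ∫⁻ x, ENNReal.ofReal (f x ^ 2) ∂μ < ⊤) : MemLp f 2 μ := by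
  rw [memLp_two_iff_integrable_sq hf]
  refine ⟨hf.pow 2, ?_⟩
  rwa [hasFiniteIntegral_iff_ofReal (.of_forall fun _ => sq_nonneg _)]

lemma lintegral_ofReal_sq_lt_top {X : Type*} [MeasurableSpace X] {μ : Measure X} {f : X → ℝ}
    (hf : MemLp f 2 μ) : ∫⁻ x, ENNReal.ofReal (f x ^ 2) ∂μ < ⊤ := by
  have := hf.integrable_sq.2
  rwa [hasFiniteIntegral_iff_ofReal (.of_forall fun _ => sq_nonneg _)] at this

lemma ae_memLp_slice (hF : MemLp F 2 ((volume.restrict (Ioo 0 P)).prod τ)) :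
    ∀ᵐ y ∂τ, MemLp (fun x => F (x, y)) 2 (volume.restrict (Ioo 0 P)) := by
  have h1 : ∀ᵐ y ∂τ, AEStronglyMeasurable (fun x => F (x, y)) (volume.restrict (Ioo 0 P)) :=
    hF.1.prod_swap.prodMk_left
  have h2 : ∀ᵐ y ∂τ, Integrable (fun x => F (x, y) ^ 2) (volume.restrict (Ioo 0 P)) :=
    hF.integrable_sq.prod_left_ae
  filter_upwards [h1, h2] with y hy1 hy2
  exact (memLp_two_iff_integrable_sq hy1).2 hy2

lemma aestronglyMeasurable_slice (hm : IsParseval P m)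
    (hF : MemLp F 2 ((volume.restrict (Ioo 0 P)).prod τ)) (k : ℤ) :
    AEStronglyMeasurable (fun y => ∫ x in Ioo 0 P, F (x, y) * m k x) τ := by
  have : AEStronglyMeasurable (fun q : ℝ × Y => F q * m k q.1)
      ((volume.restrict (Ioo 0 P)).prod τ) :=
    hF.1.mul ((hm.continuous k).measurable.comp measurable_fst).aestronglyMeasurable
  exact this.prod_swap.integral_prod_right'

/-- Parseval on almost every slice, followed by Tonelli in `[0, ∞]`. A factor `ρ` that depends only
on the remaining variables passes through; this is how the Carleman weight survives the expansion.
-/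
lemma IsParseval.tsum_lintegral (hm : IsParseval P m) (hP : 0 < P)
    (hF : MemLp F 2 ((volume.restrict (Ioo 0 P)).prod τ)) {ρ : Y → ℝ≥0∞} (hρ : Measurable ρ) :
    ∑' k, ∫⁻ y, ρ y * ENNReal.ofReal ((∫ x in Ioo 0 P, F (x, y) * m k x) ^ 2) ∂τ =
      ENNReal.ofReal P * ∫⁻ q, ρ q.2 * ENNReal.ofReal (F q ^ 2)
        ∂((volume.restrict (Ioo 0 P)).prod τ) := by
  have hmeas : ∀ k, AEMeasurable (fun y => ρ y *
      ENNReal.ofReal ((∫ x in Ioo 0 P, F (x, y) * m k x) ^ 2)) τ := fun k =>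
    hρ.aemeasurable.mul
      ((aestronglyMeasurable_slice hm hF k).aemeasurable.pow_const 2).ennreal_ofReal
  have hFm : AEMeasurable (fun q : ℝ × Y => ρ q.2 * ENNReal.ofReal (F q ^ 2))
      ((volume.restrict (Ioo 0 P)).prod τ) :=
    (hρ.comp measurable_snd).aemeasurable.mul (hF.1.aemeasurable.pow_const 2).ennreal_ofReal
  rw [← lintegral_tsum hmeas, lintegral_prod_symm _ hFm, ← lintegral_const_mul' _ _
    ENNReal.ofReal_ne_top]
  refine lintegral_congr_ae ?_
  filter_upwards [ae_memLp_slice hF] with y hy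
  rw [ENNReal.tsum_mul_left, hm.tsum_eq hP hy, lintegral_const_mul'' _
    (hy.1.aemeasurable.pow_const 2).ennreal_ofReal]
  ring

/-- One term of the Parseval series is at most its finite sum. -/
lemma IsParseval.memLp_slice (hm : IsParseval P m) (hP : 0 < P)
    (hF : MemLp F 2 ((volume.restrict (Ioo 0 P)).prod τ)) (k : ℤ) :
    MemLp (fun y => ∫ x in Ioo 0 P, F (x, y) * m k x) 2 τ := by
  refine memLp_two_of_lintegral (aestronglyMeasurable_slice hm hF k) ?_
  have h := hm.tsum_lintegral hP hF (ρ := fun _ => 1) measurable_const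
  simp only [one_mul] at h
  refine (ENNReal.le_tsum (f := fun k => ∫⁻ y, ENNReal.ofReal
    ((∫ x in Ioo 0 P, F (x, y) * m k x) ^ 2) ∂τ) k).trans_lt ?_
  rw [h]
  exact ENNReal.mul_lt_top ENNReal.ofReal_lt_top (lintegral_ofReal_sq_lt_top hF)

end Slices

/-- Lebesgue measure on the cube `(0, P)³`. -/
def boxMeasure (P : ℝ) : Measure (ℝ × ℝ × ℝ) :=
  (volume.restrict (Ioo 0 P)).prod ((volume.restrict (Ioo 0 P)).prod (volume.restrict (Ioo 0 P)))

instance isFiniteMeasure_boxMeasure (P : ℝ) : IsFiniteMeasure (boxMeasure P) := by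
  unfold boxMeasure; infer_instance

/-- The coefficient of `F` with respect to `a(x) b(y)`, a function of the third variable. -/
def coef (P : ℝ) (a b : ℝ → ℝ) (F : ℝ × ℝ × ℝ → ℝ) (t : ℝ) : ℝ :=
  ∫ y in Ioo 0 P, (∫ x in Ioo 0 P, F (x, y, t) * a x) * b y

section Coef

variable {P : ℝ} {m n : ℤ → ℝ → ℝ} {F G : ℝ × ℝ × ℝ → ℝ}

lemma IsParseval.tsum_coef (hm : IsParseval P m) (hn : IsParseval P n) (hP : 0 < P)
    (hF : MemLp F 2 (boxMeasure P)) {ρ : ℝ → ℝ≥0∞} (hρ : Measurable ρ) :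
    ∑' k, ∑' l, ∫⁻ t in Ioo 0 P, ρ t * ENNReal.ofReal (coef P (m k) (n l) F t ^ 2) =
      ENNReal.ofReal P * ENNReal.ofReal P *
        ∫⁻ q, ρ q.2.2 * ENNReal.ofReal (F q ^ 2) ∂boxMeasure P := by
  have h1 := hm.tsum_lintegral hP hF (ρ := fun q : ℝ × ℝ => ρ q.2) (hρ.comp measurable_snd)
  rw [boxMeasure, mul_assoc, ← h1, ← ENNReal.tsum_mul_left]
  refine tsum_congr fun k => ?_
  exact hn.tsum_lintegral hP (hm.memLp_slice hP hF k) hρ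

lemma IsParseval.memLp_coef (hm : IsParseval P m) (hn : IsParseval P n) (hP : 0 < P)
    (hF : MemLp F 2 (boxMeasure P)) (k l : ℤ) :
    MemLp (coef P (m k) (n l) F) 2 (volume.restrict (Ioo 0 P)) :=
  hn.memLp_slice hP (hm.memLp_slice hP hF k) l

lemma memLp_box_of_continuous {φ : ℝ × ℝ × ℝ → ℝ} (h : Continuous φ) :
    MemLp φ 2 (boxMeasure P) := by
  have hK : IsCompact (Icc 0 P ×ˢ (Icc 0 P ×ˢ Icc (0 : ℝ) P)) :=
    isCompact_Icc.prod (isCompact_Icc.prod isCompact_Icc)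
  obtain ⟨C, hC⟩ := hK.exists_bound_of_continuousOn h.continuousOn
  refine MemLp.of_bound h.aestronglyMeasurable C ?_
  rw [boxMeasure, Measure.prod_restrict, Measure.prod_restrict]
  filter_upwards [ae_restrict_mem
    (measurableSet_Ioo.prod (measurableSet_Ioo.prod measurableSet_Ioo))] with q hq
  exact hC q ⟨Ioo_subset_Icc_self hq.1, Ioo_subset_Icc_self hq.2.1, Ioo_subset_Icc_self hq.2.2⟩

/-- Fubini. Coefficients are only defined through iterated integrals, so relations between them are
obtained almost everywhere by testing against `p` and returning to an integral over the box. -/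
lemma integral_coef_mul {a b p : ℝ → ℝ} (ha : Continuous a) (hb : Continuous b)
    (hp : Continuous p) (hF : MemLp F 2 (boxMeasure P)) :
    ∫ t in Ioo 0 P, coef P a b F t * p t =
      ∫ q, F q * (a q.1 * b q.2.1 * p q.2.2) ∂boxMeasure P := by
  have hint : Integrable (fun q : ℝ × ℝ × ℝ => F q * (a q.1 * b q.2.1 * p q.2.2)) (boxMeasure P) :=
    hF.integrable_fun_mul (memLp_box_of_continuous (by fun_prop))
  rw [boxMeasure] at hint ⊢
  rw [integral_prod_symm _ hint, integral_prod_symm _ hint.integral_prod_right]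
  refine integral_congr_ae (.of_forall fun t => ?_)
  simp only [coef]
  rw [← integral_mul_const]
  refine integral_congr_ae (.of_forall fun y => ?_)
  simp only []
  rw [← integral_mul_const, ← integral_mul_const]
  refine integral_congr_ae (.of_forall fun x => ?_)
  simp only []
  ring

lemma ae_eq_zero_of_integral_mul_smooth {h : ℝ → ℝ} {a b : ℝ}
    (hh : MemLp h 2 (volume.restrict (Ioo a b)))
    (H : ∀ p : ℝ → ℝ, ContDiff ℝ ∞ p → HasCompactSupport p → tsupport p ⊆ Ioo a b →
      ∫ t in Ioo a b, h t * p t = 0) :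
    h =ᵐ[volume.restrict (Ioo a b)] 0 := by
  have := isOpen_Ioo.ae_eq_zero_of_integral_contDiff_smul_eq_zero (μ := volume)
    (locallyIntegrableOn_of_locallyIntegrable_restrict (hh.locallyIntegrable one_le_two)) ?_
  · rw [Filter.EventuallyEq, ae_restrict_iff' measurableSet_Ioo]
    exact this
  · intro g hg hgc hgs
    rw [← H g hg hgc hgs, setIntegral_eq_integral_of_forall_compl_eq_zero]
    · simp_rw [smul_eq_mul, mul_comm]
    · intro x hx
      rw [image_eq_zero_of_notMem_tsupport fun h' => hx (hgs h'), mul_zero]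

end Coef

/-! ### Coordinates on the cube -/

/-- Coordinates `(x, y, t) ∈ (0, 2A)³` on the cube, where `t` is the distance to the face
`{z = σ A}`. -/
def boxPoint (A σ : ℝ) (q : ℝ × ℝ × ℝ) : E3 := ![q.1 - A, q.2.1 - A, σ * (A - q.2.2)]

lemma measurePreserving_boxPoint {A σ : ℝ} (hσ : σ = 1 ∨ σ = -1) :
    MeasurePreserving (boxPoint A σ) (boxMeasure (2 * A)) (volume.restrict (cube A)) := by
  have h1 : MeasurePreserving (fun q : ℝ × ℝ × ℝ => (![q.1, q.2.1, q.2.2] : E3)) volume volume := by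
    have e1 := (volume_preserving_piFinSuccAbove (fun _ : Fin 3 => ℝ) 0).symm
    have e2 := (volume_preserving_finTwoArrow ℝ).symm
    have e3 := e1.comp ((MeasurePreserving.id (volume : Measure ℝ)).prod e2)
    have e4 : (fun q : ℝ × ℝ × ℝ => (![q.1, q.2.1, q.2.2] : E3)) =
        (MeasurableEquiv.piFinSuccAbove (fun _ : Fin 3 => ℝ) 0).symm ∘
          Prod.map id MeasurableEquiv.finTwoArrow.symm := by
      funext q i
      fin_cases i <;> rfl
    rw [e4]
    exact e3
  have ha : MeasurePreserving (fun x : ℝ => x - A) volume volume :=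
    measurePreserving_sub_right volume A
  have hb : MeasurePreserving (fun x : ℝ => σ * (A - x)) volume volume := by
    rcases hσ with rfl | rfl
    · simpa using Measure.measurePreserving_sub_left (volume : Measure ℝ) A
    · simpa using measurePreserving_sub_right (volume : Measure ℝ) A
  have h2 : MeasurePreserving (boxPoint A σ) volume volume := h1.comp (ha.prod (ha.prod hb))
  have h3 := h2.restrict_preimage (measurableSet_cube A)
  suffices h : boxMeasure (2 * A) = volume.restrict (boxPoint A σ ⁻¹' cube A) by
    rw [h]; exact h3
  rw [boxMeasure, Measure.prod_restrict, Measure.prod_restrict]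
  congr 1
  ext q
  simp only [mem_prod, mem_Ioo, mem_preimage, cube, mem_ofPred_eq, boxPoint, Fin.forall_fin_succ,
    Fin.succ_zero_eq_one, Fin.succ_one_eq_two, IsEmpty.forall_iff, and_true, Matrix.cons_val_zero, Matrix.cons_val_one,
    Matrix.cons_val]
  have : (-A < σ * (A - q.2.2) ∧ σ * (A - q.2.2) < A) ↔ 0 < q.2.2 ∧ q.2.2 < 2 * A := by
    rcases hσ with rfl | rfl <;> constructor <;> rintro ⟨h, h'⟩ <;> constructor <;> linarith
  rw [this]
  constructor
  · rintro ⟨⟨h1, h2⟩, ⟨h3, h4⟩, h5⟩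
    exact ⟨⟨by linarith, by linarith⟩, ⟨by linarith, by linarith⟩, h5⟩
  · rintro ⟨⟨h1, h2⟩, ⟨h3, h4⟩, h5⟩
    exact ⟨⟨by linarith, by linarith⟩, ⟨by linarith, by linarith⟩, h5⟩

/-! ### Functions of one variable with square integrable derivative -/

/-- `v` is absolutely continuous on `[0, P]` with derivative `v' ∈ L²`. -/
structure HasL2Deriv (P : ℝ) (v v' : ℝ → ℝ) : Prop where
  ac : AbsolutelyContinuousOnInterval v 0 P
  hasDerivAt : ∀ᵐ t ∂volume.restrict (Ioo 0 P), HasDerivAt v (v' t) t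
  memLp : MemLp v' 2 (volume.restrict (Ioo 0 P))

section OneDim

variable {P : ℝ} {u u' v v' : ℝ → ℝ}

lemma memLp_continuous_mul {c f : ℝ → ℝ} (hc : Continuous c)
    (hf : MemLp f 2 (volume.restrict (Ioo 0 P))) :
    MemLp (fun t => c t * f t) 2 (volume.restrict (Ioo 0 P)) := by
  obtain ⟨C, hC⟩ := (isCompact_Icc (a := (0 : ℝ)) (b := P)).exists_bound_of_continuousOn
    hc.continuousOn
  refine MemLp.of_le_mul (c := C) hf (hc.aestronglyMeasurable.mul hf.1) ?_
  filter_upwards [ae_restrict_mem measurableSet_Ioo] with t ht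
  rw [norm_mul]
  exact mul_le_mul_of_nonneg_right (hC t (Ioo_subset_Icc_self ht)) (norm_nonneg _)

lemma memLp_of_continuousOn_Icc {f : ℝ → ℝ} (hf : ContinuousOn f (Icc 0 P)) :
    MemLp f 2 (volume.restrict (Ioo 0 P)) := by
  obtain ⟨C, hC⟩ := (isCompact_Icc (a := (0 : ℝ)) (b := P)).exists_bound_of_continuousOn hf
  refine MemLp.of_bound ((hf.mono Ioo_subset_Icc_self).aestronglyMeasurable measurableSet_Ioo) C ?_
  filter_upwards [ae_restrict_mem measurableSet_Ioo] with t ht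
  exact hC t (Ioo_subset_Icc_self ht)

lemma intervalIntegrable_of_memLp {f : ℝ → ℝ} (hP : 0 < P)
    (hf : MemLp f 2 (volume.restrict (Ioo 0 P))) : IntervalIntegrable f volume 0 P :=
  (intervalIntegrable_iff_integrableOn_Ioo_of_le hP.le).2 (hf.integrable one_le_two)

lemma HasL2Deriv.memLp_self (hP : 0 < P) (h : HasL2Deriv P v v') :
    MemLp v 2 (volume.restrict (Ioo 0 P)) :=
  memLp_of_continuousOn_Icc (by simpa [uIcc_of_le hP.le] using h.ac.continuousOn)

lemma hasL2Deriv_integral (hP : 0 < P) (hv : MemLp v' 2 (volume.restrict (Ioo 0 P))) :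
    HasL2Deriv P (fun t => ∫ s in 0..t, v' s) v' := by
  have hi := intervalIntegrable_of_memLp hP hv
  refine ⟨hi.absolutelyContinuousOnInterval_intervalIntegral left_mem_uIcc, ?_, hv⟩
  rw [ae_restrict_iff' measurableSet_Ioo]
  filter_upwards [hi.ae_hasDerivAt_integral] with t ht htI
  exact ht (by rw [uIcc_of_le hP.le]; exact Ioo_subset_Icc_self htI) 0 left_mem_uIcc

lemma hasL2Deriv_of_contDiff {f : ℝ → ℝ} (hf : ContDiff ℝ 1 f) : HasL2Deriv P f (deriv f) :=
  ⟨hf.contDiffOn.absolutelyContinuousOnInterval,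
    .of_forall fun t => (hf.differentiable one_ne_zero t).hasDerivAt,
    memLp_of_continuousOn_Icc (hf.continuous_deriv le_rfl).continuousOn⟩

lemma HasL2Deriv.add (hu : HasL2Deriv P u u') (hv : HasL2Deriv P v v') :
    HasL2Deriv P (fun t => u t + v t) (fun t => u' t + v' t) :=
  ⟨hu.ac.add hv.ac, by
    filter_upwards [hu.hasDerivAt, hv.hasDerivAt] with t h1 h2 using h1.add h2,
    hu.memLp.add hv.memLp⟩

lemma HasL2Deriv.const_mul (c : ℝ) (hu : HasL2Deriv P u u') :
    HasL2Deriv P (fun t => c * u t) (fun t => c * u' t) :=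
  ⟨hu.ac.const_mul c, by
    filter_upwards [hu.hasDerivAt] with t h1 using h1.const_mul c, hu.memLp.const_mul c⟩

lemma HasL2Deriv.smooth_mul (hP : 0 < P) (hu : HasL2Deriv P u u') {c : ℝ → ℝ}
    (hc : ContDiff ℝ 1 c) :
    HasL2Deriv P (fun t => c t * u t) (fun t => deriv c t * u t + c t * u' t) :=
  ⟨(hasL2Deriv_of_contDiff hc).ac.fun_mul hu.ac, by
    filter_upwards [hu.hasDerivAt] with t h1
    exact (hc.differentiable one_ne_zero t).hasDerivAt.mul h1,
    (memLp_continuous_mul (hc.continuous_deriv le_rfl) (hu.memLp_self hP)).add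
      (memLp_continuous_mul hc.continuous hu.memLp)⟩

lemma HasL2Deriv.integral_mul_add (hP : 0 < P) (hu : HasL2Deriv P u u') (hv : HasL2Deriv P v v') :
    ∫ t in Ioo 0 P, (u' t * v t + u t * v' t) = u P * v P - u 0 * v 0 := by
  rw [← hu.ac.integral_deriv_mul_eq_sub hv.ac, intervalIntegral.integral_of_le hP.le,
    integral_Ioc_eq_integral_Ioo]
  refine integral_congr_ae ?_
  filter_upwards [hu.hasDerivAt, hv.hasDerivAt] with t h1 h2
  rw [h1.deriv, h2.deriv]

/-- A function that satisfies the integration by parts rule against all smooth functions that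
vanish at `P` is the primitive that vanishes at `0`. -/
lemma ae_eq_integral_of_weak (hP : 0 < P) (hv : MemLp v 2 (volume.restrict (Ioo 0 P)))
    (hv' : MemLp v' 2 (volume.restrict (Ioo 0 P)))
    (H : ∀ p : ℝ → ℝ, ContDiff ℝ ∞ p → p P = 0 →
      ∫ t in Ioo 0 P, (v t * deriv p t + v' t * p t) = 0) :
    v =ᵐ[volume.restrict (Ioo 0 P)] fun t => ∫ s in 0..t, v' s := by
  set V : ℝ → ℝ := fun t => ∫ s in 0..t, v' s with hV
  have hVd : HasL2Deriv P V v' := hasL2Deriv_integral hP hv'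
  have hVL := hVd.memLp_self hP
  have key : (fun t => v t - V t) =ᵐ[volume.restrict (Ioo 0 P)] 0 := by
    refine ae_eq_zero_of_integral_mul_smooth (hv.sub hVL) fun q hq _ _ => ?_
    -- The primitive of `q` that vanishes at `P` is an admissible test function in `H`. Integration
    -- by parts for `V` also has no boundary term, since `V 0 = 0` and `p P = 0`, so `v - V` is
    -- orthogonal to every `q`.
    set p : ℝ → ℝ := fun t => ∫ s in P..t, q s with hp
    have hpd : ∀ t, HasDerivAt p (q t) t := fun t =>
      intervalIntegral.integral_hasDerivAt_right (hq.continuous.intervalIntegrable _ _)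
        (hq.continuous.stronglyMeasurableAtFilter _ _) hq.continuous.continuousAt
    have hpd' : deriv p = q := funext fun t => (hpd t).deriv
    have hpc : ContDiff ℝ ∞ p :=
      contDiff_infty_iff_deriv.2 ⟨fun t => (hpd t).differentiableAt, hpd'.symm ▸ hq⟩
    have hpP : p P = 0 := by simp [hp]
    have e1 := H p hpc hpP
    have e2 := hVd.integral_mul_add hP (hasL2Deriv_of_contDiff (P := P) (hpc.of_le (by norm_cast)))
    have hV0 : V 0 = 0 := by simp [hV]
    rw [hpP, hV0, mul_zero, zero_mul, sub_zero] at e2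
    rw [hpd'] at e1 e2
    have iq : MemLp q 2 (volume.restrict (Ioo 0 P)) :=
      memLp_of_continuousOn_Icc hq.continuous.continuousOn
    have ip : MemLp p 2 (volume.restrict (Ioo 0 P)) :=
      memLp_of_continuousOn_Icc hpc.continuous.continuousOn
    rw [integral_add (hv.integrable_fun_mul iq) (hv'.integrable_fun_mul ip)] at e1
    rw [integral_add (hv'.integrable_fun_mul ip) (hVL.integrable_fun_mul iq)] at e2
    simp only [sub_mul]
    rw [integral_sub (hv.integrable_fun_mul iq) (hVL.integrable_fun_mul iq)]
    linarith
  filter_upwards [key] with t ht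
  simpa [sub_eq_zero] using ht

/-! ### A Carleman estimate in one variable -/

/-- The weight `exp (-2 λ ψ)` with the concave increasing function `ψ(t) = 4 P t - t²`. -/
def weight (P lam t : ℝ) : ℝ := Real.exp (-(2 * lam * (4 * P * t - t ^ 2)))

lemma weight_pos (P lam t : ℝ) : 0 < weight P lam t := Real.exp_pos _

lemma contDiff_weight (P lam : ℝ) : ContDiff ℝ 1 (weight P lam) := by
  unfold weight
  exact Real.contDiff_exp.comp (by fun_prop)

lemma continuous_weight (P lam : ℝ) : Continuous (weight P lam) := (contDiff_weight P lam).continuous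

lemma hasDerivAt_weight (P lam t : ℝ) :
    HasDerivAt (weight P lam) (-(2 * lam * (4 * P - 2 * t)) * weight P lam t) t := by
  have h : HasDerivAt (fun t : ℝ => -(2 * lam * (4 * P * t - t ^ 2)))
      (-(2 * lam * (4 * P - 2 * t))) t := by
    refine ((((hasDerivAt_id t).const_mul (4 * P)).sub ((hasDerivAt_id t).pow 2)).const_mul
      (2 * lam)).neg.congr_deriv ?_
    simp
  exact h.exp.congr_deriv (mul_comm _ _)

lemma integrable_weight_mul {c f g : ℝ → ℝ} (hc : Continuous c)
    (hf : MemLp f 2 (volume.restrict (Ioo 0 P))) (hg : MemLp g 2 (volume.restrict (Ioo 0 P))) :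
    Integrable (fun t => c t * (f t * g t)) (volume.restrict (Ioo 0 P)) := by
  have := (memLp_continuous_mul hc hf).integrable_fun_mul hg
  simpa only [mul_assoc] using this

lemma integrable_weight_sq {lam : ℝ} {f : ℝ → ℝ} (hf : MemLp f 2 (volume.restrict (Ioo 0 P))) :
    Integrable (fun t => weight P lam t * f t ^ 2) (volume.restrict (Ioo 0 P)) := by
  simpa only [sq] using integrable_weight_mul (continuous_weight P lam) hf hf

/-- With `ψ' = 4P - 2t`, `a = λψ' + κ` and `v = exp(λψ) z`, the right side is the integral of `(z' +
a z)²`. The cross term integrates by parts to `-a' z² = 2λ z²`, which is the gain due to concavity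
of `ψ`, and the square of `z'` is dropped. -/
lemma weighted_first_order_estimate (hP : 0 < P) (hv : HasL2Deriv P v v') (h0 : v 0 = 0)
    (h1 : v P = 0) (lam κ : ℝ) :
    ∫ t in Ioo 0 P, weight P lam t * (((lam * (4 * P - 2 * t) + κ) ^ 2 + 2 * lam) * v t ^ 2) ≤
      ∫ t in Ioo 0 P, weight P lam t * (v' t + κ * v t) ^ 2 := by
  set a : ℝ → ℝ := fun t => lam * (4 * P - 2 * t) + κ with ha
  have hac : Continuous a := by fun_prop
  have hρ := continuous_weight P lam
  have hvL := hv.memLp_self hP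
  set θ : ℝ → ℝ := fun t => a t * weight P lam t with hθ
  have hθc : ContDiff ℝ 1 θ := ContDiff.mul (by fun_prop) (contDiff_weight P lam)
  have hθd : ∀ t, deriv θ t = (-(2 * lam) - 2 * lam * (4 * P - 2 * t) * a t) * weight P lam t := by
    intro t
    have h1 : HasDerivAt a (-(2 * lam)) t := by
      refine ((((hasDerivAt_id t).const_mul 2).const_sub (4 * P)).const_mul lam).add_const κ
        |>.congr_deriv ?_
      ring
    have h2 : HasDerivAt θ _ t := h1.mul (hasDerivAt_weight P lam t)
    rw [h2.deriv]
    ring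
  have ibp := (hv.smooth_mul hP hθc).integral_mul_add hP hv
  rw [h0, h1, mul_zero, mul_zero, sub_zero] at ibp
  have i1 : Integrable (fun t => deriv θ t * (v t * v t)) (volume.restrict (Ioo 0 P)) :=
    integrable_weight_mul (hθc.continuous_deriv le_rfl) hvL hvL
  have i2 : Integrable (fun t => 2 * θ t * (v t * v' t)) (volume.restrict (Ioo 0 P)) :=
    integrable_weight_mul (continuous_const.mul hθc.continuous) hvL hv.memLp
  have i3 : Integrable (fun t => weight P lam t * (((a t) ^ 2 + 2 * lam) * v t ^ 2))
      (volume.restrict (Ioo 0 P)) := by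
    have := integrable_weight_mul (P := P) (c := fun t => weight P lam t * ((a t) ^ 2 + 2 * lam))
      (by fun_prop) hvL hvL
    refine this.congr (.of_forall fun t => ?_)
    simp only []
    ring
  have i4 : Integrable (fun t => weight P lam t * (v' t + κ * v t) ^ 2)
      (volume.restrict (Ioo 0 P)) := integrable_weight_sq (hv.memLp.add (hvL.const_mul κ))
  -- The integrand is the weight times `(v' - λψ' v)²`, the square of `z'` in the conjugated
  -- variable. The subtracted expression with `θ` is the derivative of `θ v²` and integrates to
  -- zero.
  have key : ∫ t in Ioo 0 P, (weight P lam t * (v' t + κ * v t) ^ 2 -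
      weight P lam t * (((a t) ^ 2 + 2 * lam) * v t ^ 2) -
      (deriv θ t * (v t * v t) + 2 * θ t * (v t * v' t))) ≥ 0 := by
    refine integral_nonneg fun t => ?_
    have : weight P lam t * (v' t + κ * v t) ^ 2 -
        weight P lam t * (((a t) ^ 2 + 2 * lam) * v t ^ 2) -
        (deriv θ t * (v t * v t) + 2 * θ t * (v t * v' t)) =
        weight P lam t * (v' t - lam * (4 * P - 2 * t) * v t) ^ 2 := by
      rw [hθd, hθ]
      simp only [ha]
      ring
    simp only [Pi.zero_apply]
    rw [this]
    exact mul_nonneg (weight_pos _ _ _).le (sq_nonneg _)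
  have e : ∫ t in Ioo 0 P, (deriv θ t * (v t * v t) + 2 * θ t * (v t * v' t)) = 0 := by
    refine Eq.trans (integral_congr_ae (.of_forall fun t => ?_)) ibp
    simp only []
    ring
  have i5 : Integrable (fun t => deriv θ t * (v t * v t) + 2 * θ t * (v t * v' t))
      (volume.restrict (Ioo 0 P)) := i1.add i2
  have i6 : Integrable (fun t => weight P lam t * (v' t + κ * v t) ^ 2 -
      weight P lam t * (((a t) ^ 2 + 2 * lam) * v t ^ 2)) (volume.restrict (Ioo 0 P)) := i4.sub i3
  rw [integral_sub i6 i5, e, integral_sub i4 i3] at key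
  linarith

/-- Here `RV` is the energy of `u' - Ku` and `D` that of `u'' - K²u`. From `b1`, the datum `D`
controls both `λ² RV` and `K² RV`. Passing from `RV` to `R0` gains `λ` in `b2` but loses `λ` in
`b3`; the loss is the factor `λ` on the right of the second-order estimate. -/
lemma carleman_mode_algebra {lam K D R0 R1 R2 RV : ℝ} (hP : 0 < P) (hlam : 1 ≤ lam) (hK : 0 ≤ K)
    (nD : 0 ≤ D) (nV : 0 ≤ RV) (b1 : (2 * P * lam + K) ^ 2 * RV ≤ D)
    (b2 : 2 * lam * R0 ≤ RV) (b3 : K ^ 2 * R0 ≤ (4 + 32 * P ^ 2 * lam) * RV)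
    (b4 : R1 ≤ 2 * RV + 2 * (K ^ 2 * R0)) (b5 : R2 ≤ 2 * D + 2 * (K ^ 4 * R0)) :
    lam * (R0 + K ^ 2 * R0 + R1) ≤
        max (1 / (8 * P ^ 2) + 1 / 2 + (1 / (2 * P ^ 2) + 1)) (24 + 160 * P ^ 2) * D ∧
      K ^ 4 * R0 + K ^ 2 * R1 + R2 ≤
        max (1 / (8 * P ^ 2) + 1 / 2 + (1 / (2 * P ^ 2) + 1)) (24 + 160 * P ^ 2) * lam * D := by
  have hlam0 : 0 < lam := by linarith
  have c1 : 4 * P ^ 2 * lam ^ 2 * RV ≤ D := by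
    refine le_trans (mul_le_mul_of_nonneg_right ?_ nV) b1
    nlinarith [mul_nonneg (mul_nonneg hP.le hlam0.le) hK]
  have c2 : K ^ 2 * RV ≤ D := by
    refine le_trans (mul_le_mul_of_nonneg_right ?_ nV) b1
    nlinarith [mul_nonneg (mul_nonneg hP.le hlam0.le) hK, sq_nonneg (P * lam)]
  have c3 : 4 * P ^ 2 * (lam * RV) ≤ D := by
    refine le_trans ?_ c1
    have : lam ≤ lam ^ 2 := by nlinarith
    nlinarith [mul_le_mul_of_nonneg_right this (mul_nonneg (sq_nonneg P) nV)]
  have d1 : lam * RV ≤ 1 / (4 * P ^ 2) * D := by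
    rw [one_div, ← div_eq_inv_mul, le_div_iff₀ (by positivity)]
    linarith
  have d0 : lam * R0 ≤ 1 / (8 * P ^ 2) * D := by
    have : R0 * lam ≤ RV / 2 := by linarith
    have h2 : RV ≤ lam * RV := le_mul_of_one_le_left nV hlam
    have h3 : 1 / (8 * P ^ 2) * D = 1 / (4 * P ^ 2) * D / 2 := by ring
    rw [h3]
    linarith
  have d2 : lam * (K ^ 2 * R0) ≤ 1 / 2 * D := by
    nlinarith [mul_le_mul_of_nonneg_left b2 (sq_nonneg K)]
  have d3 : lam * R1 ≤ (1 / (2 * P ^ 2) + 1) * D := by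
    have h3 : 1 / (2 * P ^ 2) * D = 2 * (1 / (4 * P ^ 2) * D) := by ring
    rw [add_mul, h3]
    nlinarith [mul_le_mul_of_nonneg_left b4 hlam0.le]
  have d4 : K ^ 4 * R0 ≤ (4 + 32 * P ^ 2 * lam) * D := by
    have h1 := mul_le_mul_of_nonneg_left b3 (sq_nonneg K)
    have h2 := mul_le_mul_of_nonneg_left c2 (show 0 ≤ 4 + 32 * P ^ 2 * lam by positivity)
    nlinarith
  have d5 : K ^ 2 * R1 ≤ 2 * D + 2 * (K ^ 4 * R0) := by
    nlinarith [mul_le_mul_of_nonneg_left b4 (sq_nonneg K)]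
  constructor
  · refine le_trans ?_ (mul_le_mul_of_nonneg_right (le_max_left _ _) nD)
    nlinarith
  · have hlD : D ≤ lam * D := le_mul_of_one_le_left nD hlam
    rw [mul_assoc]
    refine le_trans ?_ (mul_le_mul_of_nonneg_right (le_max_right _ _) (mul_nonneg hlam0.le nD))
    nlinarith

/-- The operator factors as `(∂ + K)(∂ - K)`, so the first-order estimate applies to `u' - Ku` and
then to `u`. That `C` depends on neither `K` nor `λ` is essential: the estimate is summed over all
frequencies. -/
lemma carleman_mode (hP : 0 < P) : ∃ C, 0 < C ∧ ∀ lam, 1 ≤ lam → ∀ K, 0 ≤ K →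
    ∀ u u₁ u₂ : ℝ → ℝ, HasL2Deriv P u u₁ → HasL2Deriv P u₁ u₂ → u 0 = 0 → u P = 0 →
      u₁ 0 = 0 → u₁ P = 0 →
      lam * ((∫ t in Ioo 0 P, weight P lam t * u t ^ 2) +
          K ^ 2 * (∫ t in Ioo 0 P, weight P lam t * u t ^ 2) +
          ∫ t in Ioo 0 P, weight P lam t * u₁ t ^ 2) ≤
        C * ∫ t in Ioo 0 P, weight P lam t * (u₂ t - K ^ 2 * u t) ^ 2 ∧
      K ^ 4 * (∫ t in Ioo 0 P, weight P lam t * u t ^ 2) +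
          K ^ 2 * (∫ t in Ioo 0 P, weight P lam t * u₁ t ^ 2) +
          ∫ t in Ioo 0 P, weight P lam t * u₂ t ^ 2 ≤
        C * lam * ∫ t in Ioo 0 P, weight P lam t * (u₂ t - K ^ 2 * u t) ^ 2 := by
  refine ⟨max (1 / (8 * P ^ 2) + 1 / 2 + (1 / (2 * P ^ 2) + 1)) (24 + 160 * P ^ 2),
    lt_max_of_lt_right (by positivity), ?_⟩
  intro lam hlam K hK u u₁ u₂ hu hu₁ u0 uP u10 u1P
  set D := ∫ t in Ioo 0 P, weight P lam t * (u₂ t - K ^ 2 * u t) ^ 2 with hD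
  set R0 := ∫ t in Ioo 0 P, weight P lam t * u t ^ 2 with hR0
  set R1 := ∫ t in Ioo 0 P, weight P lam t * u₁ t ^ 2 with hR1
  set R2 := ∫ t in Ioo 0 P, weight P lam t * u₂ t ^ 2 with hR2
  set RV := ∫ t in Ioo 0 P, weight P lam t * (u₁ t + -K * u t) ^ 2 with hRV
  have hlam0 : 0 < lam := by linarith
  have nonneg : ∀ f : ℝ → ℝ, 0 ≤ ∫ t in Ioo 0 P, weight P lam t * f t ^ 2 := fun f =>
    integral_nonneg fun t => mul_nonneg (weight_pos _ _ _).le (sq_nonneg _)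
  have huL := hu.memLp_self hP
  have hu1L := hu₁.memLp_self hP
  have hu2L := hu₁.memLp
  have hvL : MemLp (fun t => u₁ t + -K * u t) 2 (volume.restrict (Ioo 0 P)) :=
    hu1L.add (huL.const_mul _)
  have hgL : MemLp (fun t => u₂ t - K ^ 2 * u t) 2 (volume.restrict (Ioo 0 P)) :=
    hu2L.sub (huL.const_mul _)
  have mono : ∀ (c d : ℝ) (f : ℝ → ℝ) (b : ℝ → ℝ), Continuous b →
      MemLp f 2 (volume.restrict (Ioo 0 P)) → (∀ t ∈ Ioo 0 P, c ≤ d * b t) →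
      c * (∫ t in Ioo 0 P, weight P lam t * f t ^ 2) ≤
        d * ∫ t in Ioo 0 P, weight P lam t * (b t * f t ^ 2) := by
    intro c d f b hb hf hbd
    rw [← integral_const_mul, ← integral_const_mul]
    refine setIntegral_mono_on ((integrable_weight_sq hf).const_mul c) ?_ measurableSet_Ioo ?_
    · have hρ := continuous_weight P lam
      have := (integrable_weight_mul (P := P) (c := fun t => weight P lam t * b t)
        (by fun_prop) hf hf).const_mul d
      refine this.congr (.of_forall fun t => ?_)
      simp only []
      ring
    · intro t ht
      have := mul_le_mul_of_nonneg_right (hbd t ht)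
        (mul_nonneg (weight_pos P lam t).le (sq_nonneg (f t)))
      linarith
  -- The factor `∂ + K`, acting on `u₁ - K u`. Its zero end values use the vanishing of both `u` and
  -- `u₁`. Here `κ = K ≥ 0` adds to `λψ'`, so the coefficient is large in `λ` and in `K`
  -- simultaneously.
  have hi := weighted_first_order_estimate hP (hu₁.add (hu.const_mul (-K)))
    (by simp [u0, u10]) (by simp [uP, u1P]) lam K
  have hi' : ∫ t in Ioo 0 P, weight P lam t * (u₂ t + -K * u₁ t + K * (u₁ t + -K * u t)) ^ 2 = D := by
    rw [hD]
    refine integral_congr_ae (.of_forall fun t => ?_)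
    simp only []
    ring
  rw [hi'] at hi
  -- The factor `∂ - K`. Now `λψ' - K` can vanish inside the interval, where only the concavity term
  -- `2λ` remains.
  have hii := weighted_first_order_estimate hP hu u0 uP lam (-K)
  have b1 : (2 * P * lam + K) ^ 2 * RV ≤ D := by
    refine (mono _ 1 _ (fun t => (lam * (4 * P - 2 * t) + K) ^ 2 + 2 * lam) (by fun_prop) hvL
      fun t ht => ?_).trans (by rw [one_mul]; exact hi)
    have : 2 * P * lam ≤ lam * (4 * P - 2 * t) := by nlinarith [ht.2]
    have h2 : 2 * P * lam + K ≤ lam * (4 * P - 2 * t) + K := by linarith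
    have := pow_le_pow_left₀ (by positivity) h2 2
    linarith
  have b2 : 2 * lam * R0 ≤ RV := by
    refine (mono _ 1 _ (fun t => (lam * (4 * P - 2 * t) + -K) ^ 2 + 2 * lam) (by fun_prop) huL
      fun t ht => ?_).trans (by rw [one_mul]; exact hii)
    nlinarith [sq_nonneg (lam * (4 * P - 2 * t) + -K)]
  have b3 : K ^ 2 * R0 ≤ (4 + 32 * P ^ 2 * lam) * RV := by
    -- With `s = λψ' ≤ 4Pλ`, write `K² ≤ 2(s - K)² + 2s²`. The last term is at most `32P²λ²` and
    -- must be paid from `2λ`, which costs a factor of order `λ`.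
    refine (mono _ (4 + 32 * P ^ 2 * lam) _ (fun t => (lam * (4 * P - 2 * t) + -K) ^ 2 + 2 * lam)
      (by fun_prop) huL fun t ht => ?_).trans (mul_le_mul_of_nonneg_left hii (by positivity))
    have hs1 : 0 ≤ lam * (4 * P - 2 * t) := mul_nonneg hlam0.le (by linarith [ht.2])
    have hs2 : lam * (4 * P - 2 * t) ≤ 4 * P * lam := by nlinarith [ht.1]
    set s := lam * (4 * P - 2 * t)
    have hsq : s ^ 2 ≤ 16 * P ^ 2 * lam ^ 2 := by nlinarith
    have h1 : K ^ 2 ≤ 2 * (s + -K) ^ 2 + 2 * s ^ 2 := by nlinarith [sq_nonneg (2 * s - K)]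
    nlinarith [sq_nonneg (s + -K), mul_nonneg (mul_nonneg (sq_nonneg P) hlam0.le) (sq_nonneg (s + -K))]
  have b4 : R1 ≤ 2 * RV + 2 * (K ^ 2 * R0) := by
    rw [hR1, hRV, hR0, ← integral_const_mul, ← integral_const_mul, ← integral_const_mul,
      ← integral_add ((integrable_weight_sq hvL).const_mul 2)
        (((integrable_weight_sq huL).const_mul _).const_mul 2)]
    refine integral_mono (integrable_weight_sq hu1L) (((integrable_weight_sq hvL).const_mul 2).add
      (((integrable_weight_sq huL).const_mul _).const_mul 2)) fun t => ?_
    simp only []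
    have h : u₁ t ^ 2 ≤ 2 * (u₁ t + -K * u t) ^ 2 + 2 * (K ^ 2 * u t ^ 2) := by
      nlinarith [sq_nonneg (u₁ t - 2 * K * u t)]
    nlinarith [mul_le_mul_of_nonneg_left h (weight_pos P lam t).le]
  have b5 : R2 ≤ 2 * D + 2 * (K ^ 4 * R0) := by
    rw [hR2, hD, hR0, ← integral_const_mul, ← integral_const_mul, ← integral_const_mul,
      ← integral_add ((integrable_weight_sq hgL).const_mul 2)
        (((integrable_weight_sq huL).const_mul _).const_mul 2)]
    refine integral_mono (integrable_weight_sq hu2L) (((integrable_weight_sq hgL).const_mul 2).add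
      (((integrable_weight_sq huL).const_mul _).const_mul 2)) fun t => ?_
    simp only []
    have h : u₂ t ^ 2 ≤ 2 * (u₂ t - K ^ 2 * u t) ^ 2 + 2 * (K ^ 4 * u t ^ 2) := by
      nlinarith [sq_nonneg (u₂ t - 2 * K ^ 2 * u t)]
    nlinarith [mul_le_mul_of_nonneg_left h (weight_pos P lam t).le]
  have nD : 0 ≤ D := nonneg _
  have nV : 0 ≤ RV := nonneg _
  exact carleman_mode_algebra hP hlam hK nD nV b1 b2 b3 b4 b5

end OneDim

/-! ### The Carleman estimate on the box, mode by mode -/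

section Modes

variable {P : ℝ}

lemma lintegral_weight_sq {X : Type*} [MeasurableSpace X] {μ : Measure X} {r f : X → ℝ}
    (hr : ∀ x, 0 ≤ r x) (hi : Integrable (fun x => r x * f x ^ 2) μ) :
    ∫⁻ x, ENNReal.ofReal (r x) * ENNReal.ofReal (f x ^ 2) ∂μ =
      ENNReal.ofReal (∫ x, r x * f x ^ 2 ∂μ) := by
  rw [ofReal_integral_eq_lintegral_ofReal hi
    (.of_forall fun x => mul_nonneg (hr x) (sq_nonneg _))]
  refine lintegral_congr fun x => ?_
  rw [ENNReal.ofReal_mul (hr x)]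

lemma memLp_box_mul {c F : ℝ × ℝ × ℝ → ℝ} (hc : Continuous c) (hF : MemLp F 2 (boxMeasure P)) :
    MemLp (fun q => c q * F q) 2 (boxMeasure P) := by
  have hK : IsCompact (Icc 0 P ×ˢ (Icc 0 P ×ˢ Icc (0 : ℝ) P)) :=
    isCompact_Icc.prod (isCompact_Icc.prod isCompact_Icc)
  obtain ⟨C, hC⟩ := hK.exists_bound_of_continuousOn hc.continuousOn
  refine MemLp.of_le_mul (c := C) hF (hc.aestronglyMeasurable.mul hF.1) ?_
  rw [boxMeasure, Measure.prod_restrict, Measure.prod_restrict]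
  filter_upwards [ae_restrict_mem
    (measurableSet_Ioo.prod (measurableSet_Ioo.prod measurableSet_Ioo))] with q hq
  rw [norm_mul]
  exact mul_le_mul_of_nonneg_right (hC q
    ⟨Ioo_subset_Icc_self hq.1, Ioo_subset_Icc_self hq.2.1, Ioo_subset_Icc_self hq.2.2⟩)
    (norm_nonneg _)

lemma integrable_box_weight_sq {c F : ℝ × ℝ × ℝ → ℝ} (hc : Continuous c)
    (hF : MemLp F 2 (boxMeasure P)) : Integrable (fun q => c q * F q ^ 2) (boxMeasure P) := by
  have := (memLp_box_mul hc hF).integrable_fun_mul hF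
  simpa only [mul_assoc, sq] using this

/-- The frequency `π k / P`. -/
def freq (P : ℝ) (k : ℤ) : ℝ := Real.pi * k / P

/-- Functions `F, F_x, …, F_tt` on the box `(0, P)³`, such that `F` and its derivatives in the
direction of `t` vanish at `t = 0` and `t = P`, in the sense that the cosine and sine coefficients
in `x, y` are related in the same way as for a smooth function with zero normal derivatives on the
lateral faces. -/
structure IsModal (P : ℝ) (F Fx Fy Ft Fxx Fyy Fxy Fxt Fyt Ftt : ℝ × ℝ × ℝ → ℝ) : Prop where
  memLp : MemLp F 2 (boxMeasure P)
  memLp_x : MemLp Fx 2 (boxMeasure P)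
  memLp_y : MemLp Fy 2 (boxMeasure P)
  memLp_t : MemLp Ft 2 (boxMeasure P)
  memLp_xx : MemLp Fxx 2 (boxMeasure P)
  memLp_yy : MemLp Fyy 2 (boxMeasure P)
  memLp_xy : MemLp Fxy 2 (boxMeasure P)
  memLp_xt : MemLp Fxt 2 (boxMeasure P)
  memLp_yt : MemLp Fyt 2 (boxMeasure P)
  memLp_tt : MemLp Ftt 2 (boxMeasure P)
  modes : ∀ k l : ℤ, ∃ u u₁ u₂ : ℝ → ℝ, HasL2Deriv P u u₁ ∧ HasL2Deriv P u₁ u₂ ∧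
    u 0 = 0 ∧ u P = 0 ∧ u₁ 0 = 0 ∧ u₁ P = 0 ∧ ∀ᵐ t ∂volume.restrict (Ioo 0 P),
      coef P (cosMode P k) (cosMode P l) F t = u t ∧
      coef P (sinMode P k) (cosMode P l) Fx t = -freq P k * u t ∧
      coef P (cosMode P k) (sinMode P l) Fy t = -freq P l * u t ∧
      coef P (cosMode P k) (cosMode P l) Ft t = u₁ t ∧
      coef P (cosMode P k) (cosMode P l) Fxx t = -freq P k ^ 2 * u t ∧
      coef P (cosMode P k) (cosMode P l) Fyy t = -freq P l ^ 2 * u t ∧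
      coef P (sinMode P k) (sinMode P l) Fxy t = freq P k * freq P l * u t ∧
      coef P (sinMode P k) (cosMode P l) Fxt t = -freq P k * u₁ t ∧
      coef P (cosMode P k) (sinMode P l) Fyt t = -freq P l * u₁ t ∧
      coef P (cosMode P k) (cosMode P l) Ftt t = u₂ t ∧
      coef P (cosMode P k) (cosMode P l) (fun q => Fxx q + Fyy q + Ftt q) t =
        u₂ t - (freq P k ^ 2 + freq P l ^ 2) * u t

/-- Weighted energy of a function on the box. -/
def boxEnergy (P lam : ℝ) (F : ℝ × ℝ × ℝ → ℝ) : ℝ :=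
  ∫ q, weight P lam q.2.2 * F q ^ 2 ∂boxMeasure P

lemma boxEnergy_nonneg (P lam : ℝ) (F : ℝ × ℝ × ℝ → ℝ) : 0 ≤ boxEnergy P lam F :=
  integral_nonneg fun _ => mul_nonneg (weight_pos _ _ _).le (sq_nonneg _)

lemma continuous_box_weight (P lam : ℝ) : Continuous fun q : ℝ × ℝ × ℝ => weight P lam q.2.2 :=
  (continuous_weight P lam).comp (by fun_prop)

lemma IsParseval.tsum_coef_weight {m n : ℤ → ℝ → ℝ} (hm : IsParseval P m) (hn : IsParseval P n)
    (hP : 0 < P) {F : ℝ × ℝ × ℝ → ℝ} (hF : MemLp F 2 (boxMeasure P)) (lam : ℝ) :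
    ∑' k, ∑' l, ENNReal.ofReal
        (∫ t in Ioo 0 P, weight P lam t * coef P (m k) (n l) F t ^ 2) =
      ENNReal.ofReal (P * P) * ENNReal.ofReal (boxEnergy P lam F) := by
  rw [boxEnergy, ← lintegral_weight_sq (fun _ => (weight_pos _ _ _).le)
    (integrable_box_weight_sq (continuous_box_weight P lam) hF), ENNReal.ofReal_mul hP.le,
    ← hm.tsum_coef hn hP hF (ρ := fun t => ENNReal.ofReal (weight P lam t))
      (continuous_weight P lam).measurable.ennreal_ofReal]
  refine tsum_congr fun k => tsum_congr fun l => ?_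
  rw [lintegral_weight_sq (fun _ => (weight_pos _ _ _).le)
    (integrable_weight_sq (hm.memLp_coef hn hP hF k l))]

lemma integral_weight_congr {lam c : ℝ} {f u : ℝ → ℝ}
    (h : ∀ᵐ t ∂volume.restrict (Ioo 0 P), f t = c * u t) :
    ∫ t in Ioo 0 P, weight P lam t * f t ^ 2 =
      c ^ 2 * ∫ t in Ioo 0 P, weight P lam t * u t ^ 2 := by
  rw [← integral_const_mul]
  refine integral_congr_ae ?_
  filter_upwards [h] with t ht
  rw [ht]
  ring

/-- The weighted energies are, up to the common factor `P²`, double series of one-dimensional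
energies, so the estimate follows from `carleman_mode` with `K² = freq k² + freq l²`. The sums are
compared in `[0, ∞]` and the factor is cancelled at the end. -/
lemma carleman_box (hP : 0 < P) : ∃ C, 0 < C ∧ ∀ lam, 1 ≤ lam →
    ∀ F Fx Fy Ft Fxx Fyy Fxy Fxt Fyt Ftt : ℝ × ℝ × ℝ → ℝ,
      IsModal P F Fx Fy Ft Fxx Fyy Fxy Fxt Fyt Ftt →
      lam * (boxEnergy P lam F + boxEnergy P lam Fx + boxEnergy P lam Fy + boxEnergy P lam Ft) ≤
        C * boxEnergy P lam (fun q => Fxx q + Fyy q + Ftt q) ∧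
      boxEnergy P lam Fxx + boxEnergy P lam Fyy + boxEnergy P lam Fxy + boxEnergy P lam Fxt +
          boxEnergy P lam Fyt + boxEnergy P lam Ftt ≤
        C * lam * boxEnergy P lam (fun q => Fxx q + Fyy q + Ftt q) := by
  obtain ⟨C, hC, H⟩ := carleman_mode hP
  refine ⟨C, hC, fun lam hlam F Fx Fy Ft Fxx Fyy Fxy Fxt Fyt Ftt hF => ?_⟩
  have hlam0 : 0 < lam := by linarith
  have hc := isParseval_cosMode hP
  have hs := isParseval_sinMode hP
  have hG : MemLp (fun q => Fxx q + Fyy q + Ftt q) 2 (boxMeasure P) :=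
    (hF.memLp_xx.add hF.memLp_yy).add hF.memLp_tt
  have e0 := hc.tsum_coef_weight hc hP hF.memLp lam
  have ex := hs.tsum_coef_weight hc hP hF.memLp_x lam
  have ey := hc.tsum_coef_weight hs hP hF.memLp_y lam
  have et := hc.tsum_coef_weight hc hP hF.memLp_t lam
  have exx := hc.tsum_coef_weight hc hP hF.memLp_xx lam
  have eyy := hc.tsum_coef_weight hc hP hF.memLp_yy lam
  have exy := hs.tsum_coef_weight hs hP hF.memLp_xy lam
  have ext := hs.tsum_coef_weight hc hP hF.memLp_xt lam
  have eyt := hc.tsum_coef_weight hs hP hF.memLp_yt lam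
  have ett := hc.tsum_coef_weight hc hP hF.memLp_tt lam
  have eG := hc.tsum_coef_weight hc hP hG lam
  have nonneg : ∀ f : ℝ → ℝ, 0 ≤ ∫ t in Ioo 0 P, weight P lam t * f t ^ 2 := fun f =>
    integral_nonneg fun t => mul_nonneg (weight_pos _ _ _).le (sq_nonneg _)
  have mode : ∀ k l : ℤ, ∃ R0 R1 R2 D : ℝ, 0 ≤ R0 ∧ 0 ≤ R1 ∧ 0 ≤ R2 ∧ 0 ≤ D ∧
      lam * (R0 + (freq P k ^ 2 + freq P l ^ 2) * R0 + R1) ≤ C * D ∧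
      (freq P k ^ 2 + freq P l ^ 2) ^ 2 * R0 + (freq P k ^ 2 + freq P l ^ 2) * R1 + R2 ≤
        C * lam * D ∧
      (∫ t in Ioo 0 P, weight P lam t * coef P (cosMode P k) (cosMode P l) F t ^ 2) = R0 ∧
      (∫ t in Ioo 0 P, weight P lam t * coef P (sinMode P k) (cosMode P l) Fx t ^ 2) =
        freq P k ^ 2 * R0 ∧
      (∫ t in Ioo 0 P, weight P lam t * coef P (cosMode P k) (sinMode P l) Fy t ^ 2) =
        freq P l ^ 2 * R0 ∧
      (∫ t in Ioo 0 P, weight P lam t * coef P (cosMode P k) (cosMode P l) Ft t ^ 2) = R1 ∧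
      (∫ t in Ioo 0 P, weight P lam t * coef P (cosMode P k) (cosMode P l) Fxx t ^ 2) =
        freq P k ^ 4 * R0 ∧
      (∫ t in Ioo 0 P, weight P lam t * coef P (cosMode P k) (cosMode P l) Fyy t ^ 2) =
        freq P l ^ 4 * R0 ∧
      (∫ t in Ioo 0 P, weight P lam t * coef P (sinMode P k) (sinMode P l) Fxy t ^ 2) =
        freq P k ^ 2 * freq P l ^ 2 * R0 ∧
      (∫ t in Ioo 0 P, weight P lam t * coef P (sinMode P k) (cosMode P l) Fxt t ^ 2) =
        freq P k ^ 2 * R1 ∧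
      (∫ t in Ioo 0 P, weight P lam t * coef P (cosMode P k) (sinMode P l) Fyt t ^ 2) =
        freq P l ^ 2 * R1 ∧
      (∫ t in Ioo 0 P, weight P lam t * coef P (cosMode P k) (cosMode P l) Ftt t ^ 2) = R2 ∧
      (∫ t in Ioo 0 P, weight P lam t * coef P (cosMode P k) (cosMode P l)
        (fun q => Fxx q + Fyy q + Ftt q) t ^ 2) = D := by
    intro k l
    obtain ⟨u, u₁, u₂, hu, hu₁, u0, uP, u10, u1P, hae⟩ := hF.modes k l
    have hK : √(freq P k ^ 2 + freq P l ^ 2) ^ 2 = freq P k ^ 2 + freq P l ^ 2 :=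
      Real.sq_sqrt (by positivity)
    have hK4 : √(freq P k ^ 2 + freq P l ^ 2) ^ 4 = (freq P k ^ 2 + freq P l ^ 2) ^ 2 := by
      rw [show 4 = 2 * 2 from rfl, pow_mul, hK]
    have := H lam hlam (√(freq P k ^ 2 + freq P l ^ 2)) (Real.sqrt_nonneg _) u u₁ u₂ hu hu₁ u0 uP
      u10 u1P
    rw [hK4] at this
    simp only [hK] at this
    refine ⟨_, _, _, _, nonneg u, nonneg u₁, nonneg u₂, nonneg _, this.1, this.2,
      ?_, ?_, ?_, ?_, ?_, ?_, ?_, ?_, ?_, ?_, ?_⟩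
    · simpa using integral_weight_congr (c := 1) (hae.mono fun t h => by rw [h.1, one_mul])
    · simpa using integral_weight_congr (hae.mono fun t h => h.2.1)
    · simpa using integral_weight_congr (hae.mono fun t h => h.2.2.1)
    · simpa using integral_weight_congr (c := 1) (hae.mono fun t h => by rw [h.2.2.2.1, one_mul])
    · rw [integral_weight_congr (hae.mono fun t h => h.2.2.2.2.1)]; ring
    · rw [integral_weight_congr (hae.mono fun t h => h.2.2.2.2.2.1)]; ring
    · rw [integral_weight_congr (hae.mono fun t h => h.2.2.2.2.2.2.1)]; ring
    · simpa using integral_weight_congr (hae.mono fun t h => h.2.2.2.2.2.2.2.1)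
    · simpa using integral_weight_congr (hae.mono fun t h => h.2.2.2.2.2.2.2.2.1)
    · simpa using integral_weight_congr (c := 1)
        (hae.mono fun t h => by rw [h.2.2.2.2.2.2.2.2.2.1, one_mul])
    · simpa using integral_weight_congr (c := 1)
        (hae.mono fun t h => by rw [h.2.2.2.2.2.2.2.2.2.2, one_mul])
  have hPP : ENNReal.ofReal (P * P) ≠ 0 := by
    rw [Ne, ENNReal.ofReal_eq_zero, not_le]; positivity
  have cancel : ∀ a b : ℝ, 0 ≤ b →
      ENNReal.ofReal (P * P) * ENNReal.ofReal a ≤ ENNReal.ofReal (P * P) * ENNReal.ofReal b →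
      a ≤ b := by
    intro a b hb h
    rwa [ENNReal.mul_le_mul_iff_right hPP ENNReal.ofReal_ne_top,
      ENNReal.ofReal_le_ofReal_iff hb] at h
  have nn := boxEnergy_nonneg P lam
  constructor
  · refine cancel _ _ (mul_nonneg hC.le (nn _)) ?_
    rw [ENNReal.ofReal_mul hlam0.le, ENNReal.ofReal_mul hC.le,
      ENNReal.ofReal_add (add_nonneg (add_nonneg (nn _) (nn _)) (nn _)) (nn _),
      ENNReal.ofReal_add (add_nonneg (nn _) (nn _)) (nn _), ENNReal.ofReal_add (nn _) (nn _),
      mul_left_comm, mul_left_comm _ (ENNReal.ofReal C), ← eG,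
      mul_add (ENNReal.ofReal (P * P)), mul_add (ENNReal.ofReal (P * P)),
      mul_add (ENNReal.ofReal (P * P)),
      ← e0, ← ex, ← ey, ← et, ← ENNReal.tsum_add, ← ENNReal.tsum_add, ← ENNReal.tsum_add,
      ← ENNReal.tsum_mul_left, ← ENNReal.tsum_mul_left]
    refine ENNReal.tsum_le_tsum fun k => ?_
    rw [← ENNReal.tsum_add, ← ENNReal.tsum_add, ← ENNReal.tsum_add, ← ENNReal.tsum_mul_left,
      ← ENNReal.tsum_mul_left]
    refine ENNReal.tsum_le_tsum fun l => ?_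
    obtain ⟨R0, R1, R2, D, n0, n1, n2, nD, h1, h2, m0, mx, my, mt, -, -, -, -, -, -, mG⟩ := mode k l
    rw [m0, mx, my, mt, mG, ← ENNReal.ofReal_add (by positivity) (by positivity),
      ← ENNReal.ofReal_add (by positivity) (by positivity),
      ← ENNReal.ofReal_add (by positivity) (by positivity), ← ENNReal.ofReal_mul hlam0.le,
      ← ENNReal.ofReal_mul hC.le]
    refine ENNReal.ofReal_le_ofReal ?_
    linarith
  · refine cancel _ _ (mul_nonneg (mul_nonneg hC.le hlam0.le) (nn _)) ?_
    rw [ENNReal.ofReal_mul (mul_nonneg hC.le hlam0.le),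
      ENNReal.ofReal_add (add_nonneg (add_nonneg (add_nonneg (add_nonneg (nn _) (nn _)) (nn _))
        (nn _)) (nn _)) (nn _),
      ENNReal.ofReal_add (add_nonneg (add_nonneg (add_nonneg (nn _) (nn _)) (nn _)) (nn _)) (nn _),
      ENNReal.ofReal_add (add_nonneg (add_nonneg (nn _) (nn _)) (nn _)) (nn _),
      ENNReal.ofReal_add (add_nonneg (nn _) (nn _)) (nn _), ENNReal.ofReal_add (nn _) (nn _),
      mul_left_comm, ← eG, mul_add (ENNReal.ofReal (P * P)),
      mul_add (ENNReal.ofReal (P * P)), mul_add (ENNReal.ofReal (P * P)),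
      mul_add (ENNReal.ofReal (P * P)), mul_add (ENNReal.ofReal (P * P)),
      ← exx, ← eyy, ← exy, ← ext, ← eyt, ← ett, ← ENNReal.tsum_add, ← ENNReal.tsum_add,
      ← ENNReal.tsum_add, ← ENNReal.tsum_add, ← ENNReal.tsum_add, ← ENNReal.tsum_mul_left]
    refine ENNReal.tsum_le_tsum fun k => ?_
    rw [← ENNReal.tsum_add, ← ENNReal.tsum_add, ← ENNReal.tsum_add, ← ENNReal.tsum_add,
      ← ENNReal.tsum_add, ← ENNReal.tsum_mul_left]
    refine ENNReal.tsum_le_tsum fun l => ?_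
    obtain ⟨R0, R1, R2, D, n0, n1, n2, nD, h1, h2, -, -, -, -, mxx, myy, mxy, mxt, myt, mtt, mG⟩ :=
      mode k l
    rw [mxx, myy, mxy, mxt, myt, mtt, mG, ← ENNReal.ofReal_add (by positivity) (by positivity),
      ← ENNReal.ofReal_add (by positivity) (by positivity),
      ← ENNReal.ofReal_add (by positivity) (by positivity),
      ← ENNReal.ofReal_add (by positivity) (by positivity),
      ← ENNReal.ofReal_add (by positivity) (by positivity),
      ← ENNReal.ofReal_mul (mul_nonneg hC.le hlam0.le)]
    refine ENNReal.ofReal_le_ofReal ?_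
    -- Expanding `K⁴` produces the mixed product twice, while the energy of `Fxy` uses it once; this
    -- is the surplus.
    have : 0 ≤ freq P k ^ 2 * freq P l ^ 2 * R0 := by positivity
    linarith

end Modes

/-! ### Fourier coefficients of weak derivatives -/

section Transport

variable {A σ : ℝ} {f f' : E3 → ℝ}

lemma integral_boxPoint (hσ : σ = 1 ∨ σ = -1)
    (hf : AEStronglyMeasurable f (volume.restrict (cube A))) :
    ∫ q, f (boxPoint A σ q) ∂boxMeasure (2 * A) = ∫ x in cube A, f x := by
  have h := measurePreserving_boxPoint (A := A) hσ
  rw [← h.map_eq] at hf ⊢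
  exact (integral_map h.measurable.aemeasurable hf).symm

lemma memLp_boxPoint (hσ : σ = 1 ∨ σ = -1) (hf : MemLp f 2 (volume.restrict (cube A))) :
    MemLp (fun q => f (boxPoint A σ q)) 2 (boxMeasure (2 * A)) :=
  hf.comp_measurePreserving (measurePreserving_boxPoint hσ)

/-- The factors of the function `a(x + A) b(y + A) p(A - σ z)` on the cube. -/
def modeFactors (A σ : ℝ) (a b p : ℝ → ℝ) : Fin 3 → ℝ → ℝ :=
  ![fun x => a (x + A), fun y => b (y + A), fun z => p (A - σ * z)]

lemma contDiff_modeFactors {a b p : ℝ → ℝ} (ha : ContDiff ℝ ∞ a) (hb : ContDiff ℝ ∞ b)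
    (hp : ContDiff ℝ ∞ p) (j : Fin 3) : ContDiff ℝ ∞ (modeFactors A σ a b p j) := by
  fin_cases j
  · exact ha.comp (by fun_prop)
  · exact hb.comp (by fun_prop)
  · exact hp.comp (by fun_prop)

lemma tensor_modeFactors_boxPoint (hσ : σ = 1 ∨ σ = -1) (a b p : ℝ → ℝ) (q : ℝ × ℝ × ℝ) :
    tensor (modeFactors A σ a b p) (boxPoint A σ q) = a q.1 * b q.2.1 * p q.2.2 := by
  have : A - σ * (σ * (A - q.2.2)) = q.2.2 := by
    rcases hσ with rfl | rfl <;> ring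
  simp [tensor, Fin.prod_univ_three, modeFactors, boxPoint, this]

lemma update_modeFactors_zero (a b p : ℝ → ℝ) :
    Function.update (modeFactors A σ a b p) 0 (deriv (modeFactors A σ a b p 0)) =
      modeFactors A σ (deriv a) b p := by
  have : deriv (fun x => a (x + A)) = fun x => deriv a (x + A) :=
    funext fun x => deriv_comp_add_const a A x
  funext j
  fin_cases j
  · simpa [modeFactors] using this
  · simp [modeFactors]
  · simp [modeFactors]

lemma update_modeFactors_one (a b p : ℝ → ℝ) :
    Function.update (modeFactors A σ a b p) 1 (deriv (modeFactors A σ a b p 1)) =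
      modeFactors A σ a (deriv b) p := by
  have : deriv (fun x => b (x + A)) = fun x => deriv b (x + A) :=
    funext fun x => deriv_comp_add_const b A x
  funext j
  fin_cases j
  · simp [modeFactors]
  · simpa [modeFactors] using this
  · simp [modeFactors]

lemma update_modeFactors_two {a b p : ℝ → ℝ} (hp : Differentiable ℝ p) :
    Function.update (modeFactors A σ a b p) 2 (deriv (modeFactors A σ a b p 2)) =
      modeFactors A σ a b (fun t => -σ * deriv p t) := by
  have : deriv (fun z => p (A - σ * z)) = fun z => -σ * deriv p (A - σ * z) := by
    funext z
    have h : HasDerivAt (fun z => A - σ * z) (-σ) z := by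
      simpa using ((hasDerivAt_id z).const_mul σ).const_sub A
    have h2 : HasDerivAt (fun z => p (A - σ * z)) _ z := (hp _).hasDerivAt.comp z h
    rw [h2.deriv, mul_comm]
  funext j
  fin_cases j
  · simp [modeFactors]
  · simp [modeFactors]
  · simpa [modeFactors] using this

lemma integral_coef_boxPoint (hσ : σ = 1 ∨ σ = -1) (hf : MemLp f 2 (volume.restrict (cube A)))
    {a b p : ℝ → ℝ} (ha : Continuous a) (hb : Continuous b) (hp : Continuous p) :
    ∫ t in Ioo 0 (2 * A), coef (2 * A) a b (fun q => f (boxPoint A σ q)) t * p t =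
      ∫ x in cube A, f x * tensor (modeFactors A σ a b p) x := by
  rw [integral_coef_mul ha hb hp (memLp_boxPoint hσ hf), ← integral_boxPoint hσ]
  · simp only [tensor_modeFactors_boxPoint hσ]
  · refine hf.1.mul (continuous_tensor fun j => ?_).aestronglyMeasurable
    fin_cases j
    · exact ha.comp (by fun_prop)
    · exact hb.comp (by fun_prop)
    · exact hp.comp (by fun_prop)

end Transport

section CoefAlgebra

variable {P : ℝ} {F G : ℝ × ℝ × ℝ → ℝ}

lemma coef_mul_left (a b c : ℝ → ℝ) (F : ℝ × ℝ × ℝ → ℝ) (t : ℝ) :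
    coef P a b (fun q => c q.2.2 * F q) t = c t * coef P a b F t := by
  simp only [coef, mul_assoc, integral_const_mul]

lemma coef_const_mul_fst (c : ℝ) (a b : ℝ → ℝ) (F : ℝ × ℝ × ℝ → ℝ) (t : ℝ) :
    coef P (fun x => c * a x) b F t = c * coef P a b F t := by
  simp only [coef, mul_left_comm _ c, integral_const_mul, mul_assoc]

lemma coef_const_mul_snd (c : ℝ) (a b : ℝ → ℝ) (F : ℝ × ℝ × ℝ → ℝ) (t : ℝ) :
    coef P a (fun x => c * b x) F t = c * coef P a b F t := by
  simp only [coef, mul_left_comm _ c, integral_const_mul]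

lemma coef_add {m n : ℤ → ℝ → ℝ} (hm : IsParseval P m) (hn : IsParseval P n) (hP : 0 < P)
    (hF : MemLp F 2 (boxMeasure P)) (hG : MemLp G 2 (boxMeasure P)) (k l : ℤ) :
    ∀ᵐ t ∂volume.restrict (Ioo 0 P), coef P (m k) (n l) (fun q => F q + G q) t =
      coef P (m k) (n l) F t + coef P (m k) (n l) G t := by
  have hFG : MemLp (fun q => F q + G q) 2 (boxMeasure P) := hF.add hG
  have h1 := hm.memLp_coef hn hP hF k l
  have h2 := hm.memLp_coef hn hP hG k l
  have h3 := hm.memLp_coef hn hP hFG k l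
  have : (fun t => coef P (m k) (n l) (fun q => F q + G q) t -
      (coef P (m k) (n l) F t + coef P (m k) (n l) G t)) =ᵐ[volume.restrict (Ioo 0 P)] 0 := by
    refine ae_eq_zero_of_integral_mul_smooth (h3.sub (h1.add h2)) fun p hp _ _ => ?_
    have hpL : MemLp p 2 (volume.restrict (Ioo 0 P)) :=
      memLp_of_continuousOn_Icc hp.continuous.continuousOn
    have hT : MemLp (fun q : ℝ × ℝ × ℝ => m k q.1 * n l q.2.1 * p q.2.2) 2 (boxMeasure P) := by
      have := hm.continuous k
      have := hn.continuous l
      have := hp.continuous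
      exact memLp_box_of_continuous (by fun_prop)
    have e3 := integral_coef_mul (hm.continuous k) (hn.continuous l) hp.continuous hFG
    have e1 := integral_coef_mul (hm.continuous k) (hn.continuous l) hp.continuous hF
    have e2 := integral_coef_mul (hm.continuous k) (hn.continuous l) hp.continuous hG
    simp only [add_mul] at e3
    rw [integral_add (hF.integrable_fun_mul hT) (hG.integrable_fun_mul hT), ← e1, ← e2] at e3
    simp only [sub_mul, add_mul]
    have i4 : Integrable (fun t => coef P (m k) (n l) F t * p t + coef P (m k) (n l) G t * p t)
        (volume.restrict (Ioo 0 P)) := (h1.integrable_fun_mul hpL).add (h2.integrable_fun_mul hpL)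
    rw [integral_sub (h3.integrable_fun_mul hpL) i4,
      integral_add (h1.integrable_fun_mul hpL) (h2.integrable_fun_mul hpL), e3, sub_self]
  filter_upwards [this] with t ht
  simpa [sub_eq_zero] using ht

end CoefAlgebra

section CoefDeriv

variable {A σ : ℝ} {f f' : E3 → ℝ} {a b c : ℝ → ℝ}

/-- If the product rule for integration by parts in the direction `x_i` turns `∂_i` of the factors
`a, b` into `a', b'`, then the coefficients of `f' = ∂_i f` are those of `f`. -/
lemma coef_eq_neg_of_green (hσ : σ = 1 ∨ σ = -1) (hf : MemLp f 2 (volume.restrict (cube A)))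
    (hf' : MemLp f' 2 (volume.restrict (cube A))) {a' b' : ℝ → ℝ} (ha : Continuous a)
    (hb : Continuous b) (ha' : Continuous a') (hb' : Continuous b')
    (h1 : MemLp (coef (2 * A) a' b' fun q => f (boxPoint A σ q)) 2
      (volume.restrict (Ioo 0 (2 * A))))
    (h2 : MemLp (coef (2 * A) a b fun q => f' (boxPoint A σ q)) 2
      (volume.restrict (Ioo 0 (2 * A))))
    (H : ∀ p : ℝ → ℝ, ContDiff ℝ ∞ p → ∫ x in cube A,
      (f x * tensor (modeFactors A σ a' b' p) x + f' x * tensor (modeFactors A σ a b p) x) = 0) :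
    ∀ᵐ t ∂volume.restrict (Ioo 0 (2 * A)),
      coef (2 * A) a b (fun q => f' (boxPoint A σ q)) t =
        -coef (2 * A) a' b' (fun q => f (boxPoint A σ q)) t := by
  have hc : ∀ {a b p : ℝ → ℝ}, Continuous a → Continuous b → Continuous p →
      MemLp (tensor (modeFactors A σ a b p)) 2 (volume.restrict (cube A)) := by
    intro a b p ha hb hp
    refine memLp_of_continuous (continuous_tensor fun j => ?_)
    fin_cases j
    · exact ha.comp (by fun_prop)
    · exact hb.comp (by fun_prop)
    · exact hp.comp (by fun_prop)
  have := ae_eq_zero_of_integral_mul_smooth (h1.add h2) fun p hp _ _ => ?_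
  · filter_upwards [this] with t ht
    simp only [Pi.add_apply, Pi.zero_apply] at ht
    linarith
  · have hpL : MemLp p 2 (volume.restrict (Ioo 0 (2 * A))) :=
      memLp_of_continuousOn_Icc hp.continuous.continuousOn
    simp only [Pi.add_apply, add_mul]
    rw [integral_add (h1.integrable_fun_mul hpL) (h2.integrable_fun_mul hpL),
      integral_coef_boxPoint hσ hf ha' hb' hp.continuous,
      integral_coef_boxPoint hσ hf' ha hb hp.continuous,
      ← integral_add (hf.integrable_fun_mul (hc ha' hb' hp.continuous))
        (hf'.integrable_fun_mul (hc ha hb hp.continuous))]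
    exact H p hp

lemma contDiff_cosMode (P : ℝ) (k : ℤ) : ContDiff ℝ ∞ (cosMode P k) := by
  unfold cosMode; fun_prop

lemma contDiff_sinMode (P : ℝ) (k : ℤ) : ContDiff ℝ ∞ (sinMode P k) := by
  unfold sinMode; fun_prop

lemma deriv_cosMode (P : ℝ) (k : ℤ) :
    deriv (cosMode P k) = fun x => -freq P k * sinMode P k x := by
  funext x
  have h : HasDerivAt (fun x => Real.pi * k / P * x) (freq P k) x := by
    simpa [freq] using (hasDerivAt_id x).const_mul (Real.pi * k / P)
  have h2 : HasDerivAt (cosMode P k) _ x := h.cos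
  rw [h2.deriv, sinMode]
  ring

lemma deriv_sinMode (P : ℝ) (k : ℤ) :
    deriv (sinMode P k) = fun x => freq P k * cosMode P k x := by
  funext x
  have h : HasDerivAt (fun x => Real.pi * k / P * x) (freq P k) x := by
    simpa [freq] using (hasDerivAt_id x).const_mul (Real.pi * k / P)
  have h2 : HasDerivAt (sinMode P k) _ x := h.sin
  rw [h2.deriv, cosMode]
  ring

lemma sinMode_zero (P : ℝ) (k : ℤ) : sinMode P k 0 = 0 := by simp [sinMode]

lemma sinMode_self {P : ℝ} (hP : P ≠ 0) (k : ℤ) : sinMode P k P = 0 := by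
  rw [sinMode, div_mul_cancel₀ _ hP, mul_comm]
  exact Real.sin_int_mul_pi k

variable {n : ℤ → ℝ → ℝ}

/-- The sine vanishes on both lateral faces, so integration by parts has no boundary term, whatever
the boundary values of `f`. -/
lemma coef_sin_x (hA : 0 < A) (hσ : σ = 1 ∨ σ = -1) (hf : MemLp f 2 (volume.restrict (cube A)))
    (h : HasWeakDeriv (cube A) (Pi.single 0 1) f f') (hn : IsParseval (2 * A) n)
    (hns : ∀ l, ContDiff ℝ ∞ (n l)) (k l : ℤ) :
    ∀ᵐ t ∂volume.restrict (Ioo 0 (2 * A)),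
      coef (2 * A) (sinMode (2 * A) k) (n l) (fun q => f' (boxPoint A σ q)) t =
        -freq (2 * A) k *
          coef (2 * A) (cosMode (2 * A) k) (n l) (fun q => f (boxPoint A σ q)) t := by
  have hP : 0 < 2 * A := by linarith
  have hc := isParseval_cosMode hP
  have hs := isParseval_sinMode hP
  have key := coef_eq_neg_of_green (a := sinMode (2 * A) k) (b := n l)
    (a' := fun x => freq (2 * A) k * cosMode (2 * A) k x) (b' := n l) hσ hf h.1
    (hs.continuous k) (hn.continuous l) (continuous_const.mul (hc.continuous k)) (hn.continuous l)
    (by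
      rw [funext (coef_const_mul_fst _ _ _ _)]
      exact (hc.memLp_coef hn hP (memLp_boxPoint hσ hf) k l).const_mul _)
    (hs.memLp_coef hn hP (memLp_boxPoint hσ h.1) k l)
    (fun p hp => by
      have := h.green hf (g := modeFactors A σ (sinMode (2 * A) k) (n l) p)
        (contDiff_modeFactors (contDiff_sinMode _ _) (hns l) hp)
        (by simp only [modeFactors, Matrix.cons_val_zero, ← two_mul]; exact sinMode_self hP.ne' k)
        (by simp only [modeFactors, Matrix.cons_val_zero, neg_add_cancel]; exact sinMode_zero _ k)
      rwa [update_modeFactors_zero, deriv_sinMode] at this)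
  filter_upwards [key] with t ht
  rw [ht, coef_const_mul_fst, neg_mul]

lemma coef_sin_y (hA : 0 < A) (hσ : σ = 1 ∨ σ = -1) (hf : MemLp f 2 (volume.restrict (cube A)))
    (h : HasWeakDeriv (cube A) (Pi.single 1 1) f f') (hn : IsParseval (2 * A) n)
    (hns : ∀ l, ContDiff ℝ ∞ (n l)) (k l : ℤ) :
    ∀ᵐ t ∂volume.restrict (Ioo 0 (2 * A)),
      coef (2 * A) (n k) (sinMode (2 * A) l) (fun q => f' (boxPoint A σ q)) t =
        -freq (2 * A) l *
          coef (2 * A) (n k) (cosMode (2 * A) l) (fun q => f (boxPoint A σ q)) t := by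
  have hP : 0 < 2 * A := by linarith
  have hc := isParseval_cosMode hP
  have hs := isParseval_sinMode hP
  have key := coef_eq_neg_of_green (a := n k) (b := sinMode (2 * A) l) (a' := n k)
    (b' := fun x => freq (2 * A) l * cosMode (2 * A) l x) hσ hf h.1
    (hn.continuous k) (hs.continuous l) (hn.continuous k) (continuous_const.mul (hc.continuous l))
    (by
      rw [funext (coef_const_mul_snd _ _ _ _)]
      exact (hn.memLp_coef hc hP (memLp_boxPoint hσ hf) k l).const_mul _)
    (hn.memLp_coef hs hP (memLp_boxPoint hσ h.1) k l)
    (fun p hp => by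
      have := h.green hf (g := modeFactors A σ (n k) (sinMode (2 * A) l) p)
        (contDiff_modeFactors (hns k) (contDiff_sinMode _ _) hp)
        (by simp only [modeFactors, Matrix.cons_val_one, Matrix.cons_val_zero, ← two_mul]; exact sinMode_self hP.ne' l)
        (by simp only [modeFactors, Matrix.cons_val_one, Matrix.cons_val_zero, neg_add_cancel]; exact sinMode_zero _ l)
      rwa [update_modeFactors_one, deriv_sinMode] at this)
  filter_upwards [key] with t ht
  rw [ht, coef_const_mul_snd, neg_mul]

/-- The cosine does not vanish on the lateral faces, so zero traces of `f` are needed there. It is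
applied to `f = ∂u/∂x`, whose traces vanish by the Neumann condition. -/
lemma coef_cos_x (hA : 0 < A) (hσ : σ = 1 ∨ σ = -1) (hf : MemLp f 2 (volume.restrict (cube A)))
    (hf' : MemLp (weakDeriv (cube A) (Pi.single 0 1) f) 2 (volume.restrict (cube A)))
    (h1 : HasTrace A 0 1 f 0) (h2 : HasTrace A 0 (-1) f 0) (hn : IsParseval (2 * A) n)
    (hns : ∀ l, ContDiff ℝ ∞ (n l)) (k l : ℤ) :
    ∀ᵐ t ∂volume.restrict (Ioo 0 (2 * A)),
      coef (2 * A) (cosMode (2 * A) k) (n l)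
          (fun q => weakDeriv (cube A) (Pi.single 0 1) f (boxPoint A σ q)) t =
        freq (2 * A) k *
          coef (2 * A) (sinMode (2 * A) k) (n l) (fun q => f (boxPoint A σ q)) t := by
  have hP : 0 < 2 * A := by linarith
  have hc := isParseval_cosMode hP
  have hs := isParseval_sinMode hP
  have key := coef_eq_neg_of_green (a := cosMode (2 * A) k) (b := n l)
    (a' := fun x => -freq (2 * A) k * sinMode (2 * A) k x) (b' := n l) hσ hf hf'
    (hc.continuous k) (hn.continuous l) (continuous_const.mul (hs.continuous k)) (hn.continuous l)
    (by
      rw [funext (coef_const_mul_fst _ _ _ _)]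
      exact (hs.memLp_coef hn hP (memLp_boxPoint hσ hf) k l).const_mul _)
    (hc.memLp_coef hn hP (memLp_boxPoint hσ hf') k l)
    (fun p hp => by
      have := green_of_hasTrace hA hf hf' h1 h2
        (g := modeFactors A σ (cosMode (2 * A) k) (n l) p)
        (contDiff_modeFactors (contDiff_cosMode _ _) (hns l) hp)
      rwa [update_modeFactors_zero, deriv_cosMode] at this)
  filter_upwards [key] with t ht
  rw [ht, coef_const_mul_fst, neg_mul, neg_neg]

lemma coef_cos_y (hA : 0 < A) (hσ : σ = 1 ∨ σ = -1) (hf : MemLp f 2 (volume.restrict (cube A)))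
    (hf' : MemLp (weakDeriv (cube A) (Pi.single 1 1) f) 2 (volume.restrict (cube A)))
    (h1 : HasTrace A 1 1 f 0) (h2 : HasTrace A 1 (-1) f 0) (hn : IsParseval (2 * A) n)
    (hns : ∀ l, ContDiff ℝ ∞ (n l)) (k l : ℤ) :
    ∀ᵐ t ∂volume.restrict (Ioo 0 (2 * A)),
      coef (2 * A) (n k) (cosMode (2 * A) l)
          (fun q => weakDeriv (cube A) (Pi.single 1 1) f (boxPoint A σ q)) t =
        freq (2 * A) l *
          coef (2 * A) (n k) (sinMode (2 * A) l) (fun q => f (boxPoint A σ q)) t := by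
  have hP : 0 < 2 * A := by linarith
  have hc := isParseval_cosMode hP
  have hs := isParseval_sinMode hP
  have key := coef_eq_neg_of_green (a := n k) (b := cosMode (2 * A) l) (a' := n k)
    (b' := fun x => -freq (2 * A) l * sinMode (2 * A) l x) hσ hf hf'
    (hn.continuous k) (hc.continuous l) (hn.continuous k) (continuous_const.mul (hs.continuous l))
    (by
      rw [funext (coef_const_mul_snd _ _ _ _)]
      exact (hn.memLp_coef hs hP (memLp_boxPoint hσ hf) k l).const_mul _)
    (hn.memLp_coef hc hP (memLp_boxPoint hσ hf') k l)
    (fun p hp => by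
      have := green_of_hasTrace hA hf hf' h1 h2
        (g := modeFactors A σ (n k) (cosMode (2 * A) l) p)
        (contDiff_modeFactors (hns k) (contDiff_cosMode _ _) hp)
      rwa [update_modeFactors_one, deriv_cosMode] at this)
  filter_upwards [key] with t ht
  rw [ht, coef_const_mul_snd, neg_mul, neg_neg]

/-- If the trace of `f` on `{z = σ A}` is zero, its coefficients are the primitives of the
coefficients of `-σ ∂_z f`, in the variable `t = A - σ z`. -/
lemma coef_eq_integral {m : ℤ → ℝ → ℝ} (hA : 0 < A) (hσ : σ = 1 ∨ σ = -1)
    (hf : MemLp f 2 (volume.restrict (cube A)))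
    (hf' : MemLp (weakDeriv (cube A) (Pi.single 2 1) f) 2 (volume.restrict (cube A)))
    (h : HasTrace A 2 σ f 0) (hm : IsParseval (2 * A) m) (hms : ∀ k, ContDiff ℝ ∞ (m k))
    (hn : IsParseval (2 * A) n) (hns : ∀ l, ContDiff ℝ ∞ (n l)) (k l : ℤ) :
    ∀ᵐ t ∂volume.restrict (Ioo 0 (2 * A)),
      coef (2 * A) (m k) (n l) (fun q => f (boxPoint A σ q)) t =
        ∫ s in 0..t, -σ * coef (2 * A) (m k) (n l)
          (fun q => weakDeriv (cube A) (Pi.single 2 1) f (boxPoint A σ q)) s := by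
  have hP : 0 < 2 * A := by linarith
  have h1 := hm.memLp_coef hn hP (memLp_boxPoint hσ hf) k l
  have h2 := hm.memLp_coef hn hP (memLp_boxPoint hσ hf') k l
  refine ae_eq_integral_of_weak hP h1 (h2.const_mul _) fun p hp hpP => ?_
  have hσσ : σ * σ = 1 := by rcases hσ with rfl | rfl <;> norm_num
  -- The requirement that the test function vanish on the face opposite to `{z = σ A}` becomes `p
  -- (2A) = 0`, which is the class of test functions of `ae_eq_integral_of_weak`.
  have hg := h.green (g := modeFactors A σ (m k) (n l) p)
    (contDiff_modeFactors (hms k) (hns l) hp)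
    (by
      have : A - σ * -(σ * A) = 2 * A := by linear_combination A * hσσ
      simp [modeFactors]
      rw [show A + σ * (σ * A) = 2 * A by linear_combination A * hσσ, hpP])
  rw [update_modeFactors_two (hp.differentiable (by simp))] at hg
  have hpc := hp.continuous
  have hpc' : Continuous (deriv p) := (contDiff_deriv hp).continuous
  have hT : ∀ r : ℝ → ℝ, ContDiff ℝ ∞ r →
      MemLp (tensor (modeFactors A σ (m k) (n l) r)) 2 (volume.restrict (cube A)) := fun r hr =>
    memLp_of_continuous (contDiff_tensor (contDiff_modeFactors (hms k) (hns l) hr)).continuous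
  rw [integral_add
    (hf.integrable_fun_mul (hT _ (contDiff_const.mul (contDiff_deriv hp))))
    (hf'.integrable_fun_mul (hT _ hp)),
    ← integral_coef_boxPoint hσ hf (hm.continuous k) (hn.continuous l) (by fun_prop),
    ← integral_coef_boxPoint hσ hf' (hm.continuous k) (hn.continuous l) hpc] at hg
  have hpL : MemLp p 2 (volume.restrict (Ioo 0 (2 * A))) :=
    memLp_of_continuousOn_Icc hpc.continuousOn
  have hpL' : MemLp (deriv p) 2 (volume.restrict (Ioo 0 (2 * A))) :=
    memLp_of_continuousOn_Icc hpc'.continuousOn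
  rw [integral_add (h1.integrable_fun_mul hpL') ((h2.const_mul _).integrable_fun_mul hpL)]
  simp only [mul_left_comm _ (-σ), mul_assoc, integral_const_mul] at hg ⊢
  linear_combination (-σ) * hg -
    (∫ t in Ioo 0 (2 * A), coef (2 * A) (m k) (n l) (fun q => f (boxPoint A σ q)) t * deriv p t) * hσσ

end CoefDeriv

/-! ### Components of functions in the zero space -/

lemma _root_.MeasureTheory.MemLp.fun_add {X : Type*} [MeasurableSpace X] {μ : Measure X}
    {f g : X → ℝ} (hf : MemLp f 2 μ) (hg : MemLp g 2 μ) : MemLp (fun x => f x + g x) 2 μ :=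
  hf.add hg

/-- The condition on each component of a function in `zeroSpace`. -/
def ZeroComponent (A : ℝ) (S : Surface) (u : E3 → ℝ) : Prop :=
  MemSobolev (cube A) 3 u ∧ HasTrace A 2 S.sign u 0 ∧ HasNormalDeriv A 2 S.sign u 0 ∧
    LateralNeumann A u

/-- The weak derivative `∂_j ∂_i u`, as a derivative of a derivative. -/
def secondDeriv (A : ℝ) (i j : Fin 3) (u : E3 → ℝ) : E3 → ℝ :=
  weakDeriv (cube A) (Pi.single j 1) (weakDeriv (cube A) (Pi.single i 1) u)

lemma Surface.sign_eq (S : Surface) : S.sign = 1 ∨ S.sign = -1 := by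
  cases S
  · exact Or.inr rfl
  · exact Or.inl rfl

lemma mem_multiIndices {m : ℕ} {α : Fin 3 → ℕ} : α ∈ multiIndices m ↔ ∑ i, α i ≤ m := by
  simp only [multiIndices, Finset.mem_filter, Fintype.mem_piFinset, Finset.mem_range,
    Order.lt_add_one_iff, and_iff_right_iff_imp]
  exact fun h i => (Finset.single_le_sum (fun _ _ => Nat.zero_le _) (Finset.mem_univ i)).trans h

lemma MemSobolev.mono {D : Set E3} {m m' : ℕ} {u : E3 → ℝ} (h : MemSobolev D m u) (hm : m' ≤ m) :
    MemSobolev D m' u :=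
  ⟨h.1, fun α hα => h.2 α (mem_multiIndices.2 ((mem_multiIndices.1 hα).trans hm))⟩

section Sobolev

variable {A : ℝ} {u : E3 → ℝ}

lemma MemSobolev.first {D : Set E3} (h : MemSobolev D 2 u) (i : Fin 3) :
    HasWeakDeriv D (Pi.single i 1) u (weakDeriv D (Pi.single i 1) u) :=
  hasWeakDeriv_weakDeriv (h.2 _ (mem_multiIndices.2 (by simp)))

lemma MemSobolev.second {D : Set E3} (h : MemSobolev D 2 u) (i j : Fin 3) :
    HasWeakDeriv D (Pi.single i 1 + Pi.single j 1) u
      (weakDeriv D (Pi.single i 1 + Pi.single j 1) u) :=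
  hasWeakDeriv_weakDeriv (h.2 _ (mem_multiIndices.2 (by simp [Finset.sum_add_distrib])))

lemma MemSobolev.weakDeriv_first {D : Set E3} (h : MemSobolev D 2 u) (i j : Fin 3) :
    HasWeakDeriv D (Pi.single j 1) (weakDeriv D (Pi.single i 1) u)
      (weakDeriv D (Pi.single i 1 + Pi.single j 1) u) :=
  (h.first i).of_second (h.second i j)

lemma MemSobolev.secondDeriv_spec (h : MemSobolev (cube A) 2 u) (i j : Fin 3) :
    HasWeakDeriv (cube A) (Pi.single j 1) (weakDeriv (cube A) (Pi.single i 1) u)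
      (secondDeriv A i j u) :=
  hasWeakDeriv_weakDeriv ⟨_, h.weakDeriv_first i j⟩

lemma MemSobolev.secondDeriv_ae_eq (h : MemSobolev (cube A) 2 u) (i j : Fin 3) :
    secondDeriv A i j u =ᵐ[volume.restrict (cube A)]
      weakDeriv (cube A) (Pi.single i 1 + Pi.single j 1) u :=
  (h.weakDeriv_first i j).weakDeriv_ae_eq (isOpen_cube A)

lemma HasNormalDeriv.hasTrace_zero {i : Fin 3} {σ : ℝ} (h : HasNormalDeriv A i σ u 0) :
    HasTrace A i σ (weakDeriv (cube A) (Pi.single i 1) u) 0 := by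
  have : (fun y : Fin 2 → ℝ => σ * (0 : (Fin 2 → ℝ) → ℝ) y) = 0 := by
    funext y; simp
  rw [HasNormalDeriv, this] at h
  exact h

/-- The Cauchy data on `S` give the zero values of each mode and of its derivative at `t = 0`; the
cutoff gives those at `t = 2A`, where nothing is known about `u`. The listed functions are the
product-rule derivatives of `χ u`, with `∂_t = -σ ∂_z`. -/
lemma isModal_of_zeroComponent (hA : 0 < A) {S : Surface} (hu : ZeroComponent A S u) {χ : ℝ → ℝ}
    (hχ : ContDiff ℝ ∞ χ) (h0 : χ (2 * A) = 0) (h1 : deriv χ (2 * A) = 0) :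
    IsModal (2 * A)
      (fun q => χ q.2.2 * u (boxPoint A S.sign q))
      (fun q => χ q.2.2 * weakDeriv (cube A) (Pi.single 0 1) u (boxPoint A S.sign q))
      (fun q => χ q.2.2 * weakDeriv (cube A) (Pi.single 1 1) u (boxPoint A S.sign q))
      (fun q => deriv χ q.2.2 * u (boxPoint A S.sign q) +
        χ q.2.2 * -S.sign * weakDeriv (cube A) (Pi.single 2 1) u (boxPoint A S.sign q))
      (fun q => χ q.2.2 * secondDeriv A 0 0 u (boxPoint A S.sign q))
      (fun q => χ q.2.2 * secondDeriv A 1 1 u (boxPoint A S.sign q))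
      (fun q => χ q.2.2 * secondDeriv A 0 1 u (boxPoint A S.sign q))
      (fun q => deriv χ q.2.2 * weakDeriv (cube A) (Pi.single 0 1) u (boxPoint A S.sign q) +
        χ q.2.2 * -S.sign * secondDeriv A 2 0 u (boxPoint A S.sign q))
      (fun q => deriv χ q.2.2 * weakDeriv (cube A) (Pi.single 1 1) u (boxPoint A S.sign q) +
        χ q.2.2 * -S.sign * secondDeriv A 2 1 u (boxPoint A S.sign q))
      (fun q => deriv (deriv χ) q.2.2 * u (boxPoint A S.sign q) +
        2 * deriv χ q.2.2 * -S.sign * weakDeriv (cube A) (Pi.single 2 1) u (boxPoint A S.sign q) +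
        χ q.2.2 * secondDeriv A 2 2 u (boxPoint A S.sign q)) := by
  obtain ⟨hm3, htr, hnd, hlat⟩ := hu
  have hm := hm3.mono (m' := 2) (by norm_num)
  have hσ := S.sign_eq
  set σ := S.sign
  have hσσ : σ * σ = 1 := by rcases hσ with h | h <;> rw [h] <;> norm_num
  have hP : 0 < 2 * A := by linarith
  have hc := isParseval_cosMode hP
  have hs := isParseval_sinMode hP
  have hcs := contDiff_cosMode (2 * A)
  have hss := contDiff_sinMode (2 * A)
  have uL := hm.1
  have dL : ∀ i, MemLp (weakDeriv (cube A) (Pi.single i 1) u) 2 (volume.restrict (cube A)) :=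
    fun i => (hm.first i).1
  have ddL : ∀ i j, MemLp (secondDeriv A i j u) 2 (volume.restrict (cube A)) :=
    fun i j => (hm.secondDeriv_spec i j).1
  have uB := memLp_boxPoint hσ uL
  have dB := fun i => memLp_boxPoint hσ (dL i)
  have ddB := fun i j => memLp_boxPoint hσ (ddL i j)
  have hχ1 := contDiff_deriv hχ
  have hχ2 := contDiff_deriv hχ1
  have c0 := hχ.continuous
  have c1 := hχ1.continuous
  have c2 := hχ2.continuous
  have b0 : Continuous fun q : ℝ × ℝ × ℝ => χ q.2.2 := by fun_prop
  have b0' : Continuous fun q : ℝ × ℝ × ℝ => χ q.2.2 * -σ := by fun_prop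
  have b1 : Continuous fun q : ℝ × ℝ × ℝ => deriv χ q.2.2 := by fun_prop
  have b1' : Continuous fun q : ℝ × ℝ × ℝ => 2 * deriv χ q.2.2 * -σ := by fun_prop
  have b2 : Continuous fun q : ℝ × ℝ × ℝ => deriv (deriv χ) q.2.2 := by fun_prop
  have Lt := (memLp_box_mul b1 uB).fun_add (memLp_box_mul b0' (dB 2))
  have Ltt1 := (memLp_box_mul b2 uB).fun_add (memLp_box_mul b1' (dB 2))
  have Ltt := Ltt1.fun_add (memLp_box_mul b0 (ddB 2 2))
  have Lxx := memLp_box_mul b0 (ddB 0 0)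
  have Lyy := memLp_box_mul b0 (ddB 1 1)
  refine ⟨memLp_box_mul b0 uB, memLp_box_mul b0 (dB 0), memLp_box_mul b0 (dB 1), Lt, Lxx, Lyy,
    memLp_box_mul b0 (ddB 0 1), (memLp_box_mul b1 (dB 0)).add (memLp_box_mul b0' (ddB 2 0)),
    (memLp_box_mul b1 (dB 1)).add (memLp_box_mul b0' (ddB 2 1)), Ltt, fun k l => ?_⟩
  -- The mode is constructed from the top down, as the double primitive `W` of the coefficient of
  -- `u_zz`. The traces on `S` then identify `W₁` and `W` with the coefficients of `-σ u_z` and `u`;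
  -- the two signs cancel because `σ² = 1`.
  set w₂ : ℝ → ℝ := coef (2 * A) (cosMode (2 * A) k) (cosMode (2 * A) l)
    (fun q => secondDeriv A 2 2 u (boxPoint A σ q)) with hw₂
  set W₁ : ℝ → ℝ := fun t => ∫ s in 0..t, w₂ s with hW₁
  set W : ℝ → ℝ := fun t => ∫ s in 0..t, W₁ s with hW
  have HW₁ : HasL2Deriv (2 * A) W₁ w₂ := hasL2Deriv_integral hP (hc.memLp_coef hc hP (ddB 2 2) k l)
  have HW : HasL2Deriv (2 * A) W W₁ := hasL2Deriv_integral hP (HW₁.memLp_self hP)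
  have W₁0 : W₁ 0 = 0 := by simp [hW₁]
  have W0 : W 0 = 0 := by simp [hW]
  have rz := coef_eq_integral hA hσ uL (dL 2) htr hc hcs hc hcs k l
  have rzz := coef_eq_integral hA hσ (dL 2) (ddL 2 2) hnd.hasTrace_zero hc hcs hc hcs k l
  have e1 : ∀ᵐ t ∂volume.restrict (Ioo 0 (2 * A)),
      -σ * coef (2 * A) (cosMode (2 * A) k) (cosMode (2 * A) l)
        (fun q => weakDeriv (cube A) (Pi.single 2 1) u (boxPoint A σ q)) t = W₁ t := by
    filter_upwards [rzz] with t ht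
    rw [ht, intervalIntegral.integral_const_mul]
    simp only [hW₁, hw₂, secondDeriv]
    rw [← mul_assoc, neg_mul_neg, hσσ, one_mul]
  have e0 : ∀ᵐ t ∂volume.restrict (Ioo 0 (2 * A)),
      coef (2 * A) (cosMode (2 * A) k) (cosMode (2 * A) l)
        (fun q => u (boxPoint A σ q)) t = W t := by
    have e1' := (ae_restrict_iff' measurableSet_Ioo).1 e1
    filter_upwards [rz, ae_restrict_mem measurableSet_Ioo] with t ht htI
    rw [ht]
    refine intervalIntegral.integral_congr_ae ?_
    filter_upwards [e1'] with s hs hsI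
    rw [uIoc_of_le htI.1.le] at hsI
    exact hs ⟨hsI.1, hsI.2.trans_lt htI.2⟩
  have rx := coef_sin_x hA hσ uL (hm.first 0) hc hcs k l
  have ry := coef_sin_y hA hσ uL (hm.first 1) hc hcs k l
  have rxx := coef_cos_x hA hσ (dL 0) (ddL 0 0) (hlat 0 (by decide) 1 (Or.inl rfl)).hasTrace_zero
    (hlat 0 (by decide) (-1) (Or.inr rfl)).hasTrace_zero hc hcs k l
  have ryy := coef_cos_y hA hσ (dL 1) (ddL 1 1) (hlat 1 (by decide) 1 (Or.inl rfl)).hasTrace_zero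
    (hlat 1 (by decide) (-1) (Or.inr rfl)).hasTrace_zero hc hcs k l
  have rxy := coef_sin_y hA hσ (dL 0) (hm.secondDeriv_spec 0 1) hs hss k l
  have rxt := coef_sin_x hA hσ (dL 2) (hm.secondDeriv_spec 2 0) hc hcs k l
  have ryt := coef_sin_y hA hσ (dL 2) (hm.secondDeriv_spec 2 1) hc hcs k l
  have at' := coef_add hc hc hP (memLp_box_mul b1 uB) (memLp_box_mul b0' (dB 2)) k l
  have axt := coef_add hs hc hP (memLp_box_mul b1 (dB 0)) (memLp_box_mul b0' (ddB 2 0)) k l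
  have ayt := coef_add hc hs hP (memLp_box_mul b1 (dB 1)) (memLp_box_mul b0' (ddB 2 1)) k l
  have att1 := coef_add hc hc hP (memLp_box_mul b2 uB) (memLp_box_mul b1' (dB 2)) k l
  have att := coef_add hc hc hP Ltt1 (memLp_box_mul b0 (ddB 2 2)) k l
  have aG1 := coef_add hc hc hP Lxx Lyy k l
  have aG := coef_add hc hc hP (Lxx.fun_add Lyy) Ltt k l
  have m0 := fun a b F => coef_mul_left (P := 2 * A) a b χ F
  have m0' := fun a b F => coef_mul_left (P := 2 * A) a b (fun t => χ t * -σ) F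
  have m1 := fun a b F => coef_mul_left (P := 2 * A) a b (deriv χ) F
  have m1' := fun a b F => coef_mul_left (P := 2 * A) a b (fun t => 2 * deriv χ t * -σ) F
  have m2 := fun a b F => coef_mul_left (P := 2 * A) a b (deriv (deriv χ)) F
  refine ⟨fun t => χ t * W t, fun t => deriv χ t * W t + χ t * W₁ t,
    fun t => (deriv (deriv χ) t * W t + deriv χ t * W₁ t) + (deriv χ t * W₁ t + χ t * w₂ t),
    HW.smooth_mul hP (hχ.of_le (by norm_cast)),
    (HW.smooth_mul hP (hχ1.of_le (by norm_cast))).add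
      (HW₁.smooth_mul hP (hχ.of_le (by norm_cast))),
    by simp [W0], by simp [h0], by simp [W0, W₁0], by simp [h0, h1], ?_⟩
  filter_upwards [e0, e1, rx, ry, rxx, ryy, rxy, rxt, ryt, at', axt, ayt, att1, att, aG1, aG] with
    t e0 e1 rx ry rxx ryy rxy rxt ryt at' axt ayt att1 att aG1 aG
  rw [m0'] at at' axt ayt
  rw [m1] at at' axt ayt
  rw [m1', m2] at att1
  rw [m0, att1] at att
  rw [m0, m0] at aG1
  rw [aG1, att] at aG
  change coef _ _ _ (fun q => secondDeriv A 0 0 u (boxPoint A σ q)) t = _ at rxx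
  change coef _ _ _ (fun q => secondDeriv A 1 1 u (boxPoint A σ q)) t = _ at ryy
  refine ⟨?_, ?_, ?_, ?_, ?_, ?_, ?_, ?_, ?_, ?_, ?_⟩
  · rw [m0, e0]
  · rw [m0, rx, e0]; ring
  · rw [m0, ry, e0]; ring
  · rw [at', e0, ← e1]; ring
  · rw [m0, rxx, rx, e0]; ring
  · rw [m0, ryy, ry, e0]; ring
  · rw [m0, rxy, rx, e0]; ring
  · rw [axt, rxt, rx, e0, ← e1]; ring
  · rw [ayt, ryt, ry, e0, ← e1]; ring
  · rw [att, e0, ← e1]; ring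
  · rw [aG, rxx, ryy, rx, ry, e0, ← e1]; ring

end Sobolev

/-! ### Bounds for the elliptic operator -/

section Operator

variable {A M : ℝ} {N : ℕ}

lemma sum_sq_entries_le {K : E3 → Matrix (Fin N) (Fin N) ℝ} (hK : ContinuousOn K (closedCube A))
    (hM : matrixNorm A K ≤ M) {x : E3} (hx : x ∈ closedCube A) :
    ∑ n, ∑ m, K x n m ^ 2 ≤ M ^ 2 := by
  have hM0 : 0 ≤ M := (Real.sqrt_nonneg _).trans hM
  refine le_trans ?_ ((Real.sqrt_le_left hM0).1 hM)
  refine Finset.sum_le_sum fun n _ => Finset.sum_le_sum fun m _ => ?_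
  rw [← sq_abs]
  refine pow_le_pow_left₀ (abs_nonneg _) ?_ 2
  have hc : ContinuousOn (fun x => |K x n m|) (closedCube A) :=
    ((continuous_apply_apply n m).comp_continuousOn hK).abs
  exact le_csSup ((isCompact_closedCube A).image_of_continuousOn hc).bddAbove
    (mem_image_of_mem _ hx)

/-- Cauchy–Schwarz row by row. The Frobenius form of the bound keeps all later constants independent
of `N`. -/
lemma sum_sq_mulVec_le (a : Fin N → Fin N → ℝ) (v : Fin N → ℝ) (h : ∑ n, ∑ m, a n m ^ 2 ≤ M ^ 2) :
    ∑ n, (∑ m, a n m * v m) ^ 2 ≤ M ^ 2 * ∑ m, v m ^ 2 := by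
  calc ∑ n, (∑ m, a n m * v m) ^ 2 ≤ ∑ n, (∑ m, a n m ^ 2) * ∑ m, v m ^ 2 :=
        Finset.sum_le_sum fun n _ => Finset.sum_mul_sq_le_sq_mul_sq _ _ _
    _ = (∑ n, ∑ m, a n m ^ 2) * ∑ m, v m ^ 2 := (Finset.sum_mul _ _ _).symm
    _ ≤ _ := mul_le_mul_of_nonneg_right h (Finset.sum_nonneg fun _ _ => sq_nonneg _)

lemma memLp_entry_mul {K : E3 → Matrix (Fin N) (Fin N) ℝ} (hK : ContinuousOn K (closedCube A))
    (n m : Fin N) {f : E3 → ℝ} (hf : MemLp f 2 (volume.restrict (cube A))) :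
    MemLp (fun x => K x n m * f x) 2 (volume.restrict (cube A)) := by
  have hc : ContinuousOn (fun x => K x n m) (closedCube A) :=
    (continuous_apply_apply n m).comp_continuousOn hK
  obtain ⟨C, hC⟩ := (isCompact_closedCube A).exists_bound_of_continuousOn hc
  refine MemLp.of_le_mul (c := C) hf
    (((hc.mono (cube_subset_closedCube A)).aestronglyMeasurable (measurableSet_cube A)).mul hf.1) ?_
  filter_upwards [ae_restrict_mem (measurableSet_cube A)] with x hx
  rw [norm_mul]
  exact mul_le_mul_of_nonneg_right (hC x (cube_subset_closedCube A hx)) (norm_nonneg _)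

lemma single_two (i : Fin 3) : (Pi.single i 2 : Fin 3 → ℕ) = Pi.single i 1 + Pi.single i 1 := by
  rw [← Pi.single_add]

lemma EllipticSystem.memLp_apply (L : EllipticSystem A N) {U : Fin N → E3 → ℝ}
    (hU : MemSobolevVec (cube A) 2 U) (n : Fin N) :
    MemLp (L.apply U n) 2 (volume.restrict (cube A)) := by
  have h1 : MemLp (fun x => ∑ i, weakDeriv (cube A) (Pi.single i 2) (U n) x) 2
      (volume.restrict (cube A)) :=
    memLp_finsetSum _ fun i _ => by rw [single_two]; exact ((hU n).second i i).1
  have h2 : MemLp (fun x => ∑ j, ∑ m, L.first j x n m *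
      weakDeriv (cube A) (Pi.single j 1) (U m) x) 2 (volume.restrict (cube A)) :=
    memLp_finsetSum _ fun j _ => memLp_finsetSum _ fun m _ =>
      memLp_entry_mul (L.first_continuous j) n m ((hU m).first j).1
  have h3 : MemLp (fun x => ∑ m, L.zeroth x n m * U m x) 2 (volume.restrict (cube A)) :=
    memLp_finsetSum _ fun m _ => memLp_entry_mul L.zeroth_continuous n m (hU m).1
  exact (h1.add h2).add h3

/-! ### The `H²` norm as an explicit sum -/

lemma weakDeriv_zero_ae_eq {D : Set E3} (hD : IsOpen D) {u : E3 → ℝ}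
    (hu : MemLp u 2 (volume.restrict D)) : weakDeriv D 0 u =ᵐ[volume.restrict D] u :=
  (hasWeakDeriv_zero hu).weakDeriv_ae_eq hD

lemma multiIndices_two : multiIndices 2 = {0, Pi.single 0 1, Pi.single 1 1, Pi.single 2 1,
    Pi.single 0 1 + Pi.single 0 1, Pi.single 1 1 + Pi.single 1 1, Pi.single 0 1 + Pi.single 1 1,
    Pi.single 2 1 + Pi.single 0 1, Pi.single 2 1 + Pi.single 1 1,
    Pi.single 2 1 + Pi.single 2 1} := by
  decide

lemma sum_multiIndices_two (f : (Fin 3 → ℕ) → ℝ) : ∑ α ∈ multiIndices 2, f α =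
    f 0 + f (Pi.single 0 1) + f (Pi.single 1 1) + f (Pi.single 2 1) +
      (f (Pi.single 0 1 + Pi.single 0 1) + f (Pi.single 1 1 + Pi.single 1 1) +
      f (Pi.single 0 1 + Pi.single 1 1) + f (Pi.single 2 1 + Pi.single 0 1) +
      f (Pi.single 2 1 + Pi.single 1 1) + f (Pi.single 2 1 + Pi.single 2 1)) := by
  rw [multiIndices_two]
  repeat rw [Finset.sum_insert (by decide)]
  rw [Finset.sum_singleton]
  ring

lemma sobolevNormSq_nonneg (D : Set E3) (m : ℕ) (u : E3 → ℝ) : 0 ≤ sobolevNormSq D m u :=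
  Finset.sum_nonneg fun _ _ => integral_nonneg fun _ => sq_nonneg _

lemma sobolevNormVec_sq (D : Set E3) (m : ℕ) (U : Fin N → E3 → ℝ) :
    sobolevNormVec D m U ^ 2 = ∑ n, sobolevNormSq D m (U n) :=
  Real.sq_sqrt (Finset.sum_nonneg fun _ _ => sobolevNormSq_nonneg _ _ _)

lemma sobolevNormVec_nonneg (D : Set E3) (m : ℕ) (U : Fin N → E3 → ℝ) :
    0 ≤ sobolevNormVec D m U := Real.sqrt_nonneg _

/-- The norm on a smaller domain, in terms of the derivatives on the larger one. -/
lemma sobolevNormSq_eq_of_subset {D D' : Set E3} (hD' : IsOpen D') (h : D' ⊆ D) {m : ℕ}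
    {u : E3 → ℝ} (hu : MemSobolev D m u) :
    sobolevNormSq D' m u = ∑ α ∈ multiIndices m, ∫ x in D', weakDeriv D α u x ^ 2 := by
  refine Finset.sum_congr rfl fun α hα => integral_congr_ae ?_
  have h1 := (hasWeakDeriv_weakDeriv (hu.2 α hα)).mono h
  filter_upwards [h1.weakDeriv_ae_eq hD'] with x hx
  rw [hx]

end Operator

/-! ### Conditional stability of the Cauchy problem -/

/-- The increment of `ψ` is `(t - s)(4P - s - t)`. -/
lemma weight_anti {P lam s t : ℝ} (hlam : 0 ≤ lam) (hst : s ≤ t) (ht : t ≤ 2 * P) :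
    weight P lam t ≤ weight P lam s := by
  refine Real.exp_le_exp.2 (neg_le_neg (mul_le_mul_of_nonneg_left ?_ (by positivity)))
  nlinarith [mul_nonneg (sub_nonneg.2 hst) (by linarith : 0 ≤ 4 * P - s - t)]

lemma weight_le_one {P lam t : ℝ} (hlam : 0 ≤ lam) (h0 : 0 ≤ t) (ht : t ≤ 2 * P) :
    weight P lam t ≤ 1 := by
  have := weight_anti hlam h0 ht
  simpa [weight] using this

/-- A smooth function equal to `1` on `(-∞, a]` and to `0` near `P`. -/
lemma exists_endCutoff {P a : ℝ} (ha : a < P) : ∃ χ : ℝ → ℝ, ContDiff ℝ ∞ χ ∧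
    (∀ t, 0 ≤ χ t ∧ χ t ≤ 1) ∧ (∀ t < a, χ t = 1 ∧ deriv χ t = 0 ∧ deriv (deriv χ) t = 0) ∧
    χ P = 0 ∧ deriv χ P = 0 := by
  -- The argument `(P - b - t) / b` is at least `1` for `t ≤ P - 2b = a` and at most `0` for `t ≥ P
  -- - b`, so the transition ends strictly before `P`.
  set b := (P - a) / 2 with hb
  have hb0 : 0 < b := by rw [hb]; linarith
  refine ⟨fun t => Real.smoothTransition ((P - b - t) / b),
    Real.smoothTransition.contDiff.comp (by fun_prop),
    fun t => ⟨Real.smoothTransition.nonneg _, Real.smoothTransition.le_one _⟩, fun t ht => ?_, ?_, ?_⟩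
  · have h1 : (fun t => Real.smoothTransition ((P - b - t) / b)) =ᶠ[nhds t] fun _ => 1 := by
      filter_upwards [Iio_mem_nhds ht] with s hs
      refine Real.smoothTransition.one_of_one_le ?_
      rw [le_div_iff₀ hb0]
      have : s < a := hs
      linarith
    refine ⟨h1.eq_of_nhds, by rw [h1.deriv_eq, deriv_const], ?_⟩
    have h2 := h1.deriv
    rw [h2.deriv_eq]
    simp
  · refine Real.smoothTransition.zero_of_nonpos ?_
    rw [div_nonpos_iff]
    right; constructor <;> linarith
  · have h1 : (fun t => Real.smoothTransition ((P - b - t) / b)) =ᶠ[nhds P] fun _ => 0 := by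
      filter_upwards [Ioi_mem_nhds (show P - b < P by linarith)] with s hs
      refine Real.smoothTransition.zero_of_nonpos ?_
      rw [div_nonpos_iff]
      have : P - b < s := hs
      right; constructor <;> linarith
    rw [h1.deriv_eq, deriv_const]

lemma sum_sq_add_le_eight {N : ℕ} (x : Fin 8 → Fin N → ℝ) :
    ∑ n, (x 0 n + x 1 n + x 2 n + x 3 n + x 4 n + x 5 n + x 6 n + x 7 n) ^ 2 ≤
      8 * (∑ n, x 0 n ^ 2 + ∑ n, x 1 n ^ 2 + ∑ n, x 2 n ^ 2 + ∑ n, x 3 n ^ 2 + ∑ n, x 4 n ^ 2 +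
        ∑ n, x 5 n ^ 2 + ∑ n, x 6 n ^ 2 + ∑ n, x 7 n ^ 2) := by
  simp only [← Finset.sum_add_distrib]
  rw [Finset.mul_sum]
  refine Finset.sum_le_sum fun n _ => ?_
  have := sq_sum_le_card_mul_sum_sq (s := Finset.univ) (f := fun i => x i n)
  simpa [Fin.sum_univ_eight] using this

/-- The pointwise estimate for `Δ` of a localized solution. -/
lemma sum_sq_localized_le {N : ℕ} {M σ χ χ' χ'' : ℝ} (hσ : σ = 1 ∨ σ = -1)
    (a : Fin 3 → Fin N → Fin N → ℝ) (a₀ : Fin N → Fin N → ℝ)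
    (ha : ∀ j, ∑ n, ∑ m, a j n m ^ 2 ≤ M ^ 2) (ha₀ : ∑ n, ∑ m, a₀ n m ^ 2 ≤ M ^ 2)
    (u Lu : Fin N → ℝ) (d : Fin 3 → Fin N → ℝ) (dd : Fin 3 → Fin N → ℝ)
    (h : ∀ n, Lu n = (∑ i, dd i n) + (∑ j, ∑ m, a j n m * d j m) + ∑ m, a₀ n m * u m) :
    ∑ n, (χ * dd 0 n + χ * dd 1 n + (χ'' * u n + 2 * χ' * -σ * d 2 n + χ * dd 2 n)) ^ 2 ≤
      8 * (χ ^ 2 * ∑ n, Lu n ^ 2 + M ^ 2 * (∑ n, (χ * u n) ^ 2 + ∑ n, (χ * d 0 n) ^ 2 +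
        ∑ n, (χ * d 1 n) ^ 2 + ∑ n, (χ' * u n + χ * -σ * d 2 n) ^ 2) +
        ((M ^ 2 * χ' ^ 2 + χ'' ^ 2) * ∑ n, u n ^ 2 + 4 * χ' ^ 2 * ∑ n, d 2 n ^ 2)) := by
  have hσσ : σ ^ 2 = 1 := by rcases hσ with rfl | rfl <;> norm_num
  -- The Laplacian is expressed through `L` and the lower-order terms. Derivatives in `z` are
  -- rewritten with `∂_t(χu) = χ'u - σχu_z`, so that every term is either controlled by the energies
  -- of `χu` and its gradient or contains a derivative of `χ`.
  set x : Fin 8 → Fin N → ℝ := ![fun n => χ * Lu n, fun n => -∑ m, a₀ n m * (χ * u m),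
    fun n => -∑ m, a 0 n m * (χ * d 0 m), fun n => -∑ m, a 1 n m * (χ * d 1 m),
    fun n => σ * ∑ m, a 2 n m * (χ' * u m + χ * -σ * d 2 m),
    fun n => -σ * ∑ m, a 2 n m * (χ' * u m), fun n => χ'' * u n,
    fun n => 2 * χ' * -σ * d 2 n] with hx
  have e : ∀ n, χ * dd 0 n + χ * dd 1 n + (χ'' * u n + 2 * χ' * -σ * d 2 n + χ * dd 2 n) =
      x 0 n + x 1 n + x 2 n + x 3 n + x 4 n + x 5 n + x 6 n + x 7 n := by
    intro n
    have l : ∀ (b : Fin N → ℝ) (c : ℝ) (v : Fin N → ℝ), ∑ m, b m * (c * v m) = c * ∑ m, b m * v m :=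
      fun b c v => by simp only [Finset.mul_sum, mul_left_comm]
    simp only [hx, Matrix.cons_val]
    rw [h n, Fin.sum_univ_three, Fin.sum_univ_three]
    simp only [mul_add (a 2 n _), Finset.sum_add_distrib, l]
    linear_combination (χ * ∑ m, a 2 n m * d 2 m) * hσσ
  simp only [e]
  refine (sum_sq_add_le_eight x).trans (mul_le_mul_of_nonneg_left ?_ (by norm_num))
  have t1 : ∑ n, x 1 n ^ 2 ≤ M ^ 2 * ∑ n, (χ * u n) ^ 2 := by
    simp only [hx, Matrix.cons_val, neg_sq]
    exact sum_sq_mulVec_le _ _ ha₀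
  have t2 : ∑ n, x 2 n ^ 2 ≤ M ^ 2 * ∑ n, (χ * d 0 n) ^ 2 := by
    simp only [hx, Matrix.cons_val, neg_sq]
    exact sum_sq_mulVec_le _ _ (ha 0)
  have t3 : ∑ n, x 3 n ^ 2 ≤ M ^ 2 * ∑ n, (χ * d 1 n) ^ 2 := by
    simp only [hx, Matrix.cons_val, neg_sq]
    exact sum_sq_mulVec_le _ _ (ha 1)
  have t4 : ∑ n, x 4 n ^ 2 ≤ M ^ 2 * ∑ n, (χ' * u n + χ * -σ * d 2 n) ^ 2 := by
    simp only [hx, Matrix.cons_val, mul_pow, hσσ, one_mul]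
    exact sum_sq_mulVec_le _ _ (ha 2)
  have t5 : ∑ n, x 5 n ^ 2 ≤ M ^ 2 * ∑ n, (χ' * u n) ^ 2 := by
    simp only [hx, Matrix.cons_val, mul_pow, neg_sq, hσσ, one_mul]
    refine (sum_sq_mulVec_le _ _ (ha 2)).trans (le_of_eq ?_)
    simp only [mul_pow]
  have t0 : ∑ n, x 0 n ^ 2 = χ ^ 2 * ∑ n, Lu n ^ 2 := by
    simp only [hx, Matrix.cons_val, mul_pow, Finset.mul_sum]
  have t6 : ∑ n, x 6 n ^ 2 = χ'' ^ 2 * ∑ n, u n ^ 2 := by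
    simp only [hx, Matrix.cons_val, mul_pow, Finset.mul_sum]
  have t7 : ∑ n, x 7 n ^ 2 = 4 * χ' ^ 2 * ∑ n, d 2 n ^ 2 := by
    simp only [hx, Matrix.cons_val, mul_pow, neg_sq, hσσ, mul_one, Finset.mul_sum]
    norm_num
  have t5' : ∑ n, (χ' * u n) ^ 2 = χ' ^ 2 * ∑ n, u n ^ 2 := by
    simp only [mul_pow, Finset.mul_sum]
  rw [t5'] at t5
  rw [t0, t6, t7]
  linarith

lemma boxPoint_mem_subdomain {A ε : ℝ} {S : Surface} {q : ℝ × ℝ × ℝ}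
    (h : boxPoint A S.sign q ∈ subdomain A ε S) : q.2.2 < 2 * A - ε := by
  cases S
  · have := h.2
    simp only [boxPoint, Surface.sign, Matrix.cons_val] at this
    linarith
  · have := h.2
    simp only [boxPoint, Surface.sign, Matrix.cons_val] at this
    linarith

/-- The subdomain lies in `t < 2A - ε`, where the decreasing weight exceeds its value at `2A - ε`.
In the application `H` is a derivative of `χu`, which agrees there with that of `u` up to sign. -/
lemma weight_mul_integral_subdomain_le {A ε lam : ℝ} (hA : 0 < A) (hε : 0 < ε) (hlam : 0 ≤ lam)
    {S : Surface} {f : E3 → ℝ} {H : ℝ × ℝ × ℝ → ℝ} (hf : MemLp f 2 (volume.restrict (cube A)))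
    (hH : MemLp H 2 (boxMeasure (2 * A)))
    (h : ∀ q : ℝ × ℝ × ℝ, q.2.2 < 2 * A - ε → H q ^ 2 = f (boxPoint A S.sign q) ^ 2) :
    weight (2 * A) lam (2 * A - ε) * ∫ x in subdomain A ε S, f x ^ 2 ≤
      boxEnergy (2 * A) lam H := by
  have hm := (isOpen_subdomain A ε S).measurableSet
  have hi : Integrable (indicator (subdomain A ε S) fun x => f x ^ 2) (volume.restrict (cube A)) :=
    hf.integrable_sq.indicator hm
  have e : ∫ x in subdomain A ε S, f x ^ 2 =
      ∫ q, indicator (subdomain A ε S) (fun x => f x ^ 2) (boxPoint A S.sign q)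
        ∂boxMeasure (2 * A) := by
    rw [integral_boxPoint S.sign_eq hi.1, integral_indicator hm, Measure.restrict_restrict hm,
      inter_eq_left.2 (subdomain_subset A ε S)]
  rw [e, ← integral_const_mul, boxEnergy]
  refine integral_mono ?_ (integrable_box_weight_sq (continuous_box_weight _ _) hH) fun q => ?_
  · exact ((measurePreserving_boxPoint S.sign_eq).integrable_comp hi.1).2 hi |>.const_mul _
  · by_cases hq : boxPoint A S.sign q ∈ subdomain A ε S
    · have ht := boxPoint_mem_subdomain hq
      simp only [indicator_of_mem hq]
      rw [h q ht]
      exact mul_le_mul_of_nonneg_right (weight_anti hlam ht.le (by linarith)) (sq_nonneg _)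
    · simp only [indicator_of_notMem hq, mul_zero]
      exact mul_nonneg (weight_pos _ _ _).le (sq_nonneg _)

lemma boxEnergy_sum {P lam : ℝ} {N : ℕ} {F : Fin N → ℝ × ℝ × ℝ → ℝ}
    (hF : ∀ n, MemLp (F n) 2 (boxMeasure P)) :
    Integrable (fun q => weight P lam q.2.2 * ∑ n, F n q ^ 2) (boxMeasure P) ∧
      ∫ q, weight P lam q.2.2 * ∑ n, F n q ^ 2 ∂boxMeasure P = ∑ n, boxEnergy P lam (F n) := by
  have hi : ∀ n, Integrable (fun q => weight P lam q.2.2 * F n q ^ 2) (boxMeasure P) := fun n =>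
    integrable_box_weight_sq (continuous_box_weight P lam) (hF n)
  simp only [Finset.mul_sum]
  exact ⟨integrable_finsetSum _ fun n _ => hi n, integral_finsetSum _ fun n _ => hi n⟩

/-- The Carleman estimate puts `λ` in front of the first-order energy `f1`. Once `λ ≥ 16M²C`, the
lower-order part `8M² f1` of the bound for `g` is at most `g / 2` and moves to the left. -/
lemma localized_absorb {C lam M w0 w1 K H I S f1 f2 g : ℝ} (hC : 0 < C) (h1 : 1 ≤ lam)
    (h2 : 16 * M ^ 2 * C ≤ lam) (hg : 0 ≤ g)
    (e1 : lam * f1 ≤ C * g) (e2 : f2 ≤ C * lam * g) (e3 : g ≤ 8 * (I + M ^ 2 * f1 + w1 * K * H))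
    (e4 : w0 * S ≤ f1 + f2) :
    w0 * S ≤ C * (1 + lam) * (16 * (I + w1 * K * H)) := by
  have hl : 0 < lam := by linarith
  have a1 : M ^ 2 * f1 ≤ g / 16 := by
    have : lam * (M ^ 2 * f1) ≤ lam * (g / 16) := by
      nlinarith [mul_le_mul_of_nonneg_left e1 (sq_nonneg M), mul_le_mul_of_nonneg_right h2 hg]
    exact le_of_mul_le_mul_left this hl
  have a2 : g ≤ 16 * (I + w1 * K * H) := by linarith
  have a3 : f1 ≤ C * g := by
    have : lam * f1 ≤ lam * (C * g) := by nlinarith [mul_nonneg hC.le hg]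
    exact le_of_mul_le_mul_left this hl
  calc w0 * S ≤ C * (1 + lam) * g := by linarith
    _ ≤ _ := mul_le_mul_of_nonneg_left a2 (by positivity)

lemma integral_combination {X : Type*} [MeasurableSpace X] {μ : Measure X}
    {a b₁ b₂ b₃ b₄ c₁ c₂ : X → ℝ} (m k : ℝ) (ha : Integrable a μ) (h1 : Integrable b₁ μ)
    (h2 : Integrable b₂ μ) (h3 : Integrable b₃ μ) (h4 : Integrable b₄ μ) (h5 : Integrable c₁ μ)
    (h6 : Integrable c₂ μ) :
    Integrable (fun q => 8 * (a q + m * (b₁ q + b₂ q + b₃ q + b₄ q) + k * (c₁ q + c₂ q))) μ ∧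
      ∫ q, 8 * (a q + m * (b₁ q + b₂ q + b₃ q + b₄ q) + k * (c₁ q + c₂ q)) ∂μ =
        8 * (∫ q, a q ∂μ + m * (∫ q, b₁ q ∂μ + ∫ q, b₂ q ∂μ + ∫ q, b₃ q ∂μ + ∫ q, b₄ q ∂μ) +
          k * (∫ q, c₁ q ∂μ + ∫ q, c₂ q ∂μ)) := by
  have i1 : Integrable (fun q => b₁ q + b₂ q) μ := h1.add h2
  have i2 : Integrable (fun q => b₁ q + b₂ q + b₃ q) μ := i1.add h3
  have i3 : Integrable (fun q => b₁ q + b₂ q + b₃ q + b₄ q) μ := i2.add h4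
  have i4 : Integrable (fun q => a q + m * (b₁ q + b₂ q + b₃ q + b₄ q)) μ := ha.add (i3.const_mul m)
  have i5 : Integrable (fun q => c₁ q + c₂ q) μ := h5.add h6
  refine ⟨(i4.add (i5.const_mul k)).const_mul 8, ?_⟩
  rw [integral_const_mul, integral_add i4 (i5.const_mul k), integral_add ha (i3.const_mul m),
    integral_const_mul, integral_const_mul, integral_add i2 h4, integral_add i1 h3,
    integral_add h1 h2, integral_add h5 h6]

lemma integral_sq_add_le_sobolevNormSq {A : ℝ} {u : E3 → ℝ} (hu : MemSobolev (cube A) 2 u) :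
    (∫ x in cube A, u x ^ 2) + ∫ x in cube A, weakDeriv (cube A) (Pi.single 2 1) u x ^ 2 ≤
      sobolevNormSq (cube A) 2 u := by
  have h0 : ∫ x in cube A, weakDeriv (cube A) 0 u x ^ 2 = ∫ x in cube A, u x ^ 2 :=
    integral_congr_ae ((weakDeriv_zero_ae_eq (isOpen_cube A) hu.1).mono fun x hx => by
      simp only [hx])
  have hn : ∀ α, 0 ≤ ∫ x in cube A, weakDeriv (cube A) α u x ^ 2 := fun α =>
    integral_nonneg fun _ => sq_nonneg _
  rw [sobolevNormSq, sum_multiIndices_two, h0]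
  linarith [hn (Pi.single 0 1), hn (Pi.single 1 1), hn (Pi.single 0 1 + Pi.single 0 1),
    hn (Pi.single 1 1 + Pi.single 1 1), hn (Pi.single 0 1 + Pi.single 1 1),
    hn (Pi.single 2 1 + Pi.single 0 1), hn (Pi.single 2 1 + Pi.single 1 1),
    hn (Pi.single 2 1 + Pi.single 2 1)]

/-- The Carleman estimate for solutions localized away from the face opposite to `S`. -/
theorem localized_estimate {A ε : ℝ} (hA : 0 < A) (M : ℝ) (hε : 0 < ε) :
    ∃ C lam₀ : ℝ, 0 < C ∧ 1 ≤ lam₀ ∧ ∀ (S : Surface) (N : ℕ) (L : EllipticSystem A N), L.NormLE M →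
      ∀ W : Fin N → E3 → ℝ, (∀ n, ZeroComponent A S (W n)) → ∀ lam, lam₀ ≤ lam →
        weight (2 * A) lam (2 * A - ε) * sobolevNormVec (subdomain A ε S) 2 W ^ 2 ≤
          C * (1 + lam) * ((∫ x in cube A, ∑ n, L.apply W n x ^ 2) +
            weight (2 * A) lam (2 * A - ε / 2) * sobolevNormVec (cube A) 2 W ^ 2) := by
  have hP : 0 < 2 * A := by linarith
  obtain ⟨C, hC, Hbox⟩ := carleman_box hP
  -- The cutoff starts at `2A - ε/2`, beyond the end `2A - ε` of the subdomain. The gap makes the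
  -- weight on the commutator exponentially smaller than the weight on the subdomain.
  obtain ⟨χ, hχ, hχ01, hχ1, hχP, hχP'⟩ := exists_endCutoff (P := 2 * A) (a := 2 * A - ε / 2)
    (by linarith)
  have hχc := hχ.continuous
  have hχc1 := (contDiff_deriv hχ).continuous
  have hχc2 := (contDiff_deriv (contDiff_deriv hχ)).continuous
  obtain ⟨K₁, hK₁⟩ := (isCompact_Icc (a := (0 : ℝ)) (b := 2 * A)).exists_bound_of_continuousOn
    (f := fun t => M ^ 2 * deriv χ t ^ 2 + deriv (deriv χ) t ^ 2 + 4 * deriv χ t ^ 2)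
    (by fun_prop : Continuous _).continuousOn
  set K := max K₁ 0 with hK
  have hK0 : 0 ≤ K := le_max_right _ _
  refine ⟨16 * C * (1 + K), max 1 (16 * M ^ 2 * C), by positivity, le_max_left _ _, ?_⟩
  intro S N L hL W hW lam hlam
  have hlam1 : 1 ≤ lam := (le_max_left _ _).trans hlam
  have hlam0 : 0 ≤ lam := by linarith
  have hσ := S.sign_eq
  set σ := S.sign
  set w1 := weight (2 * A) lam (2 * A - ε / 2)
  have hw1 : 0 < w1 := weight_pos _ _ _
  have hm : ∀ n, MemSobolev (cube A) 2 (W n) := fun n => (hW n).1.mono (by norm_num)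
  set u : Fin N → ℝ × ℝ × ℝ → ℝ := fun n q => W n (boxPoint A σ q) with hu
  set d : Fin 3 → Fin N → ℝ × ℝ × ℝ → ℝ := fun i n q =>
    weakDeriv (cube A) (Pi.single i 1) (W n) (boxPoint A σ q) with hd
  set dd : Fin 3 → Fin 3 → Fin N → ℝ × ℝ × ℝ → ℝ := fun i j n q =>
    secondDeriv A i j (W n) (boxPoint A σ q) with hdd
  set Lu : Fin N → ℝ × ℝ × ℝ → ℝ := fun n q => L.apply W n (boxPoint A σ q) with hLu
  have uB : ∀ n, MemLp (u n) 2 (boxMeasure (2 * A)) := fun n => memLp_boxPoint hσ (hm n).1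
  have dB : ∀ i n, MemLp (d i n) 2 (boxMeasure (2 * A)) := fun i n =>
    memLp_boxPoint hσ ((hm n).first i).1
  have LB : ∀ n, MemLp (Lu n) 2 (boxMeasure (2 * A)) := fun n =>
    memLp_boxPoint hσ (L.memLp_apply hm n)
  have modal := fun n => isModal_of_zeroComponent hA (hW n) hχ hχP hχP'
  have car := fun n => Hbox lam hlam1 _ _ _ _ _ _ _ _ _ _ (modal n)
  set F : Fin N → ℝ × ℝ × ℝ → ℝ := fun n q => χ q.2.2 * u n q with hF
  set Fx : Fin N → ℝ × ℝ × ℝ → ℝ := fun n q => χ q.2.2 * d 0 n q with hFx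
  set Fy : Fin N → ℝ × ℝ × ℝ → ℝ := fun n q => χ q.2.2 * d 1 n q with hFy
  set Ft : Fin N → ℝ × ℝ × ℝ → ℝ := fun n q =>
    deriv χ q.2.2 * u n q + χ q.2.2 * -σ * d 2 n q with hFt
  set G : Fin N → ℝ × ℝ × ℝ → ℝ := fun n q => χ q.2.2 * dd 0 0 n q + χ q.2.2 * dd 1 1 n q +
    (deriv (deriv χ) q.2.2 * u n q + 2 * deriv χ q.2.2 * -σ * d 2 n q + χ q.2.2 * dd 2 2 n q) with hG
  have GB : ∀ n, MemLp (G n) 2 (boxMeasure (2 * A)) := fun n =>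
    ((modal n).memLp_xx.fun_add (modal n).memLp_yy).fun_add (modal n).memLp_tt
  -- The pointwise inequality
  have hdom : ∀ᵐ q ∂boxMeasure (2 * A), (q.2.2 ∈ Ioo 0 (2 * A)) ∧ boxPoint A σ q ∈ cube A ∧
      ∀ n, Lu n q = (∑ i, dd i i n q) + (∑ j, ∑ m, L.first j (boxPoint A σ q) n m * d j m q) +
        ∑ m, L.zeroth (boxPoint A σ q) n m * u m q := by
    have h1 : ∀ᵐ x ∂volume.restrict (cube A), x ∈ cube A ∧ ∀ n, L.apply W n x =
        (∑ i, secondDeriv A i i (W n) x) + (∑ j, ∑ m, L.first j x n m *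
          weakDeriv (cube A) (Pi.single j 1) (W m) x) + ∑ m, L.zeroth x n m * W m x := by
      have h2 : ∀ᵐ x ∂volume.restrict (cube A), ∀ n i,
          secondDeriv A i i (W n) x = weakDeriv (cube A) (Pi.single i 2) (W n) x := by
        rw [ae_all_iff]; intro n
        rw [ae_all_iff]; intro i
        rw [single_two]
        exact (hm n).secondDeriv_ae_eq i i
      filter_upwards [h2, ae_restrict_mem (measurableSet_cube A)] with x hx hxA
      refine ⟨hxA, fun n => ?_⟩
      simp only [EllipticSystem.apply, hx]
    have h3 := (measurePreserving_boxPoint (A := A) hσ).quasiMeasurePreserving.ae h1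
    have h4 : ∀ᵐ q ∂boxMeasure (2 * A), q.2.2 ∈ Ioo 0 (2 * A) := by
      rw [boxMeasure, Measure.prod_restrict, Measure.prod_restrict]
      filter_upwards [ae_restrict_mem
        (measurableSet_Ioo.prod (measurableSet_Ioo.prod measurableSet_Ioo))] with q hq
      exact hq.2.2
    filter_upwards [h3, h4] with q hq hq4
    exact ⟨hq4, hq.1, hq.2⟩
  have hpt : ∀ᵐ q ∂boxMeasure (2 * A), weight (2 * A) lam q.2.2 * ∑ n, G n q ^ 2 ≤
      8 * (∑ n, Lu n q ^ 2 + M ^ 2 * (weight (2 * A) lam q.2.2 * ∑ n, F n q ^ 2 +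
        weight (2 * A) lam q.2.2 * ∑ n, Fx n q ^ 2 + weight (2 * A) lam q.2.2 * ∑ n, Fy n q ^ 2 +
        weight (2 * A) lam q.2.2 * ∑ n, Ft n q ^ 2) +
        w1 * K * (∑ n, u n q ^ 2 + ∑ n, d 2 n q ^ 2)) := by
    filter_upwards [hdom] with q ⟨hqt, hqc, hq⟩
    have hx := cube_subset_closedCube A hqc
    have := sum_sq_localized_le (χ := χ q.2.2) (χ' := deriv χ q.2.2) (χ'' := deriv (deriv χ) q.2.2)
      (M := M) hσ (fun j n m => L.first j (boxPoint A σ q) n m)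
      (fun n m => L.zeroth (boxPoint A σ q) n m)
      (fun j => sum_sq_entries_le (L.first_continuous j) (hL.1 j) hx)
      (sum_sq_entries_le L.zeroth_continuous hL.2 hx) (fun n => u n q) (fun n => Lu n q)
      (fun i n => d i n q) (fun i n => dd i i n q) hq
    have hρ0 := weight_pos (2 * A) lam q.2.2
    have hρ1 : weight (2 * A) lam q.2.2 ≤ 1 :=
      weight_le_one hlam0 hqt.1.le (by linarith [hqt.2])
    refine (mul_le_mul_of_nonneg_left this hρ0.le).trans ?_
    have nL : 0 ≤ ∑ n, Lu n q ^ 2 := Finset.sum_nonneg fun _ _ => sq_nonneg _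
    have nu : 0 ≤ ∑ n, u n q ^ 2 := Finset.sum_nonneg fun _ _ => sq_nonneg _
    have nd : 0 ≤ ∑ n, d 2 n q ^ 2 := Finset.sum_nonneg fun _ _ => sq_nonneg _
    have p1 : weight (2 * A) lam q.2.2 * (χ q.2.2 ^ 2 * ∑ n, Lu n q ^ 2) ≤ ∑ n, Lu n q ^ 2 := by
      rw [← mul_assoc]
      refine mul_le_of_le_one_left nL (mul_le_one₀ hρ1 (sq_nonneg _) ?_)
      exact pow_le_one₀ (hχ01 _).1 (hχ01 _).2
    have p2 : weight (2 * A) lam q.2.2 * ((M ^ 2 * deriv χ q.2.2 ^ 2 + deriv (deriv χ) q.2.2 ^ 2) *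
        ∑ n, u n q ^ 2 + 4 * deriv χ q.2.2 ^ 2 * ∑ n, d 2 n q ^ 2) ≤
        -- The commutator terms vanish for `t < 2A - ε/2`; beyond that the weight is at most `w1`,
        -- and `K` bounds the derivatives of `χ`.
        w1 * K * (∑ n, u n q ^ 2 + ∑ n, d 2 n q ^ 2) := by
      by_cases ht : q.2.2 < 2 * A - ε / 2
      · rw [(hχ1 _ ht).2.1, (hχ1 _ ht).2.2]
        simp only [ne_eq, OfNat.ofNat_ne_zero, not_false_eq_true, zero_pow, mul_zero, add_zero,
          zero_mul]
        positivity
      · rw [not_lt] at ht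
        have hb : M ^ 2 * deriv χ q.2.2 ^ 2 + deriv (deriv χ) q.2.2 ^ 2 + 4 * deriv χ q.2.2 ^ 2 ≤ K :=
          (le_abs_self _).trans ((hK₁ _ (Ioo_subset_Icc_self hqt)).trans (le_max_left _ _))
        have hρw : weight (2 * A) lam q.2.2 ≤ w1 := weight_anti hlam0 ht (by linarith [hqt.2])
        have c1 : 0 ≤ M ^ 2 * deriv χ q.2.2 ^ 2 + deriv (deriv χ) q.2.2 ^ 2 := by positivity
        have c2 : 0 ≤ 4 * deriv χ q.2.2 ^ 2 := by positivity
        rw [mul_assoc w1]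
        refine mul_le_mul hρw ?_ (by positivity) hw1.le
        rw [mul_add K]
        exact add_le_add (mul_le_mul_of_nonneg_right (by linarith) nu)
          (mul_le_mul_of_nonneg_right (by linarith) nd)
    calc _ = 8 * (weight (2 * A) lam q.2.2 * (χ q.2.2 ^ 2 * ∑ n, Lu n q ^ 2) +
          M ^ 2 * (weight (2 * A) lam q.2.2 * ∑ n, F n q ^ 2 +
          weight (2 * A) lam q.2.2 * ∑ n, Fx n q ^ 2 + weight (2 * A) lam q.2.2 * ∑ n, Fy n q ^ 2 +
          weight (2 * A) lam q.2.2 * ∑ n, Ft n q ^ 2) +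
          weight (2 * A) lam q.2.2 *
            ((M ^ 2 * deriv χ q.2.2 ^ 2 + deriv (deriv χ) q.2.2 ^ 2) *
        ∑ n, u n q ^ 2 + 4 * deriv χ q.2.2 ^ 2 * ∑ n, d 2 n q ^ 2)) := by
            simp only [hF, hFx, hFy, hFt]
            ring
      _ ≤ _ := by
        refine mul_le_mul_of_nonneg_left ?_ (by norm_num)
        exact add_le_add (add_le_add p1 le_rfl) p2
  -- Integration
  have sq_int : ∀ f : Fin N → ℝ × ℝ × ℝ → ℝ, (∀ n, MemLp (f n) 2 (boxMeasure (2 * A))) →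
      Integrable (fun q => ∑ n, f n q ^ 2) (boxMeasure (2 * A)) := fun f hf =>
    integrable_finsetSum _ fun n _ => (hf n).integrable_sq
  obtain ⟨iG, sG⟩ := boxEnergy_sum (lam := lam) GB
  obtain ⟨iF, sF⟩ := boxEnergy_sum (lam := lam) fun n => (modal n).memLp
  obtain ⟨iFx, sFx⟩ := boxEnergy_sum (lam := lam) fun n => (modal n).memLp_x
  obtain ⟨iFy, sFy⟩ := boxEnergy_sum (lam := lam) fun n => (modal n).memLp_y
  obtain ⟨iFt, sFt⟩ := boxEnergy_sum (lam := lam) fun n => (modal n).memLp_t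
  have iL := sq_int Lu LB
  have iu := sq_int u uB
  have id2 := sq_int (d 2) (dB 2)
  obtain ⟨iR, sR⟩ := integral_combination (M ^ 2) (w1 * K) iL iF iFx iFy iFt iu id2
  have e3 := integral_mono_ae iG iR hpt
  rw [sR, sG, sF, sFx, sFy, sFt] at e3
  have eI : ∫ q, ∑ n, Lu n q ^ 2 ∂boxMeasure (2 * A) = ∫ x in cube A, ∑ n, L.apply W n x ^ 2 :=
    integral_boxPoint (f := fun x => ∑ n, L.apply W n x ^ 2) hσ
      (integrable_finsetSum _ fun n _ => (L.memLp_apply hm n).integrable_sq).1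
  have eH : ∫ q, ∑ n, u n q ^ 2 ∂boxMeasure (2 * A) + ∫ q, ∑ n, d 2 n q ^ 2 ∂boxMeasure (2 * A) ≤
      sobolevNormVec (cube A) 2 W ^ 2 := by
    rw [sobolevNormVec_sq, integral_finsetSum _ fun n _ => (uB n).integrable_sq,
      integral_finsetSum _ fun n _ => (dB 2 n).integrable_sq, ← Finset.sum_add_distrib]
    refine Finset.sum_le_sum fun n _ => ?_
    rw [integral_boxPoint (f := fun x => W n x ^ 2) hσ (hm n).1.integrable_sq.1,
      integral_boxPoint (f := fun x => weakDeriv (cube A) (Pi.single 2 1) (W n) x ^ 2) hσ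
        ((hm n).first 2).1.integrable_sq.1]
    exact integral_sq_add_le_sobolevNormSq (hm n)
  have e1 : lam * (∑ n, boxEnergy (2 * A) lam (F n) + ∑ n, boxEnergy (2 * A) lam (Fx n) +
      ∑ n, boxEnergy (2 * A) lam (Fy n) + ∑ n, boxEnergy (2 * A) lam (Ft n)) ≤
      C * ∑ n, boxEnergy (2 * A) lam (G n) := by
    simp only [← Finset.sum_add_distrib, Finset.mul_sum]
    exact Finset.sum_le_sum fun n _ => (car n).1
  -- On the subdomain `χ = 1` and its derivatives vanish, so the ten box energies dominate the ten
  -- terms of the `H²` norm there.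
  have e24 : weight (2 * A) lam (2 * A - ε) * sobolevNormVec (subdomain A ε S) 2 W ^ 2 ≤
      (∑ n, boxEnergy (2 * A) lam (F n) + ∑ n, boxEnergy (2 * A) lam (Fx n) +
      ∑ n, boxEnergy (2 * A) lam (Fy n) + ∑ n, boxEnergy (2 * A) lam (Ft n)) +
      C * lam * ∑ n, boxEnergy (2 * A) lam (G n) := by
    rw [sobolevNormVec_sq, Finset.mul_sum, Finset.mul_sum]
    simp only [← Finset.sum_add_distrib]
    refine Finset.sum_le_sum fun n _ => le_trans ?_ (add_le_add le_rfl (car n).2)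
    have hone : ∀ q : ℝ × ℝ × ℝ, q.2.2 < 2 * A - ε → χ q.2.2 = 1 ∧ deriv χ q.2.2 = 0 ∧
        deriv (deriv χ) q.2.2 = 0 := fun q hq => hχ1 _ (by linarith)
    have hσσ : σ ^ 2 = 1 := by rcases hσ with h | h <;> rw [h] <;> norm_num
    have B := @weight_mul_integral_subdomain_le A ε lam hA hε hlam0 S
    have s0 : ∀ i j, ∫ x in subdomain A ε S,
        weakDeriv (cube A) (Pi.single i 1 + Pi.single j 1) (W n) x ^ 2 =
        ∫ x in subdomain A ε S, secondDeriv A i j (W n) x ^ 2 := fun i j =>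
      integral_congr_ae ((ae_restrict_of_ae_restrict_of_subset (subdomain_subset A ε S)
        ((hm n).secondDeriv_ae_eq i j)).mono fun x hx => by simp only [hx])
    have s1 : ∫ x in subdomain A ε S, weakDeriv (cube A) 0 (W n) x ^ 2 =
        ∫ x in subdomain A ε S, W n x ^ 2 :=
      integral_congr_ae ((ae_restrict_of_ae_restrict_of_subset (subdomain_subset A ε S)
        (weakDeriv_zero_ae_eq (isOpen_cube A) (hm n).1)).mono fun x hx => by simp only [hx])
    rw [sobolevNormSq_eq_of_subset (isOpen_subdomain A ε S) (subdomain_subset A ε S) (hm n),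
      sum_multiIndices_two]
    simp only [s0, s1, mul_add]
    have b2 := fun i j => ((hm n).secondDeriv_spec i j).1
    refine add_le_add (add_le_add (add_le_add (add_le_add ?_ ?_) ?_) ?_)
      (add_le_add (add_le_add (add_le_add (add_le_add (add_le_add ?_ ?_) ?_) ?_) ?_) ?_)
    · exact B (hm n).1 (modal n).memLp fun q hq => by simp only [hF]; rw [(hone q hq).1, one_mul]
    · exact B ((hm n).first 0).1 (modal n).memLp_x fun q hq => by simp only [hFx]; rw [(hone q hq).1, one_mul]
    · exact B ((hm n).first 1).1 (modal n).memLp_y fun q hq => by simp only [hFy]; rw [(hone q hq).1, one_mul]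
    · exact B ((hm n).first 2).1 (modal n).memLp_t fun q hq => by
        simp only [hFt]
        rw [(hone q hq).1, (hone q hq).2.1, zero_mul, zero_add, one_mul, mul_pow, neg_sq, hσσ,
          one_mul]
    · exact B (b2 0 0) (modal n).memLp_xx fun q hq => by rw [(hone q hq).1, one_mul]
    · exact B (b2 1 1) (modal n).memLp_yy fun q hq => by rw [(hone q hq).1, one_mul]
    · exact B (b2 0 1) (modal n).memLp_xy fun q hq => by rw [(hone q hq).1, one_mul]
    · exact B (b2 2 0) (modal n).memLp_xt fun q hq => by
        rw [(hone q hq).1, (hone q hq).2.1, zero_mul, zero_add, one_mul, mul_pow, neg_sq, hσσ,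
          one_mul]
    · exact B (b2 2 1) (modal n).memLp_yt fun q hq => by
        rw [(hone q hq).1, (hone q hq).2.1, zero_mul, zero_add, one_mul, mul_pow, neg_sq, hσσ,
          one_mul]
    · exact B (b2 2 2) (modal n).memLp_tt fun q hq => by
        rw [(hone q hq).1, (hone q hq).2.1, (hone q hq).2.2]; ring
  refine (localized_absorb hC hlam1 ((le_max_right _ _).trans hlam)
    (Finset.sum_nonneg fun n _ => boxEnergy_nonneg _ _ _) e1 le_rfl e3 e24).trans ?_
  rw [eI]
  have nI : 0 ≤ ∫ x in cube A, ∑ n, L.apply W n x ^ 2 :=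
    integral_nonneg fun _ => Finset.sum_nonneg fun _ _ => sq_nonneg _
  have nH : 0 ≤ w1 * sobolevNormVec (cube A) 2 W ^ 2 := by positivity
  calc _ ≤ C * (1 + lam) * (16 * ((∫ x in cube A, ∑ n, L.apply W n x ^ 2) +
        w1 * K * sobolevNormVec (cube A) 2 W ^ 2)) := by gcongr
    _ ≤ C * (1 + lam) * (16 * ((1 + K) * ((∫ x in cube A, ∑ n, L.apply W n x ^ 2) +
        w1 * sobolevNormVec (cube A) 2 W ^ 2))) := by
        gcongr
        nlinarith [mul_nonneg hK0 nI]
    _ = _ := by ring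

/-- The Carleman estimate for localized solutions, with the exponents made explicit. -/
lemma exponential_stability {A ε : ℝ} (hA : 0 < A) (M : ℝ) (hε : 0 < ε) (hεA : ε < A) :
    ∃ C lam₀ R d : ℝ, 0 < C ∧ 0 < R ∧ 0 < d ∧
      ∀ (S : Surface) (N : ℕ) (L : EllipticSystem A N), L.NormLE M →
      ∀ W : Fin N → E3 → ℝ, (∀ n, ZeroComponent A S (W n)) → ∀ lam, lam₀ ≤ lam →
        sobolevNormVec (subdomain A ε S) 2 W ^ 2 ≤
          C * (Real.exp (lam * R) * (∫ x in cube A, ∑ n, L.apply W n x ^ 2) +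
            Real.exp (-(lam * d)) * sobolevNormVec (cube A) 2 W ^ 2) := by
  obtain ⟨C, lam₀, hC, hl, H⟩ := localized_estimate hA M hε
  set p0 := 4 * (2 * A) * (2 * A - ε) - (2 * A - ε) ^ 2 with hp0
  set p1 := 4 * (2 * A) * (2 * A - ε / 2) - (2 * A - ε / 2) ^ 2 with hp1
  have hp0' : 0 < p0 := by rw [hp0]; nlinarith
  set d := p1 - p0 with hd
  have hd0 : 0 < d := by rw [hd, hp1, hp0]; nlinarith
  -- The ratio of the weights at `2A - ε/2` and `2A - ε` is `exp(-2λd)`. Half of this decay is spent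
  -- on the factor `1 + λ`, bounded by a multiple of `exp(λd)`. Division by the weight at `2A - ε`
  -- costs `exp(2λp0)`, whence `R = 2p0 + d`.
  refine ⟨C * (1 + 1 / d), lam₀, 2 * p0 + d, d, by positivity, by positivity, hd0, ?_⟩
  intro S N L hL W hW lam hlam
  have hlam0 : 0 < lam := by linarith
  have h := H S N L hL W hW lam hlam
  set I := ∫ x in cube A, ∑ n, L.apply W n x ^ 2
  set Q := sobolevNormVec (cube A) 2 W ^ 2
  have nI : 0 ≤ I := integral_nonneg fun _ => Finset.sum_nonneg fun _ _ => sq_nonneg _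
  have nQ : 0 ≤ Q := sq_nonneg _
  have hexp : 1 + lam ≤ (1 + 1 / d) * Real.exp (lam * d) := by
    have h1 : lam * d + 1 ≤ Real.exp (lam * d) := Real.add_one_le_exp _
    refine le_trans ?_ (mul_le_mul_of_nonneg_left h1 (by positivity))
    have : (1 + 1 / d) * (lam * d + 1) = 1 + lam + lam * d + 1 / d := by field_simp; ring
    rw [this]
    have : 0 < lam * d + 1 / d := by positivity
    linarith
  have hw : Real.exp (2 * lam * p0) * weight (2 * A) lam (2 * A - ε) = 1 := by
    rw [weight, ← Real.exp_add, ← Real.exp_zero]; congr 1; rw [hp0]; ring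
  have e1 : Real.exp (2 * lam * p0) * Real.exp (lam * d) = Real.exp (lam * (2 * p0 + d)) := by
    rw [← Real.exp_add]; congr 1; ring
  have e2 : Real.exp (2 * lam * p0) * Real.exp (lam * d) * weight (2 * A) lam (2 * A - ε / 2) =
      Real.exp (-(lam * d)) := by
    rw [weight, ← Real.exp_add, ← Real.exp_add]; congr 1; rw [hd, hp1]; ring
  have nw : 0 ≤ weight (2 * A) lam (2 * A - ε / 2) := (weight_pos _ _ _).le
  calc sobolevNormVec (subdomain A ε S) 2 W ^ 2 = Real.exp (2 * lam * p0) *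
        (weight (2 * A) lam (2 * A - ε) * sobolevNormVec (subdomain A ε S) 2 W ^ 2) := by
        rw [← mul_assoc, hw, one_mul]
    _ ≤ Real.exp (2 * lam * p0) * (C * ((1 + 1 / d) * Real.exp (lam * d)) *
        (I + weight (2 * A) lam (2 * A - ε / 2) * Q)) := by
        refine mul_le_mul_of_nonneg_left (h.trans ?_) (Real.exp_pos _).le
        gcongr
    _ = C * (1 + 1 / d) * (Real.exp (2 * lam * p0) * Real.exp (lam * d) * I +
        Real.exp (2 * lam * p0) * Real.exp (lam * d) * weight (2 * A) lam (2 * A - ε / 2) * Q) := by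
        ring
    _ = _ := by rw [e2, e1]

/-- Hölder stability of the Cauchy problem away from the face opposite to `S`. -/
theorem holder_stability {A ε K : ℝ} (hA : 0 < A) (M : ℝ) (hε : 0 < ε) (hεA : ε < A) (hK : 0 ≤ K) :
    ∃ δ₀ ∈ Ioo (0 : ℝ) 1, ∃ α ∈ Ioo (0 : ℝ) (1 / 2),
      ∀ (S : Surface) (N : ℕ) (L : EllipticSystem A N), L.NormLE M →
      ∀ W : Fin N → E3 → ℝ, (∀ n, ZeroComponent A S (W n)) → ∀ δ ∈ Ioo 0 δ₀, ∀ E : ℝ,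
        (∫ x in cube A, ∑ n, L.apply W n x ^ 2) ≤ K * E ^ 2 * δ ^ 2 →
        sobolevNormVec (cube A) 2 W ^ 2 ≤ K * E ^ 2 →
        sobolevNormVec (subdomain A ε S) 2 W ≤ |E| * δ ^ α := by
  obtain ⟨C, lam₀, R, d, hC, hR, hd, H⟩ := exponential_stability hA M hε hεA
  set p := min 1 (d / R) with hp
  have hp0 : 0 < p := lt_min one_pos (by positivity)
  have hp1 : p ≤ 1 := min_le_left _ _
  set c := 1 / (1 + 2 * C * K) with hc
  have hc0 : 0 < c := by positivity
  -- The three terms ensure `δ₀ < 1`, that the chosen `λ` is at least `lam₀`, and that `δ^(p/2) ≤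
  -- c`, which absorbs the constant `2CK`. Of the exponent `p` of the squared norm, `p/2` is spent
  -- on this; the remaining `p/2` gives `p/4` for the norm.
  refine ⟨min (1 / 2) (min (Real.exp (-(lam₀ * R))) (c ^ (2 / p))),
    ⟨lt_min (by norm_num) (lt_min (Real.exp_pos _) (by positivity)),
      (min_le_left _ _).trans_lt (by norm_num)⟩, p / 4, ⟨by positivity, by linarith⟩, ?_⟩
  intro S N L hL W hW δ hδ E hI hQ
  obtain ⟨hδ0, hδ'⟩ := hδ
  have hδ1 : δ < 1 := hδ'.trans_le ((min_le_left _ _).trans (by norm_num))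
  have hδ2 : δ ≤ Real.exp (-(lam₀ * R)) :=
    hδ'.le.trans ((min_le_right _ _).trans (min_le_left _ _))
  have hδ3 : δ ≤ c ^ (2 / p) := hδ'.le.trans ((min_le_right _ _).trans (min_le_right _ _))
  -- With `exp(λR) = 1/δ`, the residual term `exp(λR) δ²` becomes `δ`, and the decaying term becomes
  -- `δ^(d/R)`.
  set lam := -Real.log δ / R with hlam
  have hlamR : lam * R = -Real.log δ := by rw [hlam]; field_simp
  have h := H S N L hL W hW lam (by
    rw [hlam, le_div_iff₀ hR]
    have := Real.log_le_log hδ0 hδ2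
    rw [Real.log_exp] at this
    linarith)
  have e1 : Real.exp (lam * R) * δ = 1 := by
    rw [hlamR, Real.exp_neg, Real.exp_log hδ0, inv_mul_cancel₀ hδ0.ne']
  have e2 : Real.exp (-(lam * d)) = δ ^ (d / R) := by
    rw [Real.rpow_def_of_pos hδ0, hlam]; congr 1; field_simp
  have f1 : δ ≤ δ ^ p := by
    conv_lhs => rw [← Real.rpow_one δ]
    exact Real.rpow_le_rpow_of_exponent_ge hδ0 hδ1.le hp1
  have f2 : δ ^ (d / R) ≤ δ ^ p :=
    Real.rpow_le_rpow_of_exponent_ge hδ0 hδ1.le (min_le_right _ _)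
  have f3 : δ ^ p = δ ^ (p / 2) * (δ ^ (p / 4)) ^ 2 := by
    rw [← Real.rpow_natCast, ← Real.rpow_mul hδ0.le, ← Real.rpow_add hδ0]; congr 1; push_cast; ring
  have f4 : δ ^ (p / 2) ≤ c := by
    refine (Real.rpow_le_rpow hδ0.le hδ3 (by positivity)).trans_eq ?_
    rw [← Real.rpow_mul hc0.le]
    have : 2 / p * (p / 2) = 1 := by field_simp
    rw [this, Real.rpow_one]
  have f5 : 2 * C * K * c ≤ 1 := by
    rw [hc, mul_one_div, div_le_one (by positivity)]; linarith
  have nE := sq_nonneg E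
  have key : sobolevNormVec (subdomain A ε S) 2 W ^ 2 ≤ (|E| * δ ^ (p / 4)) ^ 2 := by
    calc _ ≤ C * (Real.exp (lam * R) * (K * E ^ 2 * δ ^ 2) +
          Real.exp (-(lam * d)) * (K * E ^ 2)) := by
          refine h.trans ?_
          gcongr
      _ = C * (K * E ^ 2) * ((Real.exp (lam * R) * δ) * δ + Real.exp (-(lam * d))) := by ring
      _ ≤ C * (K * E ^ 2) * (δ ^ p + δ ^ p) := by
          rw [e1, e2, one_mul]
          gcongr
      _ = 2 * C * K * δ ^ (p / 2) * (E ^ 2 * (δ ^ (p / 4)) ^ 2) := by rw [f3]; ring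
      _ ≤ 2 * C * K * c * (E ^ 2 * (δ ^ (p / 4)) ^ 2) := by gcongr
      _ ≤ 1 * (E ^ 2 * (δ ^ (p / 4)) ^ 2) := by gcongr
      _ = _ := by rw [mul_pow, sq_abs, one_mul]
  exact (pow_le_pow_iff_left₀ (sobolevNormVec_nonneg _ _ _) (by positivity) two_ne_zero).1 key

/-! ### Minimization under affine constraints in a product of `L²` spaces -/

section Minimization

variable {X : Type*} [MeasurableSpace X] {μ : Measure X} {ι : Type*} [Fintype ι]

/-- On tuples of `L²` functions, the condition `Q` is a system of equations `∑ ⟨p_i, g_i⟩ = c`. -/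
def IsAffineCond (μ : Measure X) (Q : (ι → X → ℝ) → Prop) : Prop :=
  ∃ 𝓕 : Set ((ι → X → ℝ) × ℝ), (∀ g ∈ 𝓕, ∀ i, MemLp (g.1 i) 2 μ) ∧
    ∀ p : ι → X → ℝ, (∀ i, MemLp (p i) 2 μ) →
      (Q p ↔ ∀ g ∈ 𝓕, ∑ i, ∫ x, p i x * g.1 i x ∂μ = g.2)

lemma IsAffineCond.forall {κ : Sort*} {Q : κ → (ι → X → ℝ) → Prop}
    (h : ∀ k, IsAffineCond μ (Q k)) : IsAffineCond μ fun p => ∀ k, Q k p := by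
  choose 𝓕 h1 h2 using h
  refine ⟨⋃ k, 𝓕 k, fun g hg => ?_, fun p hp => ?_⟩
  · obtain ⟨k, hk⟩ := mem_iUnion.1 hg
    exact h1 k g hk
  · constructor
    · intro hQ g hg
      obtain ⟨k, hk⟩ := mem_iUnion.1 hg
      exact (h2 k p hp).1 (hQ k) g hk
    · exact fun hg k => (h2 k p hp).2 fun g hgk => hg g (mem_iUnion.2 ⟨k, hgk⟩)

lemma IsAffineCond.and {Q Q' : (ι → X → ℝ) → Prop} (h : IsAffineCond μ Q)
    (h' : IsAffineCond μ Q') : IsAffineCond μ fun p => Q p ∧ Q' p := by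
  obtain ⟨𝓕, h1, h2⟩ := h
  obtain ⟨𝓕', h1', h2'⟩ := h'
  refine ⟨𝓕 ∪ 𝓕', fun g hg => hg.elim (h1 g) (h1' g), fun p hp => ?_⟩
  show Q p ∧ Q' p ↔ _
  rw [h2 p hp, h2' p hp]
  constructor
  · rintro ⟨h, h'⟩ g (hg | hg)
    exacts [h g hg, h' g hg]
  · exact fun h => ⟨fun g hg => h g (Or.inl hg), fun g hg => h g (Or.inr hg)⟩

/-- Multiplication by `a` preserves `L²`. -/
def IsMultiplier (μ : Measure X) (a : X → ℝ) : Prop :=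
  ∀ f : X → ℝ, MemLp f 2 μ → MemLp (fun x => a x * f x) 2 μ

lemma isMultiplier_const (c : ℝ) : IsMultiplier μ fun _ => c := fun _ hf => hf.const_mul c

/-- `T p` is a linear combination of the `p_i`, the coefficients being multipliers. -/
def IsPointwise (μ : Measure X) (T : (ι → X → ℝ) → X → ℝ) : Prop :=
  ∃ a : ι → X → ℝ, (∀ i, IsMultiplier μ (a i)) ∧ ∀ p x, T p x = ∑ i, a i x * p i x

lemma isPointwise_proj (i : ι) : IsPointwise μ fun p : ι → X → ℝ => p i := by
  classical
  refine ⟨fun j _ => if j = i then 1 else 0, fun j => isMultiplier_const _, fun p x => ?_⟩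
  simp

lemma isPointwise_zero : IsPointwise μ fun _ : ι → X → ℝ => (0 : X → ℝ) :=
  ⟨fun _ _ => 0, fun _ => isMultiplier_const _, fun p x => by simp⟩

lemma IsPointwise.add {T T' : (ι → X → ℝ) → X → ℝ} (h : IsPointwise μ T) (h' : IsPointwise μ T') :
    IsPointwise μ fun p x => T p x + T' p x := by
  obtain ⟨a, h1, h2⟩ := h
  obtain ⟨b, h1', h2'⟩ := h'
  refine ⟨fun i x => a i x + b i x, fun i f hf => ?_, fun p x => ?_⟩
  · simp only [add_mul]
    exact (h1 i f hf).add (h1' i f hf)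
  · simp only [h2, h2', add_mul, Finset.sum_add_distrib]

lemma IsPointwise.mul {T : (ι → X → ℝ) → X → ℝ} (h : IsPointwise μ T) {b : X → ℝ}
    (hb : IsMultiplier μ b) : IsPointwise μ fun p x => b x * T p x := by
  obtain ⟨a, h1, h2⟩ := h
  refine ⟨fun i x => b x * a i x, fun i f hf => ?_, fun p x => ?_⟩
  · simp only [mul_assoc]
    exact hb _ (h1 i f hf)
  · simp only [h2, Finset.mul_sum, mul_assoc]

lemma IsPointwise.sum {κ : Type*} [Fintype κ] {T : κ → (ι → X → ℝ) → X → ℝ}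
    (h : ∀ k, IsPointwise μ (T k)) : IsPointwise μ fun p x => ∑ k, T k p x := by
  choose a h1 h2 using h
  refine ⟨fun i x => ∑ k, a k i x, fun i f hf => ?_, fun p x => ?_⟩
  · simp only [Finset.sum_mul]
    exact memLp_finsetSum _ fun k _ => h1 k i f hf
  · simp only [h2, Finset.sum_mul]
    rw [Finset.sum_comm]

lemma IsPointwise.memLp {T : (ι → X → ℝ) → X → ℝ} (h : IsPointwise μ T) {p : ι → X → ℝ}
    (hp : ∀ i, MemLp (p i) 2 μ) : MemLp (T p) 2 μ := by
  obtain ⟨a, h1, h2⟩ := h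
  rw [funext (h2 p)]
  exact memLp_finsetSum _ fun i _ => h1 i _ (hp i)

/-- The multipliers are moved from `p` onto `ψ`, which exhibits the condition as one pairing with a
tuple of `L²` functions. -/
lemma IsPointwise.isAffineCond {T : (ι → X → ℝ) → X → ℝ} (h : IsPointwise μ T) {ψ : X → ℝ}
    (hψ : MemLp ψ 2 μ) (c : ℝ) : IsAffineCond μ fun p => ∫ x, T p x * ψ x ∂μ = c := by
  obtain ⟨a, h1, h2⟩ := h
  refine ⟨{(fun i x => a i x * ψ x, c)}, ?_, fun p hp => ?_⟩
  · rintro g rfl i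
    exact h1 i ψ hψ
  · simp only [mem_singleton_iff, forall_eq, h2, Finset.sum_mul]
    rw [integral_finsetSum]
    · simp only [mul_comm, mul_left_comm]
    · intro i _
      exact (h1 i _ (hp i)).integrable_fun_mul hψ

/-- A weighted sum of squared `L²` norms has a minimizer under consistent affine constraints. -/
theorem IsAffineCond.exists_minimizer {Q : (ι → X → ℝ) → Prop} (hQ : IsAffineCond μ Q) {w : ι → ℝ}
    (hw : ∀ i, 0 < w i) (hne : ∃ p : ι → X → ℝ, (∀ i, MemLp (p i) 2 μ) ∧ Q p) :
    ∃ p : ι → X → ℝ, (∀ i, MemLp (p i) 2 μ) ∧ Q p ∧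
      ∀ p' : ι → X → ℝ, (∀ i, MemLp (p' i) 2 μ) → Q p' →
        ∑ i, w i * ∫ x, p i x ^ 2 ∂μ ≤ ∑ i, w i * ∫ x, p' i x ^ 2 ∂μ := by
  obtain ⟨𝓕, hF, hQF⟩ := hQ
  -- Scaling the `i`-th component by `√(w i)` turns the weighted sum into the Hilbert norm of the
  -- product; the functionals are scaled by the inverse.
  have hs : ∀ i, 0 < √(w i) := fun i => Real.sqrt_pos.2 (hw i)
  have hgi : ∀ g : 𝓕, ∀ i, MemLp (fun x => (√(w i))⁻¹ * g.1.1 i x) 2 μ := fun g i =>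
    (hF g.1 g.2 i).const_mul _
  let Λ : 𝓕 → PiLp 2 (fun _ : ι => Lp ℝ 2 μ) →L[ℝ] ℝ := fun g =>
    ∑ i, (innerSL ℝ ((hgi g i).toLp _)).comp (PiLp.proj 2 (fun _ : ι => Lp ℝ 2 μ) i)
  have hΛ : ∀ g P, Λ g P = ∑ i, ∫ x, ((√(w i))⁻¹ * P i x) * g.1.1 i x ∂μ := by
    intro g P
    simp only [Λ, sum_apply, ContinuousLinearMap.comp_apply, innerSL_apply_apply,
      PiLp.proj_apply, L2.inner_def]
    refine Finset.sum_congr rfl fun i _ => integral_congr_ae ?_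
    filter_upwards [(hgi g i).coeFn_toLp] with x hx
    rw [hx]
    simp only [RCLike.inner_apply, conj_trivial]
    ring
  -- An intersection of level sets of continuous linear functionals is closed and convex even for an
  -- uncountable family, so projection of the origin onto it gives the minimizer.
  set K : Set (PiLp 2 (fun _ : ι => Lp ℝ 2 μ)) := ⋂ g : 𝓕, (Λ g) ⁻¹' {g.1.2} with hK
  have hKc : IsClosed K := isClosed_iInter fun g => isClosed_singleton.preimage (Λ g).continuous
  have hKv : Convex ℝ K := convex_iInter fun g =>
    (convex_singleton _).linear_preimage (Λ g).toLinearMap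
  have hnorm : ∀ P : PiLp 2 (fun _ : ι => Lp ℝ 2 μ), ‖P‖ ^ 2 = ∑ i, ∫ x, P i x ^ 2 ∂μ := by
    intro P
    rw [PiLp.norm_sq_eq_of_L2]
    refine Finset.sum_congr rfl fun i _ => ?_
    rw [← real_inner_self_eq_norm_sq, L2.inner_def]
    refine integral_congr_ae (Filter.Eventually.of_forall fun x => ?_)
    simp only [RCLike.inner_apply, conj_trivial]
    ring
  have hlift : ∀ p : ι → X → ℝ, (∀ i, MemLp (p i) 2 μ) → Q p → ∃ P ∈ K,
      ‖P‖ ^ 2 = ∑ i, w i * ∫ x, p i x ^ 2 ∂μ := by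
    intro p hp hQp
    let P : PiLp 2 (fun _ : ι => Lp ℝ 2 μ) :=
      WithLp.toLp 2 fun i => ((hp i).const_mul (√(w i))).toLp _
    have hP : ∀ i, P i =ᵐ[μ] fun x => √(w i) * p i x := fun i =>
      ((hp i).const_mul (√(w i))).coeFn_toLp
    refine ⟨P, mem_iInter.2 fun g => ?_, ?_⟩
    · rw [mem_preimage, mem_singleton_iff, hΛ, ← (hQF p hp).1 hQp g.1 g.2]
      refine Finset.sum_congr rfl fun i _ => integral_congr_ae ?_
      filter_upwards [hP i] with x hx
      rw [hx, inv_mul_cancel_left₀ (hs i).ne']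
    · rw [hnorm]
      refine Finset.sum_congr rfl fun i _ => ?_
      rw [← integral_const_mul]
      refine integral_congr_ae ?_
      filter_upwards [hP i] with x hx
      rw [hx, mul_pow, Real.sq_sqrt (hw i).le]
  obtain ⟨p₀, hp₀, hQ₀⟩ := hne
  obtain ⟨P₀, hP₀, -⟩ := hlift p₀ hp₀ hQ₀
  obtain ⟨P, hPK, hP⟩ := exists_norm_eq_iInf_of_complete_convex ⟨P₀, hP₀⟩ hKc.isComplete hKv 0
  have hpm : ∀ i, MemLp (fun x => (√(w i))⁻¹ * P i x) 2 μ := fun i => (Lp.memLp (P i)).const_mul _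
  refine ⟨fun i x => (√(w i))⁻¹ * P i x, hpm, (hQF _ hpm).2 fun g hg => ?_,
    fun p' hp' hQ' => ?_⟩
  · rw [← hΛ ⟨g, hg⟩ P]
    exact mem_iInter.1 hPK ⟨g, hg⟩
  · obtain ⟨P', hP', hn'⟩ := hlift p' hp' hQ'
    have h1 : ‖P‖ ≤ ‖P'‖ := by
      simp only [zero_sub, norm_neg] at hP
      rw [hP]
      exact ciInf_le ⟨0, by rintro _ ⟨v, rfl⟩; exact norm_nonneg _⟩ (⟨P', hP'⟩ : K)
    rw [← hn']
    refine le_trans (le_of_eq ?_) (pow_le_pow_left₀ (norm_nonneg _) h1 2)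
    rw [hnorm]
    refine Finset.sum_congr rfl fun i _ => ?_
    simp only [mul_pow]
    rw [integral_const_mul, inv_pow, Real.sq_sqrt (hw i).le, mul_inv_cancel_left₀ (hw i).ne']

end Minimization

/-! ### Linear operations on Sobolev functions -/

section Linear

variable {D : Set E3} {m : ℕ} {u v : E3 → ℝ} {α : Fin 3 → ℕ}

lemma MemSobolev.hasWeakDeriv (hu : MemSobolev D m u) (hα : α ∈ multiIndices m) :
    HasWeakDeriv D α u (weakDeriv D α u) := hasWeakDeriv_weakDeriv (hu.2 α hα)

lemma MemSobolev.add (hu : MemSobolev D m u) (hv : MemSobolev D m v) : MemSobolev D m (u + v) :=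
  ⟨hu.1.add hv.1, fun _ hα => ⟨_, (hu.hasWeakDeriv hα).add hu.1 hv.1 (hv.hasWeakDeriv hα)⟩⟩

lemma MemSobolev.sub (hu : MemSobolev D m u) (hv : MemSobolev D m v) : MemSobolev D m (u - v) :=
  ⟨hu.1.sub hv.1, fun _ hα => ⟨_, (hu.hasWeakDeriv hα).sub hu.1 hv.1 (hv.hasWeakDeriv hα)⟩⟩

lemma MemSobolev.subset {D' : Set E3} (h : D' ⊆ D) (hu : MemSobolev D m u) : MemSobolev D' m u :=
  ⟨hu.1.mono_measure (Measure.restrict_mono h le_rfl), fun _ hα => ⟨_, (hu.hasWeakDeriv hα).mono h⟩⟩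

lemma MemSobolev.weakDeriv_add (hD : IsOpen D) (hu : MemSobolev D m u) (hv : MemSobolev D m v)
    (hα : α ∈ multiIndices m) : weakDeriv D α (u + v) =ᵐ[volume.restrict D]
      weakDeriv D α u + weakDeriv D α v :=
  ((hu.hasWeakDeriv hα).add hu.1 hv.1 (hv.hasWeakDeriv hα)).weakDeriv_ae_eq hD

lemma MemSobolev.weakDeriv_sub (hD : IsOpen D) (hu : MemSobolev D m u) (hv : MemSobolev D m v)
    (hα : α ∈ multiIndices m) : weakDeriv D α (u - v) =ᵐ[volume.restrict D]
      weakDeriv D α u - weakDeriv D α v :=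
  ((hu.hasWeakDeriv hα).sub hu.1 hv.1 (hv.hasWeakDeriv hα)).weakDeriv_ae_eq hD

/-- No measurability is required of `h`: for a nonnegative integrand, domination by an integrable
function is enough. -/
lemma integral_sq_le_of_ae {X : Type*} [MeasurableSpace X] {μ : Measure X} {κ : Type*} [Fintype κ]
    {f g h : κ → X → ℝ} (hf : ∀ k, MemLp (f k) 2 μ) (hg : ∀ k, MemLp (g k) 2 μ)
    (h1 : ∀ᵐ x ∂μ, ∀ k, h k x ^ 2 ≤ 2 * f k x ^ 2 + 2 * g k x ^ 2) :
    ∫ x, ∑ k, h k x ^ 2 ∂μ ≤ 2 * ∫ x, ∑ k, f k x ^ 2 ∂μ + 2 * ∫ x, ∑ k, g k x ^ 2 ∂μ := by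
  have i1 : Integrable (fun x => ∑ k, f k x ^ 2) μ :=
    integrable_finsetSum _ fun k _ => (hf k).integrable_sq
  have i2 : Integrable (fun x => ∑ k, g k x ^ 2) μ :=
    integrable_finsetSum _ fun k _ => (hg k).integrable_sq
  rw [← integral_const_mul, ← integral_const_mul, ← integral_add (i1.const_mul 2) (i2.const_mul 2)]
  refine integral_mono_of_nonneg (Filter.Eventually.of_forall fun x =>
    Finset.sum_nonneg fun _ _ => sq_nonneg _) ((i1.const_mul 2).add (i2.const_mul 2)) ?_
  filter_upwards [h1] with x hx
  rw [Finset.mul_sum, Finset.mul_sum, ← Finset.sum_add_distrib]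
  exact Finset.sum_le_sum fun k _ => hx k

lemma sobolevNormSq_le_of_ae {w : E3 → ℝ} (hu : MemSobolev D m u) (hv : MemSobolev D m v)
    (h : ∀ α ∈ multiIndices m, ∀ᵐ x ∂volume.restrict D,
      weakDeriv D α w x ^ 2 ≤ 2 * weakDeriv D α u x ^ 2 + 2 * weakDeriv D α v x ^ 2) :
    sobolevNormSq D m w ≤ 2 * sobolevNormSq D m u + 2 * sobolevNormSq D m v := by
  rw [sobolevNormSq, sobolevNormSq, sobolevNormSq, Finset.mul_sum, Finset.mul_sum,
    ← Finset.sum_add_distrib]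
  refine Finset.sum_le_sum fun α hα => ?_
  have := integral_sq_le_of_ae (κ := Unit) (fun _ => (hu.hasWeakDeriv hα).1)
    (fun _ => (hv.hasWeakDeriv hα).1) (h := fun _ => weakDeriv D α w)
    ((h α hα).mono fun x hx _ => hx)
  simpa using this

lemma sobolevNormSq_add_le (hD : IsOpen D) (hu : MemSobolev D m u) (hv : MemSobolev D m v) :
    sobolevNormSq D m (u + v) ≤ 2 * sobolevNormSq D m u + 2 * sobolevNormSq D m v := by
  refine sobolevNormSq_le_of_ae hu hv fun α hα => ?_
  filter_upwards [hu.weakDeriv_add hD hv hα] with x hx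
  rw [hx, Pi.add_apply]
  nlinarith [sq_nonneg (weakDeriv D α u x - weakDeriv D α v x)]

lemma sobolevNormSq_sub_le (hD : IsOpen D) (hu : MemSobolev D m u) (hv : MemSobolev D m v) :
    sobolevNormSq D m (u - v) ≤ 2 * sobolevNormSq D m u + 2 * sobolevNormSq D m v := by
  refine sobolevNormSq_le_of_ae hu hv fun α hα => ?_
  filter_upwards [hu.weakDeriv_sub hD hv hα] with x hx
  rw [hx, Pi.sub_apply]
  nlinarith [sq_nonneg (weakDeriv D α u x + weakDeriv D α v x)]

lemma sobolevNormSq_mono_order (D : Set E3) {m m' : ℕ} (h : m ≤ m') (u : E3 → ℝ) :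
    sobolevNormSq D m u ≤ sobolevNormSq D m' u :=
  Finset.sum_le_sum_of_subset_of_nonneg
    (fun _ hα => mem_multiIndices.2 ((mem_multiIndices.1 hα).trans h))
    fun _ _ _ => integral_nonneg fun _ => sq_nonneg _

lemma sobolevNormSq_mono_set {D' : Set E3} (hD' : IsOpen D') (h : D' ⊆ D) (hu : MemSobolev D m u) :
    sobolevNormSq D' m u ≤ sobolevNormSq D m u := by
  rw [sobolevNormSq_eq_of_subset hD' h hu]
  refine Finset.sum_le_sum fun α hα => ?_
  exact setIntegral_mono_set (hu.hasWeakDeriv hα).1.integrable_sq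
    (Filter.Eventually.of_forall fun _ => sq_nonneg _) (LE.le.eventuallyLE h)

end Linear

section Vector

variable {N m : ℕ} {D : Set E3} {U V : Fin N → E3 → ℝ}

lemma sobolevNormVec_add_sq_le (hD : IsOpen D) (hU : MemSobolevVec D m U)
    (hV : MemSobolevVec D m V) : sobolevNormVec D m (U + V) ^ 2 ≤
      2 * sobolevNormVec D m U ^ 2 + 2 * sobolevNormVec D m V ^ 2 := by
  simp only [sobolevNormVec_sq, Finset.mul_sum, ← Finset.sum_add_distrib]
  exact Finset.sum_le_sum fun n _ => sobolevNormSq_add_le hD (hU n) (hV n)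

lemma sobolevNormVec_sub_sq_le (hD : IsOpen D) (hU : MemSobolevVec D m U)
    (hV : MemSobolevVec D m V) : sobolevNormVec D m (U - V) ^ 2 ≤
      2 * sobolevNormVec D m U ^ 2 + 2 * sobolevNormVec D m V ^ 2 := by
  simp only [sobolevNormVec_sq, Finset.mul_sum, ← Finset.sum_add_distrib]
  exact Finset.sum_le_sum fun n _ => sobolevNormSq_sub_le hD (hU n) (hV n)

lemma sobolevNormVec_mono_order (D : Set E3) {m m' : ℕ} (h : m ≤ m') (U : Fin N → E3 → ℝ) :
    sobolevNormVec D m U ≤ sobolevNormVec D m' U :=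
  Real.sqrt_le_sqrt (Finset.sum_le_sum fun _ _ => sobolevNormSq_mono_order D h _)

lemma sobolevNormVec_mono_set {D' : Set E3} (hD' : IsOpen D') (h : D' ⊆ D)
    (hU : MemSobolevVec D m U) : sobolevNormVec D' m U ≤ sobolevNormVec D m U :=
  Real.sqrt_le_sqrt (Finset.sum_le_sum fun n _ => sobolevNormSq_mono_set hD' h (hU n))

end Vector

/-! ### Linearity of `L` and its bound from `H²` to `L²`. -/

section Operator

variable {A M : ℝ} {N : ℕ} {U V : Fin N → E3 → ℝ} (L : EllipticSystem A N)

lemma single_mem_multiIndices_two (i : Fin 3) : Pi.single i 1 ∈ multiIndices 2 :=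
  mem_multiIndices.2 (by simp)

lemma single_two_mem_multiIndices_two (i : Fin 3) : Pi.single i 2 ∈ multiIndices 2 :=
  mem_multiIndices.2 (by simp)

lemma EllipticSystem.apply_add (hU : MemSobolevVec (cube A) 2 U) (hV : MemSobolevVec (cube A) 2 V) :
    ∀ᵐ x ∂volume.restrict (cube A), ∀ n, L.apply (U + V) n x = L.apply U n x + L.apply V n x := by
  have h1 : ∀ᵐ x ∂volume.restrict (cube A), ∀ n, ∀ i : Fin 3,
      weakDeriv (cube A) (Pi.single i 1) (U n + V n) x =
        weakDeriv (cube A) (Pi.single i 1) (U n) x + weakDeriv (cube A) (Pi.single i 1) (V n) x :=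
    ae_all_iff.2 fun n => ae_all_iff.2 fun i =>
      (hU n).weakDeriv_add (isOpen_cube A) (hV n) (single_mem_multiIndices_two i)
  have h2 : ∀ᵐ x ∂volume.restrict (cube A), ∀ n, ∀ i : Fin 3,
      weakDeriv (cube A) (Pi.single i 2) (U n + V n) x =
        weakDeriv (cube A) (Pi.single i 2) (U n) x + weakDeriv (cube A) (Pi.single i 2) (V n) x :=
    ae_all_iff.2 fun n => ae_all_iff.2 fun i =>
      (hU n).weakDeriv_add (isOpen_cube A) (hV n) (single_two_mem_multiIndices_two i)
  filter_upwards [h1, h2] with x h1 h2 n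
  simp only [apply, Pi.add_apply, h1, h2, mul_add, Finset.sum_add_distrib]
  ring

lemma EllipticSystem.apply_sub (hU : MemSobolevVec (cube A) 2 U) (hV : MemSobolevVec (cube A) 2 V) :
    ∀ᵐ x ∂volume.restrict (cube A), ∀ n, L.apply (U - V) n x = L.apply U n x - L.apply V n x := by
  have h := L.apply_add (U := U - V) (V := V) (fun n => (hU n).sub (hV n)) hV
  rw [sub_add_cancel] at h
  filter_upwards [h] with x hx n
  rw [hx n, add_sub_cancel_right]

lemma EllipticSystem.integral_apply_sq_le (hL : L.NormLE M) (hU : MemSobolevVec (cube A) 2 U) :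
    ∫ x in cube A, ∑ n, L.apply U n x ^ 2 ≤
      8 * (1 + M ^ 2) * sobolevNormVec (cube A) 2 U ^ 2 := by
  have hi : ∀ n, ∀ α ∈ multiIndices 2,
      Integrable (fun x => weakDeriv (cube A) α (U n) x ^ 2) (volume.restrict (cube A)) :=
    fun n α hα => ((hU n).hasWeakDeriv hα).1.integrable_sq
  have hs : sobolevNormVec (cube A) 2 U ^ 2 =
      ∫ x in cube A, ∑ n, ∑ α ∈ multiIndices 2, weakDeriv (cube A) α (U n) x ^ 2 := by
    rw [sobolevNormVec_sq, integral_finsetSum _ fun n _ => integrable_finsetSum _ (hi n)]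
    exact Finset.sum_congr rfl fun n _ => (integral_finsetSum _ (hi n)).symm
  rw [hs, ← integral_const_mul]
  refine integral_mono_of_nonneg (Filter.Eventually.of_forall fun x =>
    Finset.sum_nonneg fun _ _ => sq_nonneg _) ((integrable_finsetSum _ fun n _ =>
      integrable_finsetSum _ (hi n)).const_mul _) ?_
  have h0 : ∀ᵐ x ∂volume.restrict (cube A), ∀ n, weakDeriv (cube A) 0 (U n) x = U n x :=
    ae_all_iff.2 fun n => weakDeriv_zero_ae_eq (isOpen_cube A) (hU n).1
  filter_upwards [h0, ae_restrict_mem (measurableSet_cube A)] with x h0 hx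
  have hx := cube_subset_closedCube A hx
  set d : Fin 3 → Fin N → ℝ := fun i n => weakDeriv (cube A) (Pi.single i 1) (U n) x
  set dd : Fin 3 → Fin N → ℝ := fun i n => weakDeriv (cube A) (Pi.single i 2) (U n) x with hdd
  -- The operator has seven terms; the eighth slot is padded by zero.
  have e := sum_sq_add_le_eight ![dd 0, dd 1, dd 2, fun n => ∑ m, L.first 0 x n m * d 0 m,
    fun n => ∑ m, L.first 1 x n m * d 1 m, fun n => ∑ m, L.first 2 x n m * d 2 m,
    fun n => ∑ m, L.zeroth x n m * U m x, fun _ => 0]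
  have b := fun j => sum_sq_mulVec_le (fun n m => L.first j x n m) (d j)
    (sum_sq_entries_le (L.first_continuous j) (hL.1 j) hx)
  have b0 := sum_sq_mulVec_le (fun n m => L.zeroth x n m) (fun m => U m x)
    (sum_sq_entries_le L.zeroth_continuous hL.2 hx)
  have hle : ∀ n, U n x ^ 2 + d 0 n ^ 2 + d 1 n ^ 2 + d 2 n ^ 2 + (dd 0 n ^ 2 + dd 1 n ^ 2 +
      dd 2 n ^ 2) ≤ ∑ α ∈ multiIndices 2, weakDeriv (cube A) α (U n) x ^ 2 := by
    intro n
    rw [sum_multiIndices_two, h0]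
    simp only [hdd, single_two]
    linarith [sq_nonneg (weakDeriv (cube A) (Pi.single 0 1 + Pi.single 1 1) (U n) x),
      sq_nonneg (weakDeriv (cube A) (Pi.single 2 1 + Pi.single 0 1) (U n) x),
      sq_nonneg (weakDeriv (cube A) (Pi.single 2 1 + Pi.single 1 1) (U n) x)]
  have hsum := Finset.sum_le_sum fun n (_ : n ∈ Finset.univ) => hle n
  simp only [Finset.sum_add_distrib] at hsum
  have ns : ∀ f : Fin N → ℝ, 0 ≤ ∑ n, f n ^ 2 := fun f => Finset.sum_nonneg fun _ _ => sq_nonneg _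
  have hlhs : ∑ n, L.apply U n x ^ 2 ≤ 8 * (∑ n, dd 0 n ^ 2 + ∑ n, dd 1 n ^ 2 + ∑ n, dd 2 n ^ 2 +
      M ^ 2 * ∑ n, d 0 n ^ 2 + M ^ 2 * ∑ n, d 1 n ^ 2 + M ^ 2 * ∑ n, d 2 n ^ 2 +
      M ^ 2 * ∑ n, U n x ^ 2) := by
    refine le_trans (le_of_eq ?_) (e.trans ?_)
    · refine Finset.sum_congr rfl fun n _ => ?_
      simp only [apply, Fin.sum_univ_three, Matrix.cons_val, hdd, d]
      congr 1
      ring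
    · simp only [Matrix.cons_val]
      have b₀ := b 0
      have b₁ := b 1
      have b₂ := b 2
      simp only [ne_eq, OfNat.ofNat_ne_zero, not_false_eq_true, zero_pow, Finset.sum_const_zero]
      linarith
  refine hlhs.trans ?_
  calc _ ≤ 8 * (1 + M ^ 2) * (∑ n, U n x ^ 2 + ∑ n, d 0 n ^ 2 + ∑ n, d 1 n ^ 2 + ∑ n, d 2 n ^ 2 +
        (∑ n, dd 0 n ^ 2 + ∑ n, dd 1 n ^ 2 + ∑ n, dd 2 n ^ 2)) := by
        nlinarith [ns (d 0), ns (d 1), ns (d 2), ns fun n => U n x,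
          mul_nonneg (sq_nonneg M) (ns (dd 0)), mul_nonneg (sq_nonneg M) (ns (dd 1)),
          mul_nonneg (sq_nonneg M) (ns (dd 2))]
    _ ≤ _ := mul_le_mul_of_nonneg_left hsum (by positivity)

end Operator

/-! ### Linearity of traces and normal derivatives. -/

section Trace

variable {A : ℝ} {i : Fin 3} {σ : ℝ} {u v : E3 → ℝ} {s t : (Fin 2 → ℝ) → ℝ}

lemma memLp_continuous_square {φ : (Fin 2 → ℝ) → ℝ} (h : Continuous φ) :
    MemLp φ 2 (volume.restrict (square A)) := by
  have hsub : square A ⊆ Set.pi univ fun _ => Icc (-A) A := fun y hy j _ =>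
    Ioo_subset_Icc_self (hy j)
  have hc : IsCompact (Set.pi univ fun _ : Fin 2 => Icc (-A) A) :=
    isCompact_univ_pi fun _ => isCompact_Icc
  have : IsFiniteMeasure (volume.restrict (square A)) :=
    ⟨by simpa using (measure_mono hsub).trans_lt hc.measure_lt_top⟩
  obtain ⟨C, hC⟩ := hc.exists_bound_of_continuousOn h.continuousOn
  have hm : MeasurableSet (square A) := by
    have : square A = Set.pi univ fun _ => Ioo (-A) A := by
      ext y; simp [square]
    rw [this]
    exact MeasurableSet.univ_pi fun _ => measurableSet_Ioo
  refine MemLp.of_bound h.aestronglyMeasurable C ?_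
  filter_upwards [ae_restrict_mem hm] with y hy
  exact hC y (hsub hy)

lemma continuous_facePoint (i : Fin 3) (c : ℝ) : Continuous (facePoint i c) :=
  continuous_const.finInsertNth i continuous_id

lemma HasTrace.sub (hu : HasWeakDeriv (cube A) (Pi.single i 1) u
      (weakDeriv (cube A) (Pi.single i 1) u)) (hu0 : MemLp u 2 (volume.restrict (cube A)))
    (hv : HasWeakDeriv (cube A) (Pi.single i 1) v (weakDeriv (cube A) (Pi.single i 1) v))
    (hv0 : MemLp v 2 (volume.restrict (cube A))) (hs : HasTrace A i σ u s)
    (ht : HasTrace A i σ v t) : HasTrace A i σ (u - v) (s - t) := by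
  refine ⟨hs.1.sub ht.1, fun φ hφ h0 => ?_⟩
  have hp := memLp_of_continuous (A := A) (contDiff_partialDeriv hφ i).continuous
  have hq := memLp_of_continuous (A := A) hφ.continuous
  have hf : MemLp (fun y => φ (facePoint i (σ * A) y)) 2 (volume.restrict (square A)) :=
    memLp_continuous_square (hφ.continuous.comp (continuous_facePoint i (σ * A)))
  have h1 := hs.2 φ hφ h0
  have h2 := ht.2 φ hφ h0
  have i1 : Integrable (fun x => u x * partialDeriv i φ x + weakDeriv (cube A) (Pi.single i 1) u x *
    φ x) (volume.restrict (cube A)) := (hu0.integrable_fun_mul hp).add (hu.1.integrable_fun_mul hq)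
  have i2 : Integrable (fun x => v x * partialDeriv i φ x + weakDeriv (cube A) (Pi.single i 1) v x *
    φ x) (volume.restrict (cube A)) := (hv0.integrable_fun_mul hp).add (hv.1.integrable_fun_mul hq)
  have h3 : ∫ y in square A, (s - t) y * φ (facePoint i (σ * A) y) =
      (∫ y in square A, s y * φ (facePoint i (σ * A) y)) -
        ∫ y in square A, t y * φ (facePoint i (σ * A) y) := by
    rw [← integral_sub (hs.1.integrable_fun_mul hf) (ht.1.integrable_fun_mul hf)]
    simp only [Pi.sub_apply, sub_mul]
  rw [h3, mul_sub, ← h1, ← h2, ← integral_sub i1 i2]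
  refine integral_congr_ae ?_
  filter_upwards [(hu.sub hu0 hv0 hv).weakDeriv_ae_eq (isOpen_cube A)] with x hx
  rw [hx, Pi.sub_apply, Pi.sub_apply]
  ring

lemma HasTrace.congr (h : HasTrace A i σ u t) (huv : u =ᵐ[volume.restrict (cube A)] v) :
    HasTrace A i σ v t := by
  refine ⟨h.1, fun φ hφ h0 => ?_⟩
  rw [← h.2 φ hφ h0, weakDeriv_congr huv]
  exact integral_congr_ae (huv.mono fun x hx => by simp only [hx])

lemma HasNormalDeriv.sub (hu : MemSobolev (cube A) 2 u) (hv : MemSobolev (cube A) 2 v)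
    (hs : HasNormalDeriv A i σ u s) (ht : HasNormalDeriv A i σ v t) :
    HasNormalDeriv A i σ (u - v) (s - t) := by
  have h := HasTrace.sub (hasWeakDeriv_weakDeriv ⟨_, hu.weakDeriv_first i i⟩) (hu.first i).1
    (hasWeakDeriv_weakDeriv ⟨_, hv.weakDeriv_first i i⟩) (hv.first i).1 hs ht
  have h2 := h.congr (hu.weakDeriv_sub (isOpen_cube A) hv (single_mem_multiIndices_two i)).symm
  have e : ((fun y => σ * s y) - fun y => σ * t y) = fun y => σ * (s - t) y := by
    funext y; simp only [Pi.sub_apply]; ring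
  rwa [e] at h2

/-- Equal Cauchy data cancel and the lateral Neumann conditions are homogeneous. The condition on
the face opposite to `S` is discarded, since the zero space does not impose it. -/
lemma BoundaryConditions.zeroComponent_sub {N : ℕ} {S : Surface} {φ₀ φ₁ : Fin N → (Fin 2 → ℝ) → ℝ}
    {U V : Fin N → E3 → ℝ} (hU : MemSobolevVec (cube A) 3 U) (hV : MemSobolevVec (cube A) 3 V)
    (hbU : BoundaryConditions A S φ₀ φ₁ U) (hbV : BoundaryConditions A S φ₀ φ₁ V) (n : Fin N) :
    ZeroComponent A S ((U - V) n) := by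
  obtain ⟨a1, a2, a3, -⟩ := hbU n
  obtain ⟨b1, b2, b3, -⟩ := hbV n
  have mU := (hU n).mono (m' := 2) (by norm_num)
  have mV := (hV n).mono (m' := 2) (by norm_num)
  have h1 := HasTrace.sub (mU.first 2) mU.1 (mV.first 2) mV.1 a1 b1
  have h2 := HasNormalDeriv.sub mU mV a2 b2
  rw [sub_self] at h1 h2
  refine ⟨(hU n).sub (hV n), h1, h2, fun i hi σ hσ => ?_⟩
  have h3 := HasNormalDeriv.sub mU mV (a3 i hi σ hσ) (b3 i hi σ hσ)
  rwa [sub_self] at h3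

lemma ZeroComponent.sub {S : Surface} (hu : ZeroComponent A S u) (hv : ZeroComponent A S v) :
    ZeroComponent A S (u - v) := by
  have mU := hu.1.mono (m' := 2) (by norm_num)
  have mV := hv.1.mono (m' := 2) (by norm_num)
  have h1 := HasTrace.sub (mU.first 2) mU.1 (mV.first 2) mV.1 hu.2.1 hv.2.1
  have h2 := HasNormalDeriv.sub mU mV hu.2.2.1 hv.2.2.1
  rw [sub_self] at h1 h2
  refine ⟨hu.1.sub hv.1, h1, h2, fun i hi σ hσ => ?_⟩
  have h3 := HasNormalDeriv.sub mU mV (hu.2.2.2 i hi σ hσ) (hv.2.2.2 i hi σ hσ)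
  rwa [sub_self] at h3

end Trace

/-! ### Existence of minimizers -/

section ZeroTrace

variable {A : ℝ} {i : Fin 3} {σ : ℝ} {u a b : E3 → ℝ}

/-- The Green identity that says that `u` has the trace zero, with `a = u` and `b = ∂u/∂x_i`. -/
def ZeroTracePair (A : ℝ) (i : Fin 3) (σ : ℝ) (a b : E3 → ℝ) : Prop :=
  ∀ φ : E3 → ℝ, ContDiff ℝ ∞ φ → (∀ y ∈ square A, φ (facePoint i (-(σ * A)) y) = 0) →
    ∫ x in cube A, (partialDeriv i φ x * a x + φ x * b x) * 1 = 0

/-- For trace zero the boundary integral disappears, leaving equations that are linear in the pair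
of a function and its derivative. This lets boundary conditions pass to the `L²` setting of jets. -/
lemma hasTrace_zero_iff (ha : u =ᵐ[volume.restrict (cube A)] a)
    (hb : weakDeriv (cube A) (Pi.single i 1) u =ᵐ[volume.restrict (cube A)] b) :
    HasTrace A i σ u 0 ↔ ZeroTracePair A i σ a b := by
  have key : ∀ φ : E3 → ℝ, ∫ x in cube A,
      (u x * partialDeriv i φ x + weakDeriv (cube A) (Pi.single i 1) u x * φ x) =
      ∫ x in cube A, (partialDeriv i φ x * a x + φ x * b x) * 1 := fun φ => by
    refine integral_congr_ae ?_
    filter_upwards [ha, hb] with x h1 h2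
    rw [h1, h2]; ring
  constructor
  · intro h φ hφ h0
    rw [← key, h.2 φ hφ h0]
    simp
  · refine fun h => ⟨MemLp.zero, fun φ hφ h0 => ?_⟩
    rw [key, h φ hφ h0]
    simp

lemma hasNormalDeriv_zero_iff (hu : MemSobolev (cube A) 2 u)
    (ha : weakDeriv (cube A) (Pi.single i 1) u =ᵐ[volume.restrict (cube A)] a)
    (hb : weakDeriv (cube A) (Pi.single i 2) u =ᵐ[volume.restrict (cube A)] b) :
    HasNormalDeriv A i σ u 0 ↔ ZeroTracePair A i σ a b := by
  have h0 : (fun y : Fin 2 → ℝ => σ * (0 : (Fin 2 → ℝ) → ℝ) y) = 0 := by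
    funext y; simp
  rw [HasNormalDeriv, h0]
  refine hasTrace_zero_iff ha (((hu.weakDeriv_first i i).weakDeriv_ae_eq (isOpen_cube A)).trans ?_)
  rwa [← single_two]

end ZeroTrace

/-! ### Jets: the minimization problem as an affine problem in a product of `L²` spaces. -/

section Jets

variable {A : ℝ} {N : ℕ}

/-- The indices of the components of the residual and of the derivatives of order at most `3`. -/
abbrev JetIndex (N : ℕ) : Type := Fin N ⊕ Fin N × multiIndices 3

/-- The entry of a jet that stands for `∂^α u_n`. -/
def jetEntry (p : JetIndex N → E3 → ℝ) (n : Fin N) (α : Fin 3 → ℕ) : E3 → ℝ :=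
  if h : α ∈ multiIndices 3 then p (Sum.inr (n, ⟨α, h⟩)) else 0

lemma isPointwise_jetEntry (μ : Measure E3) (n : Fin N) (α : Fin 3 → ℕ) :
    IsPointwise μ fun p : JetIndex N → E3 → ℝ => jetEntry p n α := by
  unfold jetEntry
  split_ifs
  · exact isPointwise_proj _
  · exact isPointwise_zero

lemma isMultiplier_of_continuous {φ : E3 → ℝ} (h : Continuous φ) :
    IsMultiplier (volume.restrict (cube A)) φ := by
  intro f hf
  obtain ⟨C, hC⟩ := (isCompact_closedCube A).exists_bound_of_continuousOn h.continuousOn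
  refine MemLp.of_le_mul (c := C) hf (h.aestronglyMeasurable.mul hf.1) ?_
  filter_upwards [ae_restrict_mem (measurableSet_cube A)] with x hx
  rw [norm_mul]
  exact mul_le_mul_of_nonneg_right (hC x (cube_subset_closedCube A hx)) (norm_nonneg _)

/-- The operator `L` applied to a jet. -/
def EllipticSystem.applyJet (L : EllipticSystem A N) (p : JetIndex N → E3 → ℝ) (n : Fin N)
    (x : E3) : ℝ :=
  (∑ i, jetEntry p n (Pi.single i 2) x) +
    (∑ j, ∑ m, L.first j x n m * jetEntry p m (Pi.single j 1) x) +
    ∑ m, L.zeroth x n m * jetEntry p m 0 x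

lemma EllipticSystem.isPointwise_applyJet (L : EllipticSystem A N) (n : Fin N) :
    IsPointwise (volume.restrict (cube A)) fun p => L.applyJet p n :=
  ((IsPointwise.sum fun _ => isPointwise_jetEntry _ _ _).add
    (IsPointwise.sum fun j => IsPointwise.sum fun m => (isPointwise_jetEntry _ _ _).mul
      fun _ hf => memLp_entry_mul (L.first_continuous j) n m hf)).add
    (IsPointwise.sum fun m => (isPointwise_jetEntry _ _ _).mul
      fun _ hf => memLp_entry_mul L.zeroth_continuous n m hf)

/-- The jet conditions: the entries are the derivatives of a function in `zeroSpace`, and the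
residual is that of `V + F`. -/
def EllipticSystem.IsJet (L : EllipticSystem A N) (S : Surface) (F : Fin N → E3 → ℝ)
    (p : JetIndex N → E3 → ℝ) : Prop :=
  ∀ n, (∀ α ∈ multiIndices 3, ∀ φ, IsTestFunction (cube A) φ → ∫ x in cube A,
      (multiDeriv α φ x * jetEntry p n 0 x + -(-1) ^ (∑ i, α i) * φ x * jetEntry p n α x) * 1 = 0) ∧
    ZeroTracePair A 2 S.sign (jetEntry p n 0) (jetEntry p n (Pi.single 2 1)) ∧
    ZeroTracePair A 2 S.sign (jetEntry p n (Pi.single 2 1)) (jetEntry p n (Pi.single 2 2)) ∧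
    (∀ i : Fin 3, i ≠ 2 → ∀ σ : ℝ, σ = 1 ∨ σ = -1 →
      ZeroTracePair A i σ (jetEntry p n (Pi.single i 1)) (jetEntry p n (Pi.single i 2))) ∧
    ∀ ψ : E3 → ℝ, MemLp ψ 2 (volume.restrict (cube A)) →
      ∫ x in cube A, (p (Sum.inl n) x + -1 * L.applyJet p n x) * ψ x =
        ∫ x in cube A, L.apply F n x * ψ x

/-- The factor `1` in `ZeroTracePair` plays the role of the `L²` test function `ψ` in
`IsPointwise.isAffineCond`; `φ` and its derivative act as multipliers. -/
lemma isAffineCond_zeroTracePair (i : Fin 3) (σ : ℝ) (n : Fin N) (α β : Fin 3 → ℕ) :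
    IsAffineCond (volume.restrict (cube A)) fun p : JetIndex N → E3 → ℝ =>
      ZeroTracePair A i σ (jetEntry p n α) (jetEntry p n β) :=
  IsAffineCond.forall fun _ => IsAffineCond.forall fun hφ => IsAffineCond.forall fun _ =>
    IsPointwise.isAffineCond (((isPointwise_jetEntry _ n α).mul (isMultiplier_of_continuous
      (contDiff_partialDeriv hφ i).continuous)).add ((isPointwise_jetEntry _ n β).mul
        (isMultiplier_of_continuous hφ.continuous))) (memLp_const 1) 0

lemma EllipticSystem.isAffineCond_isJet (L : EllipticSystem A N) (S : Surface)
    (F : Fin N → E3 → ℝ) : IsAffineCond (volume.restrict (cube A)) (L.IsJet S F) := by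
  refine IsAffineCond.forall fun n => IsAffineCond.and ?_ (IsAffineCond.and
    (isAffineCond_zeroTracePair _ _ _ _ _) (IsAffineCond.and (isAffineCond_zeroTracePair _ _ _ _ _)
      (IsAffineCond.and (IsAffineCond.forall fun i => IsAffineCond.forall fun _ =>
        IsAffineCond.forall fun σ => IsAffineCond.forall fun _ =>
          isAffineCond_zeroTracePair _ _ _ _ _) ?_)))
  · refine IsAffineCond.forall fun α => IsAffineCond.forall fun _ => IsAffineCond.forall fun φ =>
      IsAffineCond.forall fun hφ => ?_
    exact IsPointwise.isAffineCond (((isPointwise_jetEntry _ n 0).mul (isMultiplier_of_continuous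
      (hφ.multiDeriv α).1.continuous)).add ((isPointwise_jetEntry _ n α).mul
        (isMultiplier_of_continuous (continuous_const.mul hφ.1.continuous)))) (memLp_const 1) 0
  · refine IsAffineCond.forall fun ψ => IsAffineCond.forall fun hψ => ?_
    exact IsPointwise.isAffineCond ((isPointwise_proj _).add
      ((L.isPointwise_applyJet n).mul (isMultiplier_const _))) hψ _

lemma zero_mem_multiIndices (m : ℕ) : 0 ∈ multiIndices m := mem_multiIndices.2 (by simp)

lemma jetEntry_of_mem (p : JetIndex N → E3 → ℝ) (n : Fin N) {α : Fin 3 → ℕ}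
    (h : α ∈ multiIndices 3) : jetEntry p n α = p (Sum.inr (n, ⟨α, h⟩)) := dif_pos h

lemma multiIndices_mono {m m' : ℕ} (h : m ≤ m') : multiIndices m ⊆ multiIndices m' :=
  fun _ hα => mem_multiIndices.2 ((mem_multiIndices.1 hα).trans h)

/-- The jet of a function, with its residual. -/
def EllipticSystem.jet (L : EllipticSystem A N) (F V : Fin N → E3 → ℝ) :
    JetIndex N → E3 → ℝ :=
  Sum.elim (fun n => L.apply (V + F) n) fun k => weakDeriv (cube A) k.2 (V k.1)

lemma EllipticSystem.jetEntry_jet (L : EllipticSystem A N) (F V : Fin N → E3 → ℝ) (n : Fin N)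
    {α : Fin 3 → ℕ} (h : α ∈ multiIndices 3) :
    jetEntry (L.jet F V) n α = weakDeriv (cube A) α (V n) := jetEntry_of_mem _ n h

/-- The weights of the functional `J_γ` on jets. -/
def jetWeight (γ : ℝ) : JetIndex N → ℝ := Sum.elim (fun _ => 1) fun _ => γ

/-- Carrying the residual as separate components makes the functional a diagonal weighted sum of
squared norms, as `IsAffineCond.exists_minimizer` requires, although `L` mixes the derivatives. -/
lemma EllipticSystem.functional_eq (L : EllipticSystem A N) {F V : Fin N → E3 → ℝ} (γ : ℝ)
    (hF : MemSobolevVec (cube A) 2 F) (hV : MemSobolevVec (cube A) 2 V)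
    {p : JetIndex N → E3 → ℝ} (h : ∀ k, p k =ᵐ[volume.restrict (cube A)] L.jet F V k) :
    ∑ k, jetWeight γ k * ∫ x in cube A, p k x ^ 2 = L.functional F γ V := by
  have e : ∀ k, ∫ x in cube A, p k x ^ 2 = ∫ x in cube A, L.jet F V k x ^ 2 := fun k =>
    integral_congr_ae ((h k).mono fun x hx => by simp only [hx])
  simp only [e, Fintype.sum_sum_type, jetWeight, jet, Sum.elim_inl, Sum.elim_inr, one_mul]
  rw [functional, integral_finsetSum _ fun n _ =>
    (L.memLp_apply (U := V + F) (fun n => (hV n).add (hF n)) n).integrable_sq, ← Finset.mul_sum,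
    sobolevNormVec_sq, Fintype.sum_prod_type]
  congr 2

lemma memSobolevVec_of_zeroSpace {S : Surface} {V : Fin N → E3 → ℝ} (hV : V ∈ zeroSpace N A S) :
    MemSobolevVec (cube A) 2 V := fun n => (hV n).1.mono (by norm_num)

lemma EllipticSystem.applyJet_ae_eq (L : EllipticSystem A N) {V : Fin N → E3 → ℝ}
    {p : JetIndex N → E3 → ℝ} (h0 : ∀ n, V n =ᵐ[volume.restrict (cube A)] jetEntry p n 0)
    (h : ∀ n, ∀ α ∈ multiIndices 2,
      weakDeriv (cube A) α (V n) =ᵐ[volume.restrict (cube A)] jetEntry p n α) :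
    ∀ᵐ x ∂volume.restrict (cube A), ∀ n, L.apply V n x = L.applyJet p n x := by
  have h0' := ae_all_iff.2 h0
  have h1 : ∀ᵐ x ∂volume.restrict (cube A), ∀ n, ∀ i : Fin 3,
      weakDeriv (cube A) (Pi.single i 1) (V n) x = jetEntry p n (Pi.single i 1) x :=
    ae_all_iff.2 fun n => ae_all_iff.2 fun i => h n _ (single_mem_multiIndices_two i)
  have h2 : ∀ᵐ x ∂volume.restrict (cube A), ∀ n, ∀ i : Fin 3,
      weakDeriv (cube A) (Pi.single i 2) (V n) x = jetEntry p n (Pi.single i 2) x :=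
    ae_all_iff.2 fun n => ae_all_iff.2 fun i => h n _ (single_two_mem_multiIndices_two i)
  filter_upwards [h0', h1, h2] with x h0 h1 h2 n
  simp only [apply, applyJet, h0, h1, h2]

lemma EllipticSystem.isJet_jet (L : EllipticSystem A N) {S : Surface} {F V : Fin N → E3 → ℝ}
    (hF : MemSobolevVec (cube A) 2 F) (hV : V ∈ zeroSpace N A S) : L.IsJet S F (L.jet F V) := by
  have hV2 := memSobolevVec_of_zeroSpace hV
  have h0 : ∀ n, V n =ᵐ[volume.restrict (cube A)] jetEntry (L.jet F V) n 0 := fun n => by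
    rw [L.jetEntry_jet F V n (zero_mem_multiIndices 3)]
    exact (weakDeriv_zero_ae_eq (isOpen_cube A) (hV n).1.1).symm
  have h2 : ∀ n, ∀ α ∈ multiIndices 2, weakDeriv (cube A) α (V n) =ᵐ[volume.restrict (cube A)]
      jetEntry (L.jet F V) n α := fun n α hα => by
    rw [L.jetEntry_jet F V n (multiIndices_mono (by norm_num) hα)]
  intro n
  obtain ⟨m3, tr, nd, lat⟩ := hV n
  refine ⟨fun α hα φ hφ => ?_,
    (hasTrace_zero_iff (h0 n) (h2 n _ (single_mem_multiIndices_two 2))).1 tr,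
    (hasNormalDeriv_zero_iff (hV2 n) (h2 n _ (single_mem_multiIndices_two 2))
      (h2 n _ (single_two_mem_multiIndices_two 2))).1 nd, fun i hi σ hσ =>
    (hasNormalDeriv_zero_iff (hV2 n) (h2 n _ (single_mem_multiIndices_two i))
      (h2 n _ (single_two_mem_multiIndices_two i))).1 (lat i hi σ hσ), fun ψ hψ => ?_⟩
  · have hw := m3.hasWeakDeriv hα
    rw [L.jetEntry_jet F V n hα]
    have e : ∫ x in cube A, (multiDeriv α φ x * jetEntry (L.jet F V) n 0 x +
        -(-1) ^ (∑ i, α i) * φ x * weakDeriv (cube A) α (V n) x) * 1 =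
        ∫ x in cube A, (V n x * multiDeriv α φ x -
          (-1) ^ (∑ i, α i) * (weakDeriv (cube A) α (V n) x * φ x)) := by
      refine integral_congr_ae ((h0 n).mono fun x hx => ?_)
      simp only [hx]; ring
    rw [e, integral_sub (m3.1.integrable_fun_mul (hφ.multiDeriv α).memLp)
      ((hw.1.integrable_fun_mul hφ.memLp).const_mul _), integral_const_mul, hw.2 φ hφ, sub_self]
  · refine integral_congr_ae ?_
    filter_upwards [L.apply_add hV2 hF, L.applyJet_ae_eq h0 h2] with x h3 h4
    simp only [jet, Sum.elim_inl, h3 n]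
    rw [← jet, ← h4 n]; ring

/-- The zeroth entries form `V`: the first group of equations says that the other entries are its
weak derivatives, and the trace identities put it in the zero space. -/
lemma EllipticSystem.exists_of_isJet (L : EllipticSystem A N) {S : Surface} {F : Fin N → E3 → ℝ}
    (hF : MemSobolevVec (cube A) 2 F) {p : JetIndex N → E3 → ℝ}
    (hp : ∀ k, MemLp (p k) 2 (volume.restrict (cube A))) (h : L.IsJet S F p) :
    ∃ V ∈ zeroSpace N A S, ∀ k, p k =ᵐ[volume.restrict (cube A)] L.jet F V k := by
  have hj : ∀ n α, MemLp (jetEntry p n α) 2 (volume.restrict (cube A)) := fun n α =>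
    (isPointwise_jetEntry _ n α).memLp hp
  set V : Fin N → E3 → ℝ := fun n => jetEntry p n 0 with hVdef
  have hw : ∀ n, ∀ α ∈ multiIndices 3, HasWeakDeriv (cube A) α (V n) (jetEntry p n α) := by
    refine fun n α hα => ⟨hj n α, fun φ hφ => ?_⟩
    have e := (h n).1 α hα φ hφ
    have e' : ∫ x in cube A, (multiDeriv α φ x * jetEntry p n 0 x +
        -(-1) ^ (∑ i, α i) * φ x * jetEntry p n α x) * 1 =
        ∫ x in cube A, (V n x * multiDeriv α φ x -
          (-1) ^ (∑ i, α i) * (jetEntry p n α x * φ x)) := by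
      congr 1; funext x; simp only [hVdef]; ring
    rw [e', integral_sub ((hj n 0).integrable_fun_mul (hφ.multiDeriv α).memLp)
      (((hj n α).integrable_fun_mul hφ.memLp).const_mul _), integral_const_mul] at e
    exact sub_eq_zero.1 e
  have m3 : ∀ n, MemSobolev (cube A) 3 (V n) := fun n => ⟨hj n 0, fun α hα => ⟨_, hw n α hα⟩⟩
  have m2 : MemSobolevVec (cube A) 2 V := fun n => (m3 n).mono (by norm_num)
  have h3 : ∀ n, ∀ α ∈ multiIndices 3, weakDeriv (cube A) α (V n) =ᵐ[volume.restrict (cube A)]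
      jetEntry p n α := fun n α hα => (hw n α hα).weakDeriv_ae_eq (isOpen_cube A)
  have h2 : ∀ n, ∀ α ∈ multiIndices 2, weakDeriv (cube A) α (V n) =ᵐ[volume.restrict (cube A)]
      jetEntry p n α := fun n α hα => h3 n α (multiIndices_mono (by norm_num) hα)
  have h0 : ∀ n, V n =ᵐ[volume.restrict (cube A)] jetEntry p n 0 := fun n => Filter.EventuallyEq.rfl
  refine ⟨V, fun n => ⟨m3 n,
    (hasTrace_zero_iff (h0 n) (h2 n _ (single_mem_multiIndices_two 2))).2 (h n).2.1,
    (hasNormalDeriv_zero_iff (m2 n) (h2 n _ (single_mem_multiIndices_two 2))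
      (h2 n _ (single_two_mem_multiIndices_two 2))).2 (h n).2.2.1, fun i hi σ hσ =>
    (hasNormalDeriv_zero_iff (m2 n) (h2 n _ (single_mem_multiIndices_two i))
      (h2 n _ (single_two_mem_multiIndices_two i))).2 ((h n).2.2.2.1 i hi σ hσ)⟩, ?_⟩
  rintro (n | ⟨n, α, hα⟩)
  · have hLp := (L.isPointwise_applyJet n).memLp hp
    have hLF := L.memLp_apply hF n
    -- The defect of the residual equation is itself in `L²`; used as its own test function it has
    -- zero norm.
    set r : E3 → ℝ := fun x => p (Sum.inl n) x + -1 * L.applyJet p n x - L.apply F n x with hr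
    have i1 : MemLp (fun x => p (Sum.inl n) x + -1 * L.applyJet p n x) 2
      (volume.restrict (cube A)) := (hp _).add (hLp.const_mul (-1))
    have hrm : MemLp r 2 (volume.restrict (cube A)) := i1.sub hLF
    have h4 : ∫ x in cube A, r x ^ 2 = 0 := by
      have e : ∫ x in cube A, r x ^ 2 = ∫ x in cube A,
          ((p (Sum.inl n) x + -1 * L.applyJet p n x) * r x - L.apply F n x * r x) := by
        congr 1; funext x; simp only [hr]; ring
      rw [e, integral_sub (i1.integrable_fun_mul hrm) (hLF.integrable_fun_mul hrm),
        (h n).2.2.2.2 r hrm, sub_self]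
    have h5 := (integral_eq_zero_iff_of_nonneg (fun x => sq_nonneg (r x)) hrm.integrable_sq).1 h4
    filter_upwards [h5, L.apply_add m2 hF, L.applyJet_ae_eq h0 h2] with x h5 h6 h7
    have h8 : r x = 0 := by simpa using h5
    simp only [jet, Sum.elim_inl, h6 n, h7 n]
    simp only [hr] at h8
    linarith
  · have := (h3 n α hα).symm
    rwa [jetEntry_of_mem p n hα] at this

/-- The functional `J_γ` has a minimizer. -/
theorem EllipticSystem.exists_isMinimizer (L : EllipticSystem A N) (S : Surface)
    {F : Fin N → E3 → ℝ} (hF : MemSobolevVec (cube A) 2 F) {γ : ℝ} (hγ : 0 < γ)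
    (hne : (zeroSpace N A S).Nonempty) : ∃ V, L.IsMinimizer S F γ V := by
  have memj : ∀ V ∈ zeroSpace N A S, ∀ k, MemLp (L.jet F V k) 2 (volume.restrict (cube A)) := by
    rintro V hV (n | ⟨n, α, hα⟩)
    · exact L.memLp_apply (fun n => (memSobolevVec_of_zeroSpace hV n).add (hF n)) n
    · exact ((hV n).1.hasWeakDeriv hα).1
  obtain ⟨V₀, hV₀⟩ := hne
  obtain ⟨p, hp, hQ, hmin⟩ := (L.isAffineCond_isJet S F).exists_minimizer (w := jetWeight γ)
    (by rintro (n | k) <;> simp [jetWeight, hγ]) ⟨_, memj V₀ hV₀, L.isJet_jet hF hV₀⟩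
  obtain ⟨V, hV, hpV⟩ := L.exists_of_isJet hF hp hQ
  refine ⟨V, hV, fun V' hV' => ?_⟩
  have h := hmin _ (memj V' hV') (L.isJet_jet hF hV')
  rwa [L.functional_eq γ hF (memSobolevVec_of_zeroSpace hV) hpV,
    L.functional_eq γ hF (memSobolevVec_of_zeroSpace hV') fun _ => Filter.EventuallyEq.rfl] at h

end Jets

/-! ### The a priori bounds for minimizers -/

section Minimizer

variable {A M δ : ℝ} {N : ℕ} {S : Surface} {U G F V : Fin N → E3 → ℝ} {L : EllipticSystem A N}

/-- Comparison of a minimizer with the difference of the exact solution and a function with the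
same data. -/
lemma EllipticSystem.IsMinimizer.bounds (hL : L.NormLE M) (hU : MemSobolevVec (cube A) 3 U)
    (hG : MemSobolevVec (cube A) 3 G) (hF : MemSobolevVec (cube A) 3 F)
    (hLU : ∀ n, ∀ᵐ x ∂volume.restrict (cube A), L.apply U n x = 0)
    (hUG : U - G ∈ zeroSpace N A S) (hδ : 0 < δ)
    (hFG : sobolevNormVec (cube A) 2 (F - G) ≤ δ) (hV : L.IsMinimizer S F (δ ^ 2) V) :
    (∫ x in cube A, ∑ n, L.apply (V - (U - G)) n x ^ 2) ≤
        64 * (1 + M ^ 2) * (1 + sobolevNormVec (cube A) 3 U + sobolevNormVec (cube A) 3 G) ^ 2 *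
          δ ^ 2 ∧
      sobolevNormVec (cube A) 2 (V - (U - G)) ^ 2 ≤
        64 * (1 + M ^ 2) * (1 + sobolevNormVec (cube A) 3 U + sobolevNormVec (cube A) 3 G) ^ 2 := by
  have h23 : (2 : ℕ) ≤ 3 := by norm_num
  have hO := isOpen_cube A
  have U2 : MemSobolevVec (cube A) 2 U := fun n => (hU n).mono h23
  have G2 : MemSobolevVec (cube A) 2 G := fun n => (hG n).mono h23
  have F2 : MemSobolevVec (cube A) 2 F := fun n => (hF n).mono h23
  have V3 : MemSobolevVec (cube A) 3 V := fun n => (hV.1 n).1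
  have V2 : MemSobolevVec (cube A) 2 V := fun n => (V3 n).mono h23
  have FG2 : MemSobolevVec (cube A) 2 (F - G) := fun n => (F2 n).sub (G2 n)
  have VF2 : MemSobolevVec (cube A) 2 (V + F) := fun n => (V2 n).add (F2 n)
  have UG3 : MemSobolevVec (cube A) 3 (U - G) := fun n => (hU n).sub (hG n)
  set E := 1 + sobolevNormVec (cube A) 3 U + sobolevNormVec (cube A) 3 G with hE
  have nU := sobolevNormVec_nonneg (cube A) 3 U
  have nG := sobolevNormVec_nonneg (cube A) 3 G
  have hE1 : 1 ≤ E ^ 2 := one_le_pow₀ (by rw [hE]; linarith)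
  have hFG2 : sobolevNormVec (cube A) 2 (F - G) ^ 2 ≤ δ ^ 2 :=
    pow_le_pow_left₀ (sobolevNormVec_nonneg _ _ _) hFG 2
  have nUG : sobolevNormVec (cube A) 3 (U - G) ^ 2 ≤ 2 * E ^ 2 := by
    refine (sobolevNormVec_sub_sq_le hO hU hG).trans ?_
    rw [hE]; nlinarith [mul_nonneg nU nG]
  have hLU' := ae_all_iff.2 hLU
  have hI : ∫ x in cube A, ∑ n, L.apply (F - G) n x ^ 2 ≤ 8 * (1 + M ^ 2) * δ ^ 2 :=
    (L.integral_apply_sq_le hL FG2).trans (mul_le_mul_of_nonneg_left hFG2 (by positivity))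
  -- The residual of the competitor `U - G` reduces to `L(F - G)` because `L(U) = 0`, so it is
  -- `O(δ)` by the `H²` bound of `L`.
  have e1 : U - G + F = U + (F - G) := by abel
  have hLe : ∀ᵐ x ∂volume.restrict (cube A), ∀ n,
      L.apply (U - G + F) n x = L.apply (F - G) n x := by
    rw [e1]
    filter_upwards [L.apply_add U2 FG2, hLU'] with x h1 h2 n
    rw [h1 n, h2 n, zero_add]
  have hJ : L.functional F (δ ^ 2) V ≤ 8 * (1 + M ^ 2) * δ ^ 2 + δ ^ 2 * (2 * E ^ 2) := by
    refine (hV.2 hUG).trans ?_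
    refine add_le_add ?_ (mul_le_mul_of_nonneg_left nUG (sq_nonneg _))
    refine le_trans (le_of_eq (integral_congr_ae ?_)) hI
    filter_upwards [hLe] with x hx
    simp only [hx]
  have hM : 0 ≤ M ^ 2 := sq_nonneg M
  have hδ2 : 0 < δ ^ 2 := by positivity
  have hB : 8 * (1 + M ^ 2) * δ ^ 2 + δ ^ 2 * (2 * E ^ 2) ≤ 10 * (1 + M ^ 2) * E ^ 2 * δ ^ 2 := by
    have : 8 * (1 + M ^ 2) + 2 * E ^ 2 ≤ 10 * (1 + M ^ 2) * E ^ 2 := by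
      nlinarith [mul_le_mul_of_nonneg_left hE1 (by positivity : 0 ≤ 8 * (1 + M ^ 2)),
        mul_nonneg hM (sq_nonneg E)]
    nlinarith [mul_le_mul_of_nonneg_right this hδ2.le]
  have nI : 0 ≤ ∫ x in cube A, ∑ n, L.apply (V + F) n x ^ 2 :=
    integral_nonneg fun _ => Finset.sum_nonneg fun _ _ => sq_nonneg _
  have hJ' := hJ.trans hB
  rw [functional] at hJ'
  have hVI : ∫ x in cube A, ∑ n, L.apply (V + F) n x ^ 2 ≤ 10 * (1 + M ^ 2) * E ^ 2 * δ ^ 2 := by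
    nlinarith [mul_nonneg hδ2.le (sq_nonneg (sobolevNormVec (cube A) 3 V))]
  -- The choice `γ = δ²` matters here: the penalty term is `O(δ²)`, and cancelling `δ²` leaves a
  -- bound independent of `δ`.
  have hVn : sobolevNormVec (cube A) 3 V ^ 2 ≤ 10 * (1 + M ^ 2) * E ^ 2 := by
    refine le_of_mul_le_mul_left ?_ hδ2
    linarith
  constructor
  -- Thus `L(V - (U - G))` is the residual of the minimizer minus `L(F - G)`, and both are `O(δ)`.
  · have e2 : V - (U - G) = V + F - (U - G + F) := by abel
    have UGF2 : MemSobolevVec (cube A) 2 (U - G + F) := fun n =>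
      ((UG3 n).mono h23).add (F2 n)
    have h1 := integral_sq_le_of_ae (fun n => L.memLp_apply VF2 n) (fun n => L.memLp_apply FG2 n)
      (h := fun n => L.apply (V - (U - G)) n) (by
        rw [e2]
        filter_upwards [L.apply_sub VF2 UGF2, hLe] with x h1 h2 n
        rw [h1 n, h2 n]
        nlinarith [sq_nonneg (L.apply (V + F) n x + L.apply (F - G) n x)])
    refine h1.trans ?_
    have : 8 * (1 + M ^ 2) * δ ^ 2 ≤ 8 * (1 + M ^ 2) * E ^ 2 * δ ^ 2 :=
      mul_le_mul_of_nonneg_right (le_mul_of_one_le_right (by positivity) hE1) hδ2.le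
    nlinarith [mul_nonneg (by positivity : 0 ≤ (1 + M ^ 2) * E ^ 2) hδ2.le]
  · have h1 := sobolevNormVec_sub_sq_le hO V3 UG3
    have h2 := pow_le_pow_left₀ (sobolevNormVec_nonneg _ _ _)
      (sobolevNormVec_mono_order (cube A) h23 (V - (U - G))) 2
    nlinarith [mul_nonneg hM (sq_nonneg E), sq_nonneg E]

end Minimizer

end QRM

end

/-- Convergence rate of the regularized solutions of the quasi-reversibility method, for Cauchy data
on either side `S` of the cube. The constant `B` depends only on `A` and on the bound `M` of the
coefficient matrices of the operator `L`. -/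
theorem theorem7p2 (A : ℝ) (hA : 0 < A) (M : ℝ) :
    ∃ B : ℝ, 0 < B ∧ ∀ ε ∈ Set.Ioo 0 A,
      ∃ δ₀ ∈ Set.Ioo (0 : ℝ) 1, ∃ α ∈ Set.Ioo (0 : ℝ) (1 / 2),
        ∀ (S : Surface) (N : ℕ) (L : EllipticSystem A N), L.NormLE M →
        ∀ (φ₀ φ₁ φ₀s φ₁s : Fin N → (Fin 2 → ℝ) → ℝ) (Us Fs F : Fin N → E3 → ℝ),
          MemSobolevVec (cube A) 3 Us → MemSobolevVec (cube A) 3 Fs →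
          MemSobolevVec (cube A) 3 F →
          (∀ n, ∀ᵐ x ∂(volume.restrict (cube A)), L.apply Us n x = 0) →
          BoundaryConditions A S φ₀s φ₁s Us → BoundaryConditions A S φ₀s φ₁s Fs →
          BoundaryConditions A S φ₀ φ₁ F →
          ∀ δ ∈ Set.Ioo 0 δ₀, sobolevNormVec (cube A) 2 (F - Fs) ≤ δ →
            (∃ V, L.IsMinimizer S F (δ ^ 2) V) ∧
            ∀ V, L.IsMinimizer S F (δ ^ 2) V →
              sobolevNormVec (subdomain A ε S) 2 (V + F - Us) ≤
                B * (1 + sobolevNormVec (cube A) 3 Us + sobolevNormVec (cube A) 3 Fs) *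
                  δ ^ α := by
  -- Both parts of the error, `V - (Us - Fs)` and `F - Fs`, are at most `E δ^α` on the subdomain,
  -- with all other constants already absorbed into `δ₀` and `α`. The inequality `‖a + b‖² ≤ 2‖a‖² +
  -- 2‖b‖²` then gives exactly `2`.
  refine ⟨2, two_pos, fun ε hε => ?_⟩
  obtain ⟨δ₀, hδ₀, α, hα, hstab⟩ := holder_stability hA M hε.1 hε.2
    (K := 64 * (1 + M ^ 2)) (by positivity)
  refine ⟨δ₀, hδ₀, α, hα, ?_⟩
  intro S N L hL φ₀ φ₁ φ₀s φ₁s Us Fs F hUs hFs hF hLU hbU hbFs hbF δ hδ hFF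
  have h23 : (2 : ℕ) ≤ 3 := by norm_num
  have hzero : Us - Fs ∈ zeroSpace N A S := BoundaryConditions.zeroComponent_sub hUs hFs hbU hbFs
  refine ⟨L.exists_isMinimizer S (fun n => (hF n).mono h23) (pow_pos hδ.1 2) ⟨_, hzero⟩, ?_⟩
  intro V hV
  obtain ⟨h1, h2⟩ := hV.bounds hL hUs hFs hF hLU hzero hδ.1 hFF
  have hW : ∀ n, ZeroComponent A S ((V - (Us - Fs)) n) := fun n =>
    ZeroComponent.sub (hV.1 n) (hzero n)
  have h3 := hstab S N L hL _ hW δ hδ _ h1 h2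
  set E := 1 + sobolevNormVec (cube A) 3 Us + sobolevNormVec (cube A) 3 Fs with hE
  have nU := sobolevNormVec_nonneg (cube A) 3 Us
  have nF := sobolevNormVec_nonneg (cube A) 3 Fs
  have hE1 : 1 ≤ E := by rw [hE]; linarith
  rw [abs_of_pos (by linarith)] at h3
  have hsub := subdomain_subset A ε S
  have hO := isOpen_subdomain A ε S
  have hFFm : MemSobolevVec (cube A) 2 (F - Fs) := fun n =>
    ((hF n).mono h23).sub ((hFs n).mono h23)
  have h4 : sobolevNormVec (subdomain A ε S) 2 (F - Fs) ≤ E * δ ^ α := by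
    refine (sobolevNormVec_mono_set hO hsub hFFm).trans (hFF.trans ?_)
    -- The data error is of order `δ`, which is smaller than the Hölder rate because `δ < 1` and `α
    -- < 1`.
    have hδα : δ ≤ δ ^ α := by
      conv_lhs => rw [← Real.rpow_one δ]
      exact Real.rpow_le_rpow_of_exponent_ge hδ.1 (hδ.2.trans hδ₀.2).le
        (hα.2.le.trans (by norm_num))
    exact hδα.trans (le_mul_of_one_le_left (Real.rpow_nonneg hδ.1.le _) hE1)
  have e : V + F - Us = (V - (Us - Fs)) + (F - Fs) := by abel
  rw [e]
  have hE0 : 0 ≤ E * δ ^ α := mul_nonneg (by linarith) (Real.rpow_nonneg hδ.1.le _)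
  have h5 := sobolevNormVec_add_sq_le hO (fun n => (((hW n).1.mono h23).subset hsub))
    (fun n => (hFFm n).subset hsub)
  have h6 := pow_le_pow_left₀ (sobolevNormVec_nonneg _ _ _) h3 2
  have h7 := pow_le_pow_left₀ (sobolevNormVec_nonneg _ _ _) h4 2
  refine (pow_le_pow_iff_left₀ (sobolevNormVec_nonneg _ _ _) (by linarith) two_ne_zero).1
    (h5.trans ?_)
  nlinarith
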